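/- Let $K\subset\mathbb C$ be an imaginary quadratic field with ring of integers $\mathcal O$, finite adeles $\mathbb A_{K,f}$ and $\hat{\mathcal O}\subset\mathbb A_{K,f}$ the subring of integral adeles. A ($1$-dimensional) $K$-lattice $(\Lambda,\phi)$ is a finitely generated $\mathcal O$-submodule $\Lambda\subset\mathbb C$ with $\Lambda\otimes_{\mathcal O}K\cong K$, together with an $\mathcal O$-module morphism $\phi:K/\mathcal O\to K\Lambda/\Lambda$. Two $K$-lattices are commensurable if $K\Lambda=K\Lambda'$ and $\phi=\phi'$ modulo $\Lambda+\Lambda'$. Let $\tilde{\mathcal R}_K$ be the étale groupoid of pairs of commensurable $K$-lattices. Its topology is the quotient topology for the map $((\rho,s),g)\mapsto(L,L')$, where $\rho\in\hat{\mathcal O}$, $s=(s_f,s_\infty)\in\mathbb A_{K,f}^*\times\mathbb C^*$, $g\in\mathbb A_{K,f}^*$, $g\rho\in\hat{\mathcal O}$, $L$ is the $K$-lattice $\Lambda=s_\infty^{-1}(s_f\hat{\mathcal O}\cap K)$, $\phi=s_\infty^{-1}(s_f\rho)$, and $L'$ is obtained in the same way from $(g\rho,g^{-1}s)$. Let $G_K=\tilde{\mathcal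 R}_K/\mathbb C^*$ be its quotient by scaling, so that functions on $G_K$ are the functions $f(L,L')$ of commensurable pairs with $f(\lambda L,\lambda L')=f(L,L')$ for $\lambda\in\mathbb C^*$. Let $\mathcal A_K=C^*(G_K)$ be the completion of $C_c(G_K)$, with the product $(f_1f_2)(L,L')=\sum_{L''}f_1(L,L'')f_2(L'',L')$ and the involution $f^*(L,L')=\overline{f(L',L)}$, in the norm $\|f\|=\sup_y\|\pi_y(f)\|$, where $\pi_y(f)$ is left convolution by $f$ on $\ell^2(\{L: L \text{ commensurable to } y\})$. The time evolution $\sigma_t$ is the strongly continuous one-parameter group of automorphisms of $\mathcal A_K$ with $\sigma_t(f)(L,L')=\left(\mathrm{covol}(\Lambda')/\mathrm{covol}(\Lambda)\right)^{it}f(L,L')$ for $f\in C_c(G_K)$. For an ideal $J\subset\mathcal O$, say that $(\Lambda,\phi)$ is divisible by $J$ if $\phi$ is well defined modulo $J\Lambda$, i.e. lifts to a morphism $K/\mathcal O\to K\Lambda/J\Lambda$. Let $e_J$ be the characteristic function of the set of pairs $(L,L)$ with $L$ divisible by $J$. **Proposition.** For $s\in\hat{\mathcal O}\cap\mathbb A_{K,f}^*$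 put $J=s\hat{\mathcal O}\cap K$. The formula $$\theta_s(f)\big((\Lambda,\phi),(\Lambda',\phi')\big)=\begin{cases}f\big((\Lambda,s^{-1}\phi),(\Lambda',s^{-1}\phi')\big)&\text{if both } K\text{-lattices are divisible by } J,\\0&\text{otherwise}\end{cases}$$ for $f\in C_c(G_K)$, where $s^{-1}\phi$ is the unique morphism $\psi: K/\mathcal O\to K\Lambda/\Lambda$ with $s\psi=\phi$, extends to a (not necessarily unital) $*$-endomorphism $\theta_s$ of $\mathcal A_K$, and $s\mapsto\theta_s$ is an action of the semigroup $\hat{\mathcal O}\cap\mathbb A_{K,f}^*$ on $\mathcal A_K$. Moreover: 1. $e_J$ is a projection in $\mathcal A_K$, and $\theta_s$ is an isomorphism of $\mathcal A_K$ onto the reduced algebra $e_J\mathcal A_Ke_J$. 2. If $s\in\hat{\mathcal O}^*$, then $\theta_s$ is an automorphism of $\mathcal A_K$. 3. If $s\in\mathcal O^\times=\mathcal O\smallsetminus\{0\}$ (diagonally embedded), then $\theta_s$ is inner: $\theta_s(x)=\mu_s\,x\,\mu_s^*$ for all $x\in\mathcal A_K$, where $\mu_s\in C_c(G_K)\subset\mathcal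 A_K$ has the value $1$ on the commensurable pairs $((\Lambda,\phi),(\Lambda',\phi'))$ with $\Lambda=s^{-1}\Lambda'$ and $\phi'=\phi$ (in $K\Lambda/\Lambda$), and $0$ on the others; $\mu_s$ is an isometry, $\mu_s^*\mu_s=1$, with range projection $\mu_s\mu_s^*=e_J$, $J=s\mathcal O$. 4. $\theta_s\,\sigma_t=\sigma_t\,\theta_s$ for all $s\in\hat{\mathcal O}\cap\mathbb A_{K,f}^*$ and $t\in\mathbb R$. -/

import Mathlib

open NumberField IsDedekindDomain Topology
open scoped ENNReal nonZeroDivisors CompactlySupported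

namespace CMSystem

section Adeles

variable (K : Type*) [Field K] [NumberField K]

/-- The ring of finite adeles `𝔸_{K,f}` of `K`. -/
abbrev Af : Type _ := FiniteAdeleRing (𝓞 K) K

/-- The maximal compact subring `Ô` of `𝔸_{K,f}`: the adeles which are integral at every
finite place. -/
noncomputable def Ohat : Subring (Af K) where
  carrier := {a | ∀ v : HeightOneSpectrum (𝓞 K), a v ∈ v.adicCompletionIntegers K}
  zero_mem' := fun v => (v.adicCompletionIntegers K).zero_mem
  one_mem' := fun v => (v.adicCompletionIntegers K).one_mem
  add_mem' := fun ha hb v => (v.adicCompletionIntegers K).add_mem _ _ (ha v) (hb v)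
  mul_mem' := fun ha hb v => (v.adicCompletionIntegers K).mul_mem _ _ (ha v) (hb v)
  neg_mem' := fun ha v => (v.adicCompletionIntegers K).neg_mem _ (ha v)

theorem algebraMap_mem_Ohat (a : 𝓞 K) : algebraMap (𝓞 K) (Af K) a ∈ Ohat K :=
  fun v => v.coe_mem_adicCompletionIntegers a

/-- The multiplicative semigroup `Ô ∩ 𝔸_{K,f}^*`. -/
noncomputable def Sgp : Submonoid (Af K)ˣ := (Ohat K).toSubmonoid.comap (Units.coeHom (Af K))

/-- The inclusion of the semigroup `𝓞^× = 𝓞 ∖ {0}` (diagonally embedded) in `Ô ∩ 𝔸_{K,f}^*`. -/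
noncomputable def diag : (𝓞 K)⁰ →* Sgp K where
  toFun a := ⟨Units.map (algebraMap K (Af K)).toMonoidHom
      (Units.mk0 ((a : 𝓞 K) : K) (by simp)), algebraMap_mem_Ohat K a⟩
  map_one' := by ext; simp
  map_mul' a b := by
    apply Subtype.ext
    apply Units.ext
    simp

variable {K}

/-- The ideal `J = s Ô ∩ K` of `𝓞` attached to `s ∈ Ô ∩ 𝔸_{K,f}^*` (it is contained in `𝓞`
because `s` is integral). -/
noncomputable def idealOf (s : Sgp K) : Ideal (𝓞 K) where
  carrier := {a | ∃ b ∈ Ohat K, algebraMap (𝓞 K) (Af K) a = ((s : (Af K)ˣ) : Af K) * b}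
  zero_mem' := ⟨0, (Ohat K).zero_mem, by simp⟩
  add_mem' := by
    rintro x y ⟨b, hb, hx⟩ ⟨c, hc, hy⟩
    exact ⟨b + c, (Ohat K).add_mem hb hc, by rw [map_add, hx, hy, mul_add]⟩
  smul_mem' := by
    rintro r x ⟨b, hb, hx⟩
    refine ⟨algebraMap (𝓞 K) (Af K) r * b,
      (Ohat K).mul_mem (algebraMap_mem_Ohat K r) hb, ?_⟩
    rw [smul_eq_mul, map_mul, hx]
    ring

end Adeles

section Lattices

variable (K : Type*) [Field K] [NumberField K] [Algebra K ℂ]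

/-- The `𝓞`-submodule `𝓞` of `K`. -/
abbrev OinK : Submodule (𝓞 K) K := LinearMap.range (Algebra.linearMap (𝓞 K) K)

variable {K} in
/-- The `K`-linear span `K Λ` of an `𝓞`-submodule `Λ` of `ℂ`. -/
abbrev KSpan (Λ : Submodule (𝓞 K) ℂ) : Submodule K ℂ := Submodule.span K (Λ : Set ℂ)

/-- A 1-dimensional `K`-lattice `(Λ, φ)`. `Λ` is a finitely generated `𝓞`-submodule of `ℂ`
with `Λ ⊗_𝓞 K ≅ K`; as `Λ` is torsion free, `Λ ⊗_𝓞 K` is the `K`-space `K Λ ⊆ ℂ`, so that the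
condition is that `K Λ` has dimension one. `φ` is a morphism of `𝓞`-modules from `K/𝓞` to
the submodule `K Λ / Λ` of `ℂ / Λ`. -/
@[ext]
structure KLattice where
  /-- the module `Λ` -/
  Λ : Submodule (𝓞 K) ℂ
  fg : Λ.FG
  rank_one : Module.finrank K (KSpan Λ) = 1
  /-- the morphism `φ` -/
  φ : (K ⧸ OinK K) →ₗ[𝓞 K] (ℂ ⧸ Λ)
  φ_mem : ∀ x, ∃ v ∈ KSpan Λ, φ x = Submodule.Quotient.mk v

variable {K}

/-- Commensurability: `K Λ₁ = K Λ₂` and `φ₁ = φ₂` modulo `Λ₁ + Λ₂`. -/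
def Commens (L₁ L₂ : KLattice K) : Prop :=
  KSpan L₁.Λ = KSpan L₂.Λ ∧
    ∀ x, Submodule.factor (le_sup_left : L₁.Λ ≤ L₁.Λ ⊔ L₂.Λ) (L₁.φ x) =
      Submodule.factor (le_sup_right : L₂.Λ ≤ L₁.Λ ⊔ L₂.Λ) (L₂.φ x)

theorem Commens.refl (L : KLattice K) : Commens L L := ⟨rfl, fun _ => rfl⟩

/-- `L' = λ L`, i.e. `Λ' = λ Λ` and `φ' = λ φ`. -/
def IsScaled (c : ℂˣ) (L L' : KLattice K) : Prop :=
  (∀ v : ℂ, v ∈ L.Λ ↔ (c : ℂ) * v ∈ L'.Λ) ∧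
    ∀ (x : K ⧸ OinK K) (v : ℂ), L.φ x = Submodule.Quotient.mk v →
      L'.φ x = Submodule.Quotient.mk ((c : ℂ) * v)

/-- `L = (Λ, φ)` is divisible by the ideal `J`: `φ` is well defined modulo `J Λ`, i.e. it lifts
to a morphism `K/𝓞 → K Λ / J Λ` (the values of a lift are torsion, hence lie in `K Λ / J Λ`). -/
def Divisible (J : Ideal (𝓞 K)) (L : KLattice K) : Prop :=
  ∃ ψ : (K ⧸ OinK K) →ₗ[𝓞 K] (ℂ ⧸ (J • L.Λ)),
    ∀ x, Submodule.factor (Submodule.smul_le_right : J • L.Λ ≤ L.Λ) (ψ x) = L.φ x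

/-- `L' = (Λ, s⁻¹ φ)`, where `L = (Λ, φ)`: the lattices are the same and `φ = s φ'`. Here
`s ∈ Ô` acts on a torsion `𝓞`-module: on the `n`-torsion, it acts as any `a ∈ 𝓞` with
`a ∈ s + n Ô`. -/
def IsQuot (s : Sgp K) (L L' : KLattice K) : Prop :=
  ∃ h : L'.Λ = L.Λ, ∀ (x : K ⧸ OinK K) (n a : 𝓞 K), n ≠ 0 → n • x = 0 →
    (∃ b ∈ Ohat K, algebraMap (𝓞 K) (Af K) a =
      ((s : (Af K)ˣ) : Af K) + algebraMap (𝓞 K) (Af K) n * b) →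
    L.φ x = Submodule.factor h.le (a • L'.φ x)

/-- The covolume of the lattice `Λ` in `ℂ`. -/
noncomputable def covol (L : KLattice K) : ℝ :=
  ZLattice.covolume (AddSubgroup.toIntSubmodule L.Λ.toAddSubgroup)

/-- `|L/L'| = covolume (Λ') / covolume (Λ)`. -/
noncomputable def covolRatio (L L' : KLattice K) : ℝ := covol L' / covol L

/-- The `K`-lattice `L` is represented by the pair `(ρ, s)`, where `ρ ∈ Ô` and
`s = (s_f, s_∞) ∈ 𝔸_{K,f}^* × ℂ^*`: one has `Λ = s_∞⁻¹ (s_f Ô ∩ K)`, and `φ` is the composite of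
multiplication by `s_f ρ : K/𝓞 ≅ 𝔸_{K,f}/Ô → 𝔸_{K,f}/s_f Ô ≅ K/(s_f Ô ∩ K)` with `s_∞⁻¹`. -/
def Represents (ρ : Af K) (sf : (Af K)ˣ) (sinf : ℂˣ) (L : KLattice K) : Prop :=
  (∀ v : ℂ, v ∈ L.Λ ↔ ∃ k : K, v = ((sinf⁻¹ : ℂˣ) : ℂ) * algebraMap K ℂ k ∧
    ∃ b ∈ Ohat K, algebraMap K (Af K) k = (sf : Af K) * b) ∧
  ∀ a k : K, L.φ (Submodule.Quotient.mk a) =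
      Submodule.Quotient.mk (((sinf⁻¹ : ℂˣ) : ℂ) * algebraMap K ℂ k) ↔
    ∃ b ∈ Ohat K, (sf : Af K) * ρ * algebraMap K (Af K) a - algebraMap K (Af K) k =
      (sf : Af K) * b

variable (K) in
/-- The groupoid `R̃_K` of the commensurability relation on 1-dimensional `K`-lattices (not up
to scaling), as a set. -/
abbrev Rel : Type _ := {p : KLattice K × KLattice K // Commens p.1 p.2}

variable (K) in
/-- Parameters `((ρ, s), g)`: here `ρ ∈ Ô`, `s ∈ 𝔸_K^* = 𝔸_{K,f}^* × ℂ^*`, and `g ∈ 𝔸_{K,f}^*` is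
such that `g ρ ∈ Ô`, together with the commensurable pair `(L, L')` which they describe: `L` is
represented by `(ρ, s)` and `L'` by `(g ρ, g⁻¹ s)`. -/
abbrev Param : Type _ :=
  {p : (Af K × (Af K)ˣ × ℂˣ × (Af K)ˣ) × Rel K //
    p.1.1 ∈ Ohat K ∧ (p.1.2.2.2 : Af K) * p.1.1 ∈ Ohat K ∧
    Represents p.1.1 p.1.2.1 p.1.2.2.1 p.2.1.1 ∧
    Represents ((p.1.2.2.2 : Af K) * p.1.1) (p.1.2.2.2⁻¹ * p.1.2.1) p.1.2.2.1 p.2.1.2}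

/-- The topology of `R̃_K`: the quotient topology for the map `((ρ, s), g) ↦ (L, L')`, where the
set of the parameters `((ρ, s), g)`, which determine `(L, L')`, is topologized as a subset of
`𝔸_{K,f} × 𝔸_{K,f}^* × ℂ^* × 𝔸_{K,f}^*`. -/
noncomputable instance : TopologicalSpace (Rel K) :=
  TopologicalSpace.coinduced (fun p : Param K => p.1.2)
    (TopologicalSpace.induced (fun p : Param K => p.1.1) inferInstance)

variable (K) in
/-- The quotient `G_K = R̃_K / ℂ^*` by scaling, with the quotient topology. -/
abbrev GK : Type _ :=
  Quot (fun γ γ' : Rel K => ∃ c : ℂˣ, IsScaled c γ.1.1 γ'.1.1 ∧ IsScaled c γ.1.2 γ'.1.2)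

open Classical in
/-- The value `f(L, L')` of a function on `G_K`, i.e. of a weight zero function on `R̃_K`; it is
extended by zero to the pairs which are not commensurable. -/
noncomputable def ev (f : C_c(GK K, ℂ)) (L L' : KLattice K) : ℂ :=
  if h : Commens L L' then f (Quot.mk _ ⟨(L, L'), h⟩) else 0

/-- The Hilbert space `H_y = ℓ²((G_K)_y)`; the elements of `G_K` with source `y` are the classes
of the pairs `(L, y)` with `L` commensurable to `y`. -/
abbrev Hy (y : KLattice K) : Type _ :=
  lp (fun _ : {L : KLattice K // Commens L y} => ℂ) 2

noncomputable instance (y : KLattice K) : Nontrivial (Hy y) := by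
  classical
  refine ⟨lp.single 2 ⟨y, Commens.refl y⟩ (1 : ℂ), 0, fun h => ?_⟩
  have := congrArg (fun ξ : Hy y => ξ ⟨y, Commens.refl y⟩) h
  simp at this

variable (K) in
/-- The C*-algebra of bounded families `(T_y)_y` of operators `T_y` on `H_y`, with the norm
`sup_y ‖T_y‖`. -/
def Ops : Type _ := lp (fun y : KLattice K => Hy y →L[ℂ] Hy y) ∞

noncomputable instance : NormedRing (Ops K) :=
  inferInstanceAs (NormedRing (lp (fun y : KLattice K => Hy y →L[ℂ] Hy y) ∞))

noncomputable instance : StarRing (Ops K) :=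
  inferInstanceAs (StarRing (lp (fun y : KLattice K => Hy y →L[ℂ] Hy y) ∞))

instance : CStarRing (Ops K) :=
  inferInstanceAs (CStarRing (lp (fun y : KLattice K => Hy y →L[ℂ] Hy y) ∞))

noncomputable instance : NormedAlgebra ℂ (Ops K) :=
  inferInstanceAs (NormedAlgebra ℂ (lp (fun y : KLattice K => Hy y →L[ℂ] Hy y) ∞))

instance : StarModule ℂ (Ops K) :=
  inferInstanceAs (StarModule ℂ (lp (fun y : KLattice K => Hy y →L[ℂ] Hy y) ∞))

instance : CompleteSpace (Ops K) :=
  inferInstanceAs (CompleteSpace (lp (fun y : KLattice K => Hy y →L[ℂ] Hy y) ∞))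

noncomputable instance : CStarAlgebra (Ops K) where

/-- The component `T_y` of a family `T = (T_y)_y`. -/
noncomputable def Ops.at (T : Ops K) (y : KLattice K) : Hy y →L[ℂ] Hy y :=
  (show lp (fun y : KLattice K => Hy y →L[ℂ] Hy y) ∞ from T).1 y

/-- `T = (π_y(f))_y`, where `π_y(f)` is left convolution by `f` on `H_y`:
`(π_y(f) ξ)(L, y) = ∑_{L'} f(L, L') ξ(L', y)`. -/
def IsConv (f : C_c(GK K, ℂ)) (T : Ops K) : Prop :=
  ∀ (y : KLattice K) (ξ : Hy y) (L : {L : KLattice K // Commens L y}),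
    HasSum (fun L' : {L : KLattice K // Commens L y} => ev f L.1 L'.1 * ξ L') (T.at y ξ L)

variable (K) in
/-- The C*-algebra `A_K = C*(G_K)` of the CM system: the closure, for the norm
`‖f‖ = sup_y ‖π_y(f)‖`, of the *-algebra of the compactly supported continuous functions on
`G_K`, acting by left convolution. -/
noncomputable def AK : StarSubalgebra ℂ (Ops K) :=
  (StarAlgebra.adjoin ℂ {T : Ops K | ∃ f : C_c(GK K, ℂ), IsConv f T}).topologicalClosure

/-- `g = σ_t(f)` on functions: `g(L, L') = |L/L'|^{it} f(L, L')`. -/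
def IsSigma (t : ℝ) (f g : C_c(GK K, ℂ)) : Prop :=
  ∀ L L' : KLattice K, Commens L L' →
    ev g L L' = (covolRatio L L' : ℂ) ^ (Complex.I * (t : ℂ)) * ev f L L'

/-- `g = θ_s(f)` on functions: `g((Λ, φ), (Λ', φ')) = f((Λ, s⁻¹ φ), (Λ', s⁻¹ φ'))` if both
`K`-lattices are divisible by `J = s Ô ∩ K`, and `0` otherwise. -/
def IsTheta (s : Sgp K) (f g : C_c(GK K, ℂ)) : Prop :=
  ∀ L L' : KLattice K, Commens L L' →
    (Divisible (idealOf s) L ∧ Divisible (idealOf s) L' →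
      ∃ M M' : KLattice K, IsQuot s L M ∧ IsQuot s L' M' ∧ ev g L L' = ev f M M') ∧
    (¬ (Divisible (idealOf s) L ∧ Divisible (idealOf s) L') → ev g L L' = 0)

open Classical in
/-- `e = e_J`: the characteristic function of the set of units `(L, L)` with `L` divisible
by `J`. -/
def IsProj (J : Ideal (𝓞 K)) (e : C_c(GK K, ℂ)) : Prop :=
  ∀ L L' : KLattice K, Commens L L' →
    ev e L L' = if L = L' ∧ Divisible J L then 1 else 0

open Classical in
/-- `m = μ_a`, for `a ∈ 𝓞 ∖ {0}`: on commensurable pairs, `m((Λ, φ), (Λ', φ'))` is `1` if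
`Λ = a⁻¹ Λ'` and `φ = φ'` (in `K Λ / Λ`, to which `K Λ' / Λ'` maps), and `0` otherwise. -/
def IsMu (a : 𝓞 K) (m : C_c(GK K, ℂ)) : Prop :=
  ∀ L L' : KLattice K, Commens L L' →
    ev m L L' = if (∀ v : ℂ, v ∈ L.Λ ↔ a • v ∈ L'.Λ) ∧
      (∃ h : L'.Λ ≤ L.Λ, ∀ x, L.φ x = Submodule.factor h (L'.φ x)) then 1 else 0

end Lattices

end CMSystem

/-! Everything is read off from ideles. Once a generator `c⁻¹` of the line `K Λ` is fixed, a
`K`-lattice is a pair `(ρ, s)`: `Λ` is `c⁻¹ (s Ô ∩ K)` and `φ` is multiplication by `s ρ`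
(`exists_rep`, which rests on strong approximation and on the compactness of `Ô`). The lattice
depends only on `s Ô` and on the adele `s ρ` (`Represents.eq_iff`), and two lattices on the same
line are commensurable exactly when their adeles `s ρ` agree (`Represents.commens_iff`). Inside a
commensurability class a lattice is therefore determined by `s` modulo `Ô^*`. Three operations
matter: `mulL t` sends `(ρ, s, c)` to `(tρ, s, c)`, `scaleL` changes `c` only, and `enlarge a` gives
`(aρ, a⁻¹s, c)`.

The map `mulL t` is injective, preserves and reflects commensurability, and its image consists of
the lattices divisible by the ideal of `t` (`divisible_iff`). On `G_K` it becomes an open embedding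
with closed range, so that `θ_t` on functions is extension by zero along it.

The class `idx` of `s s'⁻¹` modulo `Ô^*` is locally constant on `G_K`, and its fibers are compact
because the class group is finite (`isCompact_idxGK_fiber`). On each commensurability class a fiber
is the graph of a partial bijection. Hence a compactly supported function is a finite sum of
weighted partial permutations, so it acts boundedly (`exists_isConv`), and `e_J` and `μ_a` are
compactly supported.

The map `θ_s` is first defined on all bounded families of operators, as conjugation by the
isometries `L ↦ sL` from the class of some `z` to the class of `y`, where `sz` is commensurable to
`y` (`thetaOps`); `σ_t` is conjugation by diagonal unitaries (`sigmaOps`). Identities are checked on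
matrix coefficients of convolution operators and carried to `A_K` by `AK_induction`.

For principal `a`, `mulL (diag K a)` is `enlarge a` up to scaling, and `enlarge a L` is
commensurable to `L`; functions on `G_K` ignore scaling, so `θ_a` is conjugation by the isometry
`μ_a` (`theta_diag`). For general `s` there is `t` with `st = a` principal (`exists_mul_eq_diag`).
Injectivity of `θ_s` and the computation of its range then follow formally from `theta_diag` and
`θ_s(μ_a) = μ_a e_J` (`theta_muCc`). -/

namespace CMSystem

set_option linter.unusedSectionVars false

/-! ### Local integers: density of `𝓞` and compactness. -/

section LocalIntegers

open IsDedekindDomain.HeightOneSpectrum WithZero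

variable (K : Type*) [Field K] [NumberField K]

/-- Density in two stages: `K` is dense in the completion, and a `v`-integral element of `K` is
approximated by elements of `𝓞`. -/
theorem exists_integer_valued_sub_lt (v : HeightOneSpectrum (𝓞 K)) (x : v.adicCompletion K)
    (hx : x ∈ v.adicCompletionIntegers K) (γ : (ℤᵐ⁰)ˣ) :
    ∃ a : 𝓞 K, Valued.v (x - ((a : K) : v.adicCompletion K)) < γ := by
  -- The minimum with `1` forces the approximating element of `K` to be `v`-integral.
  have hopen : IsOpen {y : v.adicCompletion K | Valued.v (x - y) < min (γ : ℤᵐ⁰) 1} := by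
    obtain ⟨y₀, hy₀⟩ := valuedAdicCompletion_surjective K v (min (γ : ℤᵐ⁰) 1)
    have : IsOpen {y : v.adicCompletion K | Valued.v y < min (γ : ℤᵐ⁰) 1} := by
      have h : {y : v.adicCompletion K | Valued.v y < min (γ : ℤᵐ⁰) 1} =
          {y | Valued.v.restrict y < Valued.v.restrict y₀} :=
        Set.ext fun y => by
          rw [Set.mem_ofPred_eq, Set.mem_ofPred_eq, Valuation.restrict_lt_iff, hy₀]
      rw [h]
      exact Valued.isOpen_ball _ _
    exact this.preimage (continuous_const.sub continuous_id)
  obtain ⟨k, hk⟩ := (HeightOneSpectrum.denseRange_algebraMap (R := 𝓞 K) K v).exists_mem_open hopen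
    ⟨x, by simp⟩
  rw [HeightOneSpectrum.algebraMap_adicCompletion] at hk
  simp only [Function.comp, Set.mem_ofPred_eq, lt_min_iff, Algebra.algebraMap_self,
    RingHom.id_apply] at hk
  have hk1 : v.valuation K k ≤ 1 := by
    rw [← valuedAdicCompletion_eq_valuation']
    have := (v.adicCompletionIntegers K).sub_mem hx
      ((mem_adicCompletionIntegers (𝓞 K) K v).2 hk.2.le)
    rw [sub_sub_cancel] at this
    exact this
  obtain ⟨a, ha⟩ := exists_valuation_sub_lt_of_integer v hk1 γ
  refine ⟨a, ?_⟩
  have : x - ((a : K) : v.adicCompletion K) =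
      (x - (k : v.adicCompletion K)) - (((a - k : K)) : v.adicCompletion K) := by
    rw [sub_eq_add_neg (a : K), adicCompletion.coe_add]
    have : (((-k : K)) : v.adicCompletion K) = -(k : v.adicCompletion K) :=
      map_neg (FinitePlace.embedding v) k
    rw [this]; ring
  rw [this]
  refine (Valuation.map_sub _ _ _).trans_lt (max_lt hk.1 ?_)
  rw [valuedAdicCompletion_eq_valuation']
  exact ha

/-- A complete discrete valuation ring with finite residue field is compact. By density of `𝓞`, the
finite ring `𝓞 / v` maps onto the residue field. -/
instance (v : HeightOneSpectrum (𝓞 K)) : CompactSpace (v.adicCompletionIntegers K) := by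
  have h1 : CompleteSpace (Valued.integer (v.adicCompletion K)) :=
    (Valued.isClosed_integer (v.adicCompletion K)).isComplete.completeSpace_coe
  have h2 : IsDiscreteValuationRing (Valued.integer (v.adicCompletion K)) :=
    inferInstanceAs (IsDiscreteValuationRing (v.adicCompletionIntegers K))
  have h3 : Finite (IsLocalRing.ResidueField (Valued.integer (v.adicCompletion K))) := by
    let f : 𝓞 K →+* IsLocalRing.ResidueField (Valued.integer (v.adicCompletion K)) :=
      (IsLocalRing.residue (Valued.integer (v.adicCompletion K))).comp
        (algebraMap (𝓞 K) (v.adicCompletionIntegers K))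
    have hf : ∀ a ∈ v.asIdeal, f a = 0 := by
      intro a ha
      refine (IsLocalRing.residue_eq_zero_iff _).2 ?_
      rw [IsLocalRing.mem_maximalIdeal, mem_nonunits_iff,
        Valuation.Integer.not_isUnit_iff_valuation_lt_one]
      change Valued.v ((a : K) : v.adicCompletion K) < 1
      rw [valuedAdicCompletion_eq_valuation']
      exact (valuation_lt_one_iff_mem v a).2 ha
    have : Finite (𝓞 K ⧸ v.asIdeal) := Ideal.finiteQuotientOfFreeOfNeBot _ v.ne_bot
    refine Finite.of_surjective (Ideal.Quotient.lift v.asIdeal f hf) ?_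
    refine Ideal.Quotient.lift_surjective_of_surjective _ _ fun y => ?_
    obtain ⟨x, rfl⟩ := IsLocalRing.residue_surjective y
    obtain ⟨a, ha⟩ := exists_integer_valued_sub_lt K v x.1 x.2 1
    refine ⟨a, ?_⟩
    change IsLocalRing.residue _ _ = IsLocalRing.residue _ x
    rw [← sub_eq_zero, ← map_sub, IsLocalRing.residue_eq_zero_iff, IsLocalRing.mem_maximalIdeal,
      mem_nonunits_iff, Valuation.Integer.not_isUnit_iff_valuation_lt_one]
    rw [← Valuation.map_neg]
    simpa [algebraMap_adicCompletionIntegers_apply] using! ha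
  exact
    Valued.integer.compactSpace_iff_completeSpace_and_isDiscreteValuationRing_and_finite_residueField.2
      ⟨h1, h2, h3⟩

end LocalIntegers

/-! ### Finite adeles: topology of `Ô` and strong approximation. -/

section Adeles

variable {K : Type*} [Field K] [NumberField K]

open IsDedekindDomain.HeightOneSpectrum WithZero

theorem isOpen_Ohat : IsOpen (Ohat K : Set (Af K)) :=
  RestrictedProduct.isOpen_forall_mem (R := fun v : HeightOneSpectrum (𝓞 K) => v.adicCompletion K)
    (A := fun v => (v.adicCompletionIntegers K : Set (v.adicCompletion K)))
    fun _ => Valued.isOpen_valuationSubring _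

/-- By Tychonoff the product of the local integer rings is compact, and `Ô` is its image under the
continuous structure map. -/
theorem isCompact_Ohat : IsCompact (Ohat K : Set (Af K)) := by
  have : CompactSpace ((v : HeightOneSpectrum (𝓞 K)) →
      ((v.adicCompletionIntegers K : Set (v.adicCompletion K)) : Type _)) :=
    inferInstanceAs (CompactSpace ((v : HeightOneSpectrum (𝓞 K)) → v.adicCompletionIntegers K))
  have := isCompact_range
    (RestrictedProduct.isEmbedding_structureMap
      (R := fun v : HeightOneSpectrum (𝓞 K) => v.adicCompletion K)
      (A := fun v => (v.adicCompletionIntegers K : Set (v.adicCompletion K)))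
      (𝓕 := Filter.cofinite)).continuous
  convert! this
  refine Set.ext fun a => ?_
  constructor
  · intro h
    exact ⟨fun v => ⟨a v, h v⟩, rfl⟩
  · rintro ⟨b, rfl⟩ v
    exact (b v).2

theorem isClosed_Ohat : IsClosed (Ohat K : Set (Af K)) :=
  (Ohat K).toAddSubgroup.isClosed_of_isOpen isOpen_Ohat

theorem algebraMap_Af_coe (a : 𝓞 K) :
    algebraMap (𝓞 K) (Af K) a = algebraMap K (Af K) (a : K) := rfl

theorem mul_apply_Af (a b : Af K) (v : HeightOneSpectrum (𝓞 K)) : (a * b) v = a v * b v := rfl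

theorem sub_apply_Af (a b : Af K) (v : HeightOneSpectrum (𝓞 K)) : (a - b) v = a v - b v := rfl

theorem valued_algebraMap_Af (k : K) (v : HeightOneSpectrum (𝓞 K)) :
    Valued.v (algebraMap K (Af K) k v) = v.valuation K k :=
  valuedAdicCompletion_eq_valuation' v k

theorem mem_Ohat_iff {a : Af K} :
    a ∈ Ohat K ↔ ∀ v : HeightOneSpectrum (𝓞 K), Valued.v (a v) ≤ 1 := Iff.rfl

theorem exists_coe_eq_of_mem_Ohat {k : K} (hk : algebraMap K (Af K) k ∈ Ohat K) :
    ∃ a : 𝓞 K, (a : K) = k :=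
  HeightOneSpectrum.mem_integers_of_valuation_le_one K k fun v => by
    have := hk v
    rwa [mem_adicCompletionIntegers, FiniteAdeleRing.algebraMap_apply,
      valuedAdicCompletion_eq_valuation'] at this

/-- Only finitely many components fail to be integral, so a product of local denominators clears
them all. -/
theorem exists_integer_mul_mem_Ohat (a : Af K) :
    ∃ n : 𝓞 K, n ≠ 0 ∧ algebraMap (𝓞 K) (Af K) n * a ∈ Ohat K := by
  classical
  have hfin : {v : HeightOneSpectrum (𝓞 K) | ¬ Valued.v (a v) ≤ 1}.Finite :=
    Filter.eventually_cofinite.1 a.2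
  choose b hb hab using fun v : HeightOneSpectrum (𝓞 K) =>
    adicCompletion.mul_nonZeroDivisor_mem_adicCompletionIntegers v (a v)
  refine ⟨∏ v ∈ hfin.toFinset, b v,
    Finset.prod_ne_zero_iff.2 fun v _ => nonZeroDivisors.ne_zero (hb v), fun v => ?_⟩
  rw [mul_apply_Af]
  by_cases hv : Valued.v (a v) ≤ 1
  · exact (v.adicCompletionIntegers K).mul_mem _ _ (algebraMap_mem_Ohat K _ v) hv
  · rw [← Finset.mul_prod_erase _ _ (hfin.mem_toFinset.2 hv), map_mul, mul_apply_Af,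
      mul_right_comm]
    refine (v.adicCompletionIntegers K).mul_mem _ _ ?_ (algebraMap_mem_Ohat K _ v)
    have := hab v
    rw [mul_comm] at this
    exact this

/-- Strong approximation, `𝔸_{K,f} = K + Ô`. After clearing denominators by `n`, the Chinese
remainder theorem gives `y ∈ 𝓞` close to `n a` at the places dividing `n`; at the other places `n`
is a unit and nothing is required. Then `k = y / n`. -/
theorem exists_sub_mem_Ohat (a : Af K) : ∃ k : K, a - algebraMap K (Af K) k ∈ Ohat K := by
  classical
  obtain ⟨n, hn, hna⟩ := exists_integer_mul_mem_Ohat a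
  have hn' : (n : K) ≠ 0 := by simpa using hn
  have hfin : {v : HeightOneSpectrum (𝓞 K) | v.asIdeal ∣ Ideal.span {n}}.Finite :=
    Ideal.finite_factors (by simpa using hn)
  have hγ : ∀ v : HeightOneSpectrum (𝓞 K), v.intValuation n ≠ 0 :=
    fun v => v.intValuation_ne_zero n hn
  choose x hx using fun v : HeightOneSpectrum (𝓞 K) =>
    exists_integer_valued_sub_lt K v _ (hna v) (Units.mk0 _ (hγ v))
  obtain ⟨y, hy⟩ := IsDedekindDomain.exists_forall_sub_mem_ideal (s := hfin.toFinset)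
    (fun v : HeightOneSpectrum (𝓞 K) => v.asIdeal)
    (fun v => multiplicity v.asIdeal (Ideal.span {n})) (fun v _ => v.prime)
    (fun v _ w _ hvw h => hvw (HeightOneSpectrum.ext h)) (fun v => x v.1)
  refine ⟨(y : K) / n, mem_Ohat_iff.2 fun v => ?_⟩
  have hv0 : 0 < v.intValuation n := zero_lt_iff.2 (hγ v)
  have key : Valued.v ((algebraMap (𝓞 K) (Af K) n * a - algebraMap (𝓞 K) (Af K) y) v) ≤
      v.intValuation n := by
    by_cases hv : v.asIdeal ∣ Ideal.span {n}
    · have h1 : (algebraMap (𝓞 K) (Af K) n * a - algebraMap (𝓞 K) (Af K) y) v =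
          ((algebraMap (𝓞 K) (Af K) n * a) v - ((x v : K) : v.adicCompletion K)) -
            algebraMap (𝓞 K) (Af K) (y - x v) v := by
        rw [map_sub, sub_apply_Af, sub_apply_Af]
        change _ = _ - _ - (_ - ((x v : K) : v.adicCompletion K))
        ring
      rw [h1]
      refine (Valuation.map_sub _ _ _).trans (max_le (hx v).le ?_)
      rw [algebraMap_Af_coe, valued_algebraMap_Af, valuation_of_algebraMap,
        intValuation_eq_exp_neg_multiplicity v hn]
      exact (intValuation_le_pow_iff_mem v _ _).2 (hy v (hfin.mem_toFinset.2 hv))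
    · have : v.intValuation n = 1 :=
        le_antisymm (v.intValuation_le_one n)
          (not_lt.1 fun h => hv ((intValuation_lt_one_iff_dvd v n).1 h))
      rw [this]
      exact (Ohat K).sub_mem hna (algebraMap_mem_Ohat K y) v
  have h2 : algebraMap (𝓞 K) (Af K) n * a - algebraMap (𝓞 K) (Af K) y =
      algebraMap K (Af K) n * (a - algebraMap K (Af K) ((y : K) / n)) := by
    rw [mul_sub, ← map_mul, mul_div_cancel₀ _ hn']
    rfl
  rw [h2, mul_apply_Af, map_mul, valued_algebraMap_Af, valuation_of_algebraMap] at key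
  exact le_of_mul_le_mul_left (by simpa using key) hv0

/-- At a place where `r` does not vanish, a suitable `k` has a pole large enough to make `r k`
non-integral. This is what makes an adele recoverable from its action on `K` modulo a ball. -/
theorem eq_zero_of_forall_mul_mem_Ohat {r : Af K}
    (h : ∀ k : K, r * algebraMap K (Af K) k ∈ Ohat K) : r = 0 := by
  refine FiniteAdeleRing.ext K fun v => ?_
  by_contra hv
  have h0 : Valued.v (r v) ≠ 0 := (Valuation.ne_zero_iff _).2 hv
  obtain ⟨k, hk⟩ := valuation_surjective K v ((Valued.v (r v))⁻¹ * exp 1)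
  have := mem_Ohat_iff.1 (h k) v
  rw [mul_apply_Af, map_mul, valued_algebraMap_Af, hk, mul_inv_cancel_left₀ h0] at this
  exact absurd this (not_le.2 (by rw [← exp_zero, exp_lt_exp]; exact zero_lt_one))

end Adeles

/-! ### Ideles, the modules `s Ô`, and fractional ideals. -/

section Ideles

variable {K : Type*} [Field K] [NumberField K]

open IsDedekindDomain.HeightOneSpectrum WithZero

variable (K) in
/-- The group `Ô^*` of units of `Ô`. -/
def OhatUnits : Subgroup (Af K)ˣ where
  carrier := {u | (u : Af K) ∈ Ohat K ∧ ((u⁻¹ : (Af K)ˣ) : Af K) ∈ Ohat K}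
  one_mem' := ⟨(Ohat K).one_mem, by simp⟩
  mul_mem' := fun ha hb => ⟨(Ohat K).mul_mem ha.1 hb.1, by
    rw [mul_inv, Units.val_mul]; exact (Ohat K).mul_mem ha.2 hb.2⟩
  inv_mem' := fun ha => ⟨ha.2, by rw [inv_inv]; exact ha.1⟩

theorem mem_OhatUnits {u : (Af K)ˣ} :
    u ∈ OhatUnits K ↔ (u : Af K) ∈ Ohat K ∧ ((u⁻¹ : (Af K)ˣ) : Af K) ∈ Ohat K := Iff.rfl

/-- The `𝓞`-submodule `s Ô` of the finite adeles. -/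
def ball (s : (Af K)ˣ) : Submodule (𝓞 K) (Af K) where
  carrier := {x | ((s⁻¹ : (Af K)ˣ) : Af K) * x ∈ Ohat K}
  zero_mem' := by simp
  add_mem' := fun ha hb => by
    simpa only [Set.mem_ofPred_eq, mul_add] using (Ohat K).add_mem ha hb
  smul_mem' := fun r x hx => by
    rw [Set.mem_ofPred_eq, Algebra.smul_def, mul_left_comm]
    exact (Ohat K).mul_mem (algebraMap_mem_Ohat K r) hx

theorem mem_ball {s : (Af K)ˣ} {x : Af K} :
    x ∈ ball s ↔ ((s⁻¹ : (Af K)ˣ) : Af K) * x ∈ Ohat K := Iff.rfl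

theorem mem_ball_iff_exists {s : (Af K)ˣ} {x : Af K} :
    x ∈ ball s ↔ ∃ b ∈ Ohat K, x = (s : Af K) * b :=
  ⟨fun h => ⟨_, h, by simp⟩, by rintro ⟨b, hb, rfl⟩; simpa [mem_ball] using hb⟩

theorem self_mem_ball (s : (Af K)ˣ) : (s : Af K) ∈ ball s := by
  simp [mem_ball]

theorem mul_mem_ball {s : (Af K)ˣ} {x : Af K} {b : Af K} (hb : b ∈ Ohat K) (hx : x ∈ ball s) :
    b * x ∈ ball s := by
  rw [mem_ball, mul_left_comm]
  exact (Ohat K).mul_mem hb hx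

theorem mul_mem_ball_mul {s t : (Af K)ˣ} {x : Af K} :
    (t : Af K) * x ∈ ball (t * s) ↔ x ∈ ball s := by
  rw [mem_ball, mem_ball, mul_inv, Units.val_mul, mul_right_comm, mul_assoc, mul_assoc,
    Units.inv_mul_cancel_left, mul_comm]

theorem ball_le_iff {s s' : (Af K)ˣ} :
    ball s ≤ ball s' ↔ ((s'⁻¹ * s : (Af K)ˣ) : Af K) ∈ Ohat K := by
  constructor
  · intro h
    exact h (self_mem_ball s)
  · intro h x hx
    have := (Ohat K).mul_mem h hx
    rw [mem_ball]
    simpa [mul_assoc] using this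

theorem ball_eq_iff {s s' : (Af K)ˣ} : ball s = ball s' ↔ s'⁻¹ * s ∈ OhatUnits K := by
  rw [le_antisymm_iff, ball_le_iff, ball_le_iff, mem_OhatUnits, mul_inv, inv_inv, mul_comm s']

/-- The idele attached to a nonzero element of `K`. -/
noncomputable def idele : Kˣ →* (Af K)ˣ := Units.map (algebraMap K (Af K)).toMonoidHom

@[simp]
theorem idele_val (k : Kˣ) : ((idele k : (Af K)ˣ) : Af K) = algebraMap K (Af K) (k : K) := rfl

theorem exists_mul_mem_ball (x : Af K) (s : (Af K)ˣ) :
    ∃ w : (Af K)ˣ, ∀ y ∈ ball w, x * y ∈ ball s := by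
  obtain ⟨n, hn, h⟩ := exists_integer_mul_mem_Ohat (((s⁻¹ : (Af K)ˣ) : Af K) * x)
  have hn' : (n : K) ≠ 0 := by simpa using hn
  refine ⟨idele (Units.mk0 (n : K) hn'), fun y hy => ?_⟩
  obtain ⟨b, hb, rfl⟩ := mem_ball_iff_exists.1 hy
  rw [mem_ball]
  convert (Ohat K).mul_mem h hb using 1
  rw [idele_val, Units.val_mk0, algebraMap_Af_coe]
  ring

theorem exists_ball_le_inf (s s' : (Af K)ˣ) : ∃ w : (Af K)ˣ, ball w ≤ ball s ∧ ball w ≤ ball s' := by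
  obtain ⟨n, hn, h⟩ := exists_integer_mul_mem_Ohat ((s⁻¹ : (Af K)ˣ) : Af K)
  obtain ⟨n', hn', h'⟩ := exists_integer_mul_mem_Ohat ((s'⁻¹ : (Af K)ˣ) : Af K)
  have hnn : ((n * n' : 𝓞 K) : K) ≠ 0 := by simpa using ⟨hn, hn'⟩
  refine ⟨idele (Units.mk0 _ hnn), ball_le_iff.2 ?_, ball_le_iff.2 ?_⟩
  · convert (Ohat K).mul_mem h (algebraMap_mem_Ohat K n') using 1
    simp only [Units.val_mul, idele_val, Units.val_mk0, map_mul, algebraMap_Af_coe]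
    ring
  · convert (Ohat K).mul_mem h' (algebraMap_mem_Ohat K n) using 1
    simp only [Units.val_mul, idele_val, Units.val_mk0, map_mul, algebraMap_Af_coe]
    ring

theorem exists_sub_mem_ball (x : Af K) (s : (Af K)ˣ) :
    ∃ k : K, x - algebraMap K (Af K) k ∈ ball s := by
  obtain ⟨n, hn, h⟩ := exists_integer_mul_mem_Ohat ((s⁻¹ : (Af K)ˣ) : Af K)
  have hn' : (n : K) ≠ 0 := by simpa using hn
  obtain ⟨k, hk⟩ := exists_sub_mem_Ohat (algebraMap K (Af K) (n : K)⁻¹ * x)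
  refine ⟨n * k, ?_⟩
  rw [mem_ball]
  convert (Ohat K).mul_mem h hk using 1
  rw [algebraMap_Af_coe, map_mul, mul_sub]
  have : algebraMap K (Af K) n * algebraMap K (Af K) (n : K)⁻¹ = 1 := by
    rw [← map_mul, mul_inv_cancel₀ hn', map_one]
  linear_combination (((s⁻¹ : (Af K)ˣ) : Af K) * x) * (-this)

/-- The fractional ideal `s Ô ∩ K`. -/
noncomputable def fid (s : (Af K)ˣ) : Submodule (𝓞 K) K :=
  (ball s).comap (IsScalarTower.toAlgHom (𝓞 K) K (Af K)).toLinearMap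

theorem mem_fid {s : (Af K)ˣ} {k : K} : k ∈ fid s ↔ algebraMap K (Af K) k ∈ ball s := Iff.rfl

/-- Density of `K`: an element of `ball s` differs from an element of `fid s` by something in a ball
contained in both `ball s` and `ball s'`. So intersecting with `K` loses no information. -/
theorem fid_le_iff {s s' : (Af K)ˣ} : fid s ≤ fid s' ↔ ball s ≤ ball s' := by
  refine ⟨fun h x hx => ?_, fun h k hk => h hk⟩
  obtain ⟨w, hw, hw'⟩ := exists_ball_le_inf s s'
  obtain ⟨k, hk⟩ := exists_sub_mem_ball x w
  have h1 : algebraMap K (Af K) k ∈ ball s := by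
    simpa using (ball s).sub_mem hx (hw hk)
  simpa using (ball s').add_mem (hw' hk) (h h1)

theorem fid_eq_iff {s s' : (Af K)ˣ} : fid s = fid s' ↔ ball s = ball s' := by
  rw [le_antisymm_iff, le_antisymm_iff, fid_le_iff, fid_le_iff]

theorem mem_fid_sup_iff {s s' : (Af K)ˣ} {k : K} :
    k ∈ fid s ⊔ fid s' ↔ algebraMap K (Af K) k ∈ ball s ⊔ ball s' := by
  simp only [Submodule.mem_sup]
  constructor
  · rintro ⟨x, hx, y, hy, rfl⟩
    exact ⟨_, hx, _, hy, (map_add (algebraMap K (Af K)) x y).symm⟩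
  · rintro ⟨x, hx, y, hy, h⟩
    obtain ⟨w, hw, hw'⟩ := exists_ball_le_inf s s'
    obtain ⟨a, ha⟩ := exists_sub_mem_ball x w
    refine ⟨a, ?_, k - a, ?_, by ring⟩
    · rw [mem_fid]
      simpa using (ball s).sub_mem hx (hw ha)
    · rw [mem_fid, map_sub, ← h]
      convert (ball s').add_mem (hw' ha) hy using 1
      ring

theorem exists_ne_zero_mem_fid (s : (Af K)ˣ) : ∃ k ∈ fid s, k ≠ 0 := by
  obtain ⟨n, hn, h⟩ := exists_integer_mul_mem_Ohat ((s⁻¹ : (Af K)ˣ) : Af K)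
  refine ⟨n, ?_, by simpa using hn⟩
  rw [mem_fid, mem_ball, mul_comm]
  exact h

theorem fid_mul_idele (k : Kˣ) (s : (Af K)ˣ) (x : K) :
    x ∈ fid (idele k * s) ↔ (k⁻¹ : Kˣ) * x ∈ fid s := by
  rw [mem_fid, mem_fid, ← mul_mem_ball_mul (t := idele k) (s := s), idele_val, ← map_mul,
    Units.mul_inv_cancel_left]

/-- Multiplication by a common denominator embeds the module in the noetherian module `𝓞`. -/
theorem fid_fg (s : (Af K)ˣ) : (fid s).FG := by
  obtain ⟨n, hn, h⟩ := exists_integer_mul_mem_Ohat (s : Af K)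
  have hn' : (n : K) ≠ 0 := by simpa using hn
  have hle : (fid s).map (LinearMap.mulLeft (𝓞 K) (n : K)) ≤
      LinearMap.range (Algebra.linearMap (𝓞 K) K) := by
    rintro _ ⟨k, hk, rfl⟩
    refine exists_coe_eq_of_mem_Ohat ?_
    rw [LinearMap.mulLeft_apply, map_mul]
    obtain ⟨b, hb, hk⟩ := mem_ball_iff_exists.1 hk
    rw [show algebraMap K (Af K) k = s * b from hk, ← mul_assoc]
    exact (Ohat K).mul_mem h hb
  have hfg : ((fid s).map (LinearMap.mulLeft (𝓞 K) (n : K))).FG := by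
    have : IsNoetherian (𝓞 K) (LinearMap.range (Algebra.linearMap (𝓞 K) K)) :=
      isNoetherian_of_surjective (LinearMap.rangeRestrict _) (LinearMap.range_rangeRestrict _)
    exact isNoetherian_submodule.1 this _ hle
  exact Submodule.fg_of_fg_map_injective _ (mul_right_injective₀ hn') hfg

/-- Local principality: at each place a generator of largest valuation generates `I` locally. These
local generators form an idele `s`, and a local-global argument identifies `I` with `s Ô ∩ K`. -/
theorem exists_eq_fid (I : Submodule (𝓞 K) K) (hfg : I.FG) (hI : I ≠ ⊥) : ∃ s, I = fid s := by
  classical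
  obtain ⟨S, hS⟩ := hfg
  have hSne : S.Nonempty := by
    rw [Finset.nonempty_iff_ne_empty]
    rintro rfl
    simp at hS
    exact hI hS.symm
  have hmax : ∀ v : HeightOneSpectrum (𝓞 K), ∃ x ∈ S,
      ∀ y ∈ I, v.valuation K y ≤ v.valuation K x := by
    intro v
    obtain ⟨x, hx, hxm⟩ := S.exists_max_image (v.valuation K) hSne
    refine ⟨x, hx, fun y hy => ?_⟩
    rw [← hS] at hy
    induction hy using Submodule.span_induction with
    | mem y hy => exact hxm y hy
    | zero => simp
    | add a b _ _ ha hb => exact (Valuation.map_add _ _ _).trans (max_le ha hb)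
    | smul r a _ ha =>
      rw [Algebra.smul_def, map_mul]
      exact mul_le_of_le_one_of_le (v.valuation_le_one r) ha
  choose x hxS hxm using hmax
  have hxI : ∀ v, x v ∈ I := fun v => hS ▸ Submodule.subset_span (hxS v)
  obtain ⟨z, hz, hz0⟩ := (Submodule.ne_bot_iff I).1 hI
  have hx0 : ∀ v, x v ≠ 0 := fun v h => by
    have := hxm v z hz
    rw [h, map_zero, le_zero_iff, Valuation.zero_iff] at this
    exact hz0 this
  -- The local generators are taken from one finite set of nonzero elements, so almost all of them
  -- are units; this is what makes the family an idele.
  have hval : ∀ᶠ v : HeightOneSpectrum (𝓞 K) in Filter.cofinite, v.valuation K (x v) = 1 := by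
    have h1 : ∀ y ∈ S, ∀ᶠ v : HeightOneSpectrum (𝓞 K) in Filter.cofinite, y ≠ 0 → v.valuation K y = 1 := by
      intro y _
      have ha := (HeightOneSpectrum.Support.finite (𝓞 K) y).eventually_cofinite_notMem
      have hb := (HeightOneSpectrum.Support.finite (𝓞 K) y⁻¹).eventually_cofinite_notMem
      filter_upwards [ha, hb] with v ha hb hy
      refine le_antisymm (not_lt.1 ha) ?_
      have : v.valuation K y⁻¹ ≤ 1 := not_lt.1 hb
      rw [map_inv₀] at this
      exact (inv_le_one₀ (zero_lt_iff.2 ((Valuation.ne_zero_iff _).2 hy))).1 this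
    filter_upwards [(Filter.eventually_all_finset S).2 h1] with v hv
    exact hv _ (hxS v) (hx0 v)
  let a : Af K := ⟨fun v => ((x v : K) : v.adicCompletion K), by
    filter_upwards [hval] with v hv
    have : Valued.v ((x v : K) : v.adicCompletion K) ≤ 1 := by
      rw [valuedAdicCompletion_eq_valuation', hv]
    exact this⟩
  have ha : ∀ v, Valued.v (a v) = v.valuation K (x v) := fun v =>
    valuedAdicCompletion_eq_valuation' v (x v)
  have hau : IsUnit a := by
    rw [FiniteAdeleRing.isUnit_iff]
    refine ⟨fun v => ?_, ?_⟩
    · rw [← Valuation.ne_zero_iff Valued.v, ha, Valuation.ne_zero_iff]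
      exact hx0 v
    · filter_upwards [hval] with v hv
      rw [ha, hv]
  obtain ⟨s, hs⟩ := hau
  have hmem : ∀ k : K, k ∈ fid s ↔ ∀ v : HeightOneSpectrum (𝓞 K), v.valuation K k ≤ v.valuation K (x v) := by
    intro k
    rw [mem_fid, mem_ball, mem_Ohat_iff]
    refine forall_congr' fun v => ?_
    have h1 : ((s⁻¹ : (Af K)ˣ) : Af K) v * a v = 1 := by
      rw [← mul_apply_Af, ← hs, Units.inv_mul]; rfl
    have h2 : Valued.v (((s⁻¹ : (Af K)ˣ) : Af K) v) * v.valuation K (x v) = 1 := by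
      rw [← ha, ← map_mul, h1, map_one]
    rw [mul_apply_Af, map_mul, valued_algebraMap_Af, eq_inv_of_mul_eq_one_left h2]
    rw [inv_mul_le_one₀ (zero_lt_iff.2 ((Valuation.ne_zero_iff _).2 (hx0 v)))]
  refine ⟨s, le_antisymm (fun k hk => (hmem k).2 fun v => hxm v k hk) fun k hk => ?_⟩
  by_contra hkI
  -- If `k ∉ I`, the ideal of `r` with `r k ∈ I` is proper and lies in some maximal `P`; but at `P`
  -- the element `k` is a local multiple of the generator, which gives such an `r` outside `P`.
  have hcond : I.comap (LinearMap.toSpanSingleton (𝓞 K) K k) ≠ ⊤ := by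
    intro h
    apply hkI
    have : (1 : 𝓞 K) ∈ I.comap (LinearMap.toSpanSingleton (𝓞 K) K k) := by rw [h]; trivial
    simpa using this
  obtain ⟨P, hP, hle⟩ := Ideal.exists_le_maximal _ hcond
  let v : HeightOneSpectrum (𝓞 K) :=
    ⟨P, hP.isPrime, Ring.ne_bot_of_isMaximal_of_not_isField hP (RingOfIntegers.not_isField K)⟩
  have hk1 : v.valuation K (k / x v) ≤ 1 := by
    rw [map_div₀]
    exact div_le_one_of_le₀ ((hmem k).1 hk v) zero_le
  obtain ⟨n, d, hnd⟩ := exists_primeCompl_mul_eq_of_integer v _ hk1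
  apply d.2
  apply hle
  rw [Submodule.mem_comap, LinearMap.toSpanSingleton_apply, Algebra.smul_def]
  have : algebraMap (𝓞 K) K d * k = n • x v := by
    rw [Algebra.smul_def, ← hnd]
    field_simp [hx0 v]
  rw [this]
  exact I.smul_mem _ (hxI v)

theorem mem_idealOf {t : Sgp K} {a : 𝓞 K} :
    a ∈ idealOf t ↔ algebraMap (𝓞 K) (Af K) a ∈ ball (t : (Af K)ˣ) := mem_ball_iff_exists.symm

/-- For the nontrivial inclusion the product module is written as `fid r`, and `t`, `s` are
approximated by elements `j`, `i` of the two factors. Then `t s = t (s - i) + i (t - j) + j i`,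
where the first two terms are small and the last is in the product, so `t s ∈ r Ô`. -/
theorem idealOf_smul_fid (t : Sgp K) (s : (Af K)ˣ) :
    idealOf t • fid s = fid ((t : (Af K)ˣ) * s) := by
  have hle : idealOf t • fid s ≤ fid ((t : (Af K)ˣ) * s) := by
    refine Submodule.smul_le.2 fun a ha k hk => ?_
    obtain ⟨b, hb, h1⟩ := mem_ball_iff_exists.1 (mem_idealOf.1 ha)
    rw [mem_fid, Algebra.smul_def, map_mul]
    change algebraMap (𝓞 K) (Af K) a * _ ∈ _
    rw [h1, mul_assoc, mul_mem_ball_mul]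
    exact mul_mem_ball hb hk
  refine le_antisymm hle ?_
  have key : ∀ r, idealOf t • fid s = fid r → ((t : (Af K)ˣ) : Af K) * s ∈ ball r := by
    intro r hr
    obtain ⟨w, hw⟩ := exists_mul_mem_ball ((t : (Af K)ˣ) : Af K) r
    obtain ⟨w₁, hw₁, hw₁'⟩ := exists_ball_le_inf w s
    obtain ⟨i, hi⟩ := exists_sub_mem_ball (s : Af K) w₁
    obtain ⟨w', hw'⟩ := exists_mul_mem_ball (algebraMap K (Af K) i) r
    obtain ⟨w₂, hw₂, hw₂'⟩ := exists_ball_le_inf w' t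
    obtain ⟨j, hj⟩ := exists_sub_mem_ball ((t : (Af K)ˣ) : Af K) w₂
    have hi' : i ∈ fid s := by
      rw [mem_fid]; simpa using (ball s).sub_mem (self_mem_ball s) (hw₁' hi)
    have hj' : algebraMap K (Af K) j ∈ ball (t : (Af K)ˣ) := by
      simpa using (ball (t : (Af K)ˣ)).sub_mem (self_mem_ball _) (hw₂' hj)
    obtain ⟨b, hb, hjb⟩ := mem_ball_iff_exists.1 hj'
    obtain ⟨a, rfl⟩ := exists_coe_eq_of_mem_Ohat (k := j) (by
      rw [hjb]; exact (Ohat K).mul_mem t.2 hb)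
    have h3 : algebraMap K (Af K) ((a : K) * i) ∈ ball r := by
      rw [← mem_fid, ← hr]
      exact Submodule.smul_mem_smul (mem_idealOf.2 hj') hi'
    have := (ball r).add_mem ((ball r).add_mem (hw _ (hw₁ hi)) (hw' _ (hw₂ hj))) h3
    convert this using 1
    rw [map_mul]
    ring
  obtain ⟨r, hr⟩ := exists_eq_fid (idealOf t • fid s)
    (Submodule.FG.smul (IsNoetherian.noetherian (idealOf t)) (fid_fg s)) (by
      obtain ⟨n, hn, h⟩ := exists_integer_mul_mem_Ohat (((t : (Af K)ˣ)⁻¹ : (Af K)ˣ) : Af K)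
      obtain ⟨k, hk, hk0⟩ := exists_ne_zero_mem_fid s
      refine (Submodule.ne_bot_iff _).2 ⟨n • k, Submodule.smul_mem_smul ?_ hk, ?_⟩
      · rw [mem_idealOf, mem_ball, mul_comm]; exact h
      · exact smul_ne_zero hn hk0)
  rw [hr, fid_le_iff, ball_le_iff]
  exact key r hr

/-- `s Ô ∩ K` as an element of the monoid of fractional ideals. -/
noncomputable def fracIdeal (s : (Af K)ˣ) : FractionalIdeal (𝓞 K)⁰ K :=
  ⟨fid s, FractionalIdeal.isFractional_of_fg (fid_fg s)⟩

-- Finiteness of the class group: ideles with the same ideal class differ by `K^*` and `Ô^*`. This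
-- is used to make the fibers of `idxGK` compact.
variable (K) in
theorem exists_finset_idele_classes : ∃ F : Finset (Af K)ˣ, ∀ s : (Af K)ˣ, ∃ t ∈ F, ∃ k : Kˣ,
    ∃ u ∈ OhatUnits K, s = idele k * t * u := by
  classical
  let I : (Af K)ˣ → (FractionalIdeal (𝓞 K)⁰ K)ˣ := fun s => Units.mk0 (fracIdeal s) (by
    intro h
    obtain ⟨k, hk, hk0⟩ := exists_ne_zero_mem_fid s
    have h1 : k ∈ fracIdeal s := hk
    rw [h] at h1
    exact hk0 (by simpa using h1))
  let c : (Af K)ˣ → ClassGroup (𝓞 K) := fun s => ClassGroup.mk K (I s)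
  have hfin : (Set.range c).Finite := Set.toFinite _
  choose g hg using fun x : Set.range c => x.2
  have : Finite (Set.range c) := hfin
  refine ⟨(Set.finite_range g).toFinset, fun s => ⟨g ⟨c s, s, rfl⟩, by simp, ?_⟩⟩
  set t := g ⟨c s, s, rfl⟩ with ht
  have h1 : ClassGroup.mk K (I s / I t) = 1 := by
    rw [map_div, div_eq_one]
    exact (hg ⟨c s, s, rfl⟩).symm
  rw [ClassGroup.mk_eq_one_iff] at h1
  obtain ⟨k, hk⟩ := h1.principal
  have h2 : ((I s / I t : (FractionalIdeal (𝓞 K)⁰ K)ˣ) : FractionalIdeal (𝓞 K)⁰ K) =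
      FractionalIdeal.spanSingleton (𝓞 K)⁰ k :=
    FractionalIdeal.coeToSubmodule_injective (by
      dsimp only; rw [hk, FractionalIdeal.coe_spanSingleton])
  have h3 : (I s : FractionalIdeal (𝓞 K)⁰ K) = FractionalIdeal.spanSingleton (𝓞 K)⁰ k * I t := by
    rw [← h2, ← Units.val_mul, div_mul_cancel]
  have hk0 : k ≠ 0 := by
    rintro rfl
    rw [FractionalIdeal.spanSingleton_zero, zero_mul] at h3
    exact (I s).ne_zero h3
  have h4 : fid s = fid (idele (Units.mk0 k hk0) * t) := by
    ext x
    rw [fid_mul_idele]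
    change x ∈ (I s : FractionalIdeal (𝓞 K)⁰ K) ↔ _
    rw [h3, FractionalIdeal.mem_singleton_mul]
    constructor
    · rintro ⟨y, hy, rfl⟩
      rw [Units.val_inv_eq_inv_val, Units.val_mk0, inv_mul_cancel_left₀ hk0]
      exact hy
    · intro h
      exact ⟨_, h, by rw [Units.val_inv_eq_inv_val, Units.val_mk0, mul_inv_cancel_left₀ hk0]⟩
  rw [fid_eq_iff, ball_eq_iff] at h4
  exact ⟨_, _, h4, by rw [mul_inv_cancel_left]⟩

end Ideles

/-! ### Adelic representatives of `K`-lattices and commensurability. -/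

section Representatives

variable {K : Type*} [Field K] [NumberField K] [Algebra K ℂ]

theorem KLattice.ext_of_iff {L L' : KLattice K} (h : L.Λ = L'.Λ)
    (hφ : ∀ (a : K) (v : ℂ), L.φ (Submodule.Quotient.mk a) = Submodule.Quotient.mk v →
      L'.φ (Submodule.Quotient.mk a) = Submodule.Quotient.mk v) : L = L' := by
  obtain ⟨Λ, fg, rk, φ, mem⟩ := L
  obtain ⟨Λ', fg', rk', φ', mem'⟩ := L'
  obtain rfl : Λ = Λ' := h
  congr 1
  ext a
  obtain ⟨v, -, hv⟩ := mem (Submodule.Quotient.mk a)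
  exact hv.trans (hφ a v hv).symm

/-- The `𝓞`-linear map `k ↦ c⁻¹ k`. -/
noncomputable def scaledEmb (c : ℂˣ) : K →ₗ[𝓞 K] ℂ where
  toFun k := ((c⁻¹ : ℂˣ) : ℂ) * algebraMap K ℂ k
  map_add' _ _ := by rw [map_add, mul_add]
  map_smul' r a := by
    rw [RingHom.id_apply, Algebra.smul_def, map_mul, ← mul_left_comm,
      ← IsScalarTower.algebraMap_apply, ← Algebra.smul_def]

theorem scaledEmb_apply (c : ℂˣ) (k : K) :
    scaledEmb c k = ((c⁻¹ : ℂˣ) : ℂ) * algebraMap K ℂ k := rfl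

theorem scaledEmb_injective (c : ℂˣ) : Function.Injective (scaledEmb (K := K) c) := fun _ _ h =>
  (algebraMap K ℂ).injective (mul_left_cancel₀ (Units.ne_zero _) h)

/-- The `𝓞`-module `c⁻¹ (s Ô ∩ K)`. -/
noncomputable def lat (s : (Af K)ˣ) (c : ℂˣ) : Submodule (𝓞 K) ℂ := (fid s).map (scaledEmb c)

theorem scaledEmb_mem_lat {s : (Af K)ˣ} {c : ℂˣ} {k : K} : scaledEmb c k ∈ lat s c ↔ k ∈ fid s :=
  Submodule.mem_map.trans
    ⟨by rintro ⟨y, hy, h⟩; rwa [← scaledEmb_injective c h], fun h => ⟨k, h, rfl⟩⟩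

theorem represents_iff {ρ : Af K} {s : (Af K)ˣ} {c : ℂˣ} {L : KLattice K} :
    Represents ρ s c L ↔ L.Λ = lat s c ∧ ∀ a k : K,
      L.φ (Submodule.Quotient.mk a) = Submodule.Quotient.mk (scaledEmb c k) ↔
        (s : Af K) * ρ * algebraMap K (Af K) a - algebraMap K (Af K) k ∈ ball s := by
  refine and_congr ?_ ?_
  · rw [SetLike.ext_iff]
    refine forall_congr' fun v => iff_congr Iff.rfl ?_
    rw [lat, Submodule.mem_map]
    refine exists_congr fun k => ?_
    rw [mem_fid, mem_ball_iff_exists, and_comm, eq_comm, scaledEmb_apply]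
  · simp_rw [mem_ball_iff_exists]; rfl

theorem kspan_lat (s : (Af K)ˣ) (c : ℂˣ) :
    KSpan (lat s c) = Submodule.span K {((c⁻¹ : ℂˣ) : ℂ)} := by
  refine le_antisymm (Submodule.span_le.2 ?_) (Submodule.span_le.2 ?_)
  · rintro _ ⟨k, -, rfl⟩
    exact Submodule.mem_span_singleton.2 ⟨k, by rw [Algebra.smul_def, mul_comm]; rfl⟩
  · obtain ⟨k, hk, hk0⟩ := exists_ne_zero_mem_fid s
    rw [Set.singleton_subset_iff, SetLike.mem_coe]
    have h : scaledEmb c k ∈ KSpan (lat s c) := Submodule.subset_span (scaledEmb_mem_lat.2 hk)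
    convert Submodule.smul_mem _ k⁻¹ h using 1
    rw [Algebra.smul_def, scaledEmb_apply, mul_left_comm, ← map_mul, inv_mul_cancel₀ hk0, map_one,
      mul_one]

theorem Represents.kspan {ρ : Af K} {s : (Af K)ˣ} {c : ℂˣ} {L : KLattice K}
    (h : Represents ρ s c L) : KSpan L.Λ = Submodule.span K {((c⁻¹ : ℂˣ) : ℂ)} := by
  rw [(represents_iff.1 h).1, kspan_lat]

theorem scaledEmb_mem_span (c : ℂˣ) (k : K) :
    scaledEmb c k ∈ Submodule.span K {((c⁻¹ : ℂˣ) : ℂ)} :=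
  Submodule.mem_span_singleton.2 ⟨k, by rw [Algebra.smul_def, mul_comm]; rfl⟩

theorem exists_scaledEmb_eq {c : ℂˣ} {v : ℂ} (hv : v ∈ Submodule.span K {((c⁻¹ : ℂˣ) : ℂ)}) :
    ∃ k : K, v = scaledEmb c k := by
  obtain ⟨k, rfl⟩ := Submodule.mem_span_singleton.1 hv
  exact ⟨k, by rw [Algebra.smul_def, mul_comm]; rfl⟩

/-- Strong approximation identifies `𝔸_{K,f} / s Ô` with `K / (s Ô ∩ K)`, so multiplication by `s ρ`
can be followed by the embedding of the latter quotient into `ℂ / Λ`. -/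
theorem exists_represents {ρ : Af K} (hρ : ρ ∈ Ohat K) (s : (Af K)ˣ) (c : ℂˣ) :
    ∃ L : KLattice K, Represents ρ s c L := by
  let ι : K →ₗ[𝓞 K] Af K := (IsScalarTower.toAlgHom (𝓞 K) K (Af K)).toLinearMap
  let π : K →ₗ[𝓞 K] Af K ⧸ ball s := (ball s).mkQ ∘ₗ ι
  have hπ : Function.Surjective π := by
    intro x
    obtain ⟨x, rfl⟩ := Submodule.Quotient.mk_surjective _ x
    obtain ⟨k, hk⟩ := exists_sub_mem_ball x s
    exact ⟨k, ((Submodule.Quotient.eq _).2 hk).symm⟩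
  let e : (K ⧸ LinearMap.ker π) ≃ₗ[𝓞 K] Af K ⧸ ball s := π.quotKerEquivOfSurjective hπ
  have hker : ∀ k, k ∈ LinearMap.ker π ↔ k ∈ fid s := fun k => by
    rw [LinearMap.mem_ker]
    exact Submodule.Quotient.mk_eq_zero _
  let m : Af K →ₗ[𝓞 K] Af K := LinearMap.mulLeft (𝓞 K) ((s : Af K) * ρ)
  let f : (K ⧸ OinK K) →ₗ[𝓞 K] Af K ⧸ ball s := (OinK K).liftQ ((ball s).mkQ ∘ₗ m ∘ₗ ι) (by
    rintro _ ⟨a, rfl⟩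
    rw [LinearMap.mem_ker]
    refine (Submodule.Quotient.mk_eq_zero _).2 ?_
    change (s : Af K) * ρ * algebraMap (𝓞 K) (Af K) a ∈ ball s
    rw [mul_assoc, mul_comm]
    exact mul_mem_ball ((Ohat K).mul_mem hρ (algebraMap_mem_Ohat K a)) (self_mem_ball s))
  let q : (K ⧸ LinearMap.ker π) →ₗ[𝓞 K] ℂ ⧸ lat s c :=
    (LinearMap.ker π).mapQ (lat s c) (scaledEmb c) fun k hk => scaledEmb_mem_lat.2 ((hker k).1 hk)
  have hq : Function.Injective q := by
    rw [← LinearMap.ker_eq_bot, eq_bot_iff]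
    intro x hx
    obtain ⟨k, rfl⟩ := Submodule.Quotient.mk_surjective _ x
    rw [LinearMap.mem_ker] at hx
    exact (Submodule.Quotient.mk_eq_zero _).2 ((hker k).2
      (scaledEmb_mem_lat.1 ((Submodule.Quotient.mk_eq_zero _).1 hx)))
  have key : ∀ a k : K, (q ∘ₗ e.symm.toLinearMap ∘ₗ f) (Submodule.Quotient.mk a) =
      Submodule.Quotient.mk (scaledEmb c k) ↔
        (s : Af K) * ρ * algebraMap K (Af K) a - algebraMap K (Af K) k ∈ ball s := by
    intro a k
    have h1 : (Submodule.Quotient.mk (scaledEmb c k) : ℂ ⧸ lat s c) =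
      q (Submodule.Quotient.mk k) := rfl
    rw [h1]
    change q (e.symm (f _)) = _ ↔ _
    rw [hq.eq_iff, LinearEquiv.symm_apply_eq]
    exact Submodule.Quotient.eq _
  refine ⟨⟨lat s c, (fid_fg s).map _, ?_, q ∘ₗ e.symm.toLinearMap ∘ₗ f, ?_⟩,
    represents_iff.2 ⟨rfl, key⟩⟩
  · rw [kspan_lat, finrank_span_singleton (Units.ne_zero _)]
  · intro x
    obtain ⟨a, rfl⟩ := Submodule.Quotient.mk_surjective _ x
    obtain ⟨k, hk⟩ := exists_sub_mem_ball ((s : Af K) * ρ * algebraMap K (Af K) a) s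
    refine ⟨scaledEmb c k, ?_, (key a k).2 hk⟩
    rw [kspan_lat]
    exact scaledEmb_mem_span c k

theorem Represents.unique {ρ : Af K} {s : (Af K)ˣ} {c : ℂˣ} {L L' : KLattice K}
    (h : Represents ρ s c L) (h' : Represents ρ s c L') : L = L' := by
  have h1 := represents_iff.1 h
  have h1' := represents_iff.1 h'
  have hΛ : L.Λ = L'.Λ := h1.1.trans h1'.1.symm
  refine KLattice.ext_of_iff hΛ fun a v hv => ?_
  obtain ⟨w, hw, hvw⟩ := L.φ_mem (Submodule.Quotient.mk a)
  rw [h.kspan] at hw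
  obtain ⟨k, rfl⟩ := exists_scaledEmb_eq hw
  rw [(h1'.2 a k).2 ((h1.2 a k).1 hvw), Submodule.Quotient.eq, ← hΛ, ← Submodule.Quotient.eq,
    ← hvw, hv]

theorem mk_one_eq_zero : (Submodule.Quotient.mk (1 : K) : K ⧸ OinK K) = 0 :=
  (Submodule.Quotient.mk_eq_zero _).2 ⟨1, by simp⟩

/-- The lattice part is `exists_eq_fid` after choosing a generator of the line. For `φ`, the point
is that morphisms from `K/𝓞` come from `Ô`: each value `φ(1/n)` imposes a closed nonempty condition
on `ρ ∈ Ô`, the conditions are directed by divisibility, and `Ô` is compact. -/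
theorem exists_rep (L : KLattice K) : ∃ ρ s c, Represents ρ s c L := by
  obtain ⟨⟨w, hw⟩, hw0, hwspan⟩ := finrank_eq_one_iff'.1 L.rank_one
  have hw0' : w ≠ 0 := fun h => hw0 (Subtype.ext h)
  let c : ℂˣ := (Units.mk0 w hw0')⁻¹
  have hc : ((c⁻¹ : ℂˣ) : ℂ) = w := by simp [c]
  have hspan : KSpan L.Λ = Submodule.span K {((c⁻¹ : ℂˣ) : ℂ)} := by
    rw [hc]
    refine le_antisymm (fun v hv => ?_) (Submodule.span_le.2 (by simpa using hw))
    obtain ⟨k, hk⟩ := hwspan ⟨v, hv⟩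
    exact Submodule.mem_span_singleton.2 ⟨k, congrArg Subtype.val hk⟩
  have hmap : (L.Λ.comap (scaledEmb c)).map (scaledEmb c) = L.Λ := by
    rw [Submodule.map_comap_eq, inf_eq_right]
    intro v hv
    have hv' : v ∈ KSpan L.Λ := Submodule.subset_span hv
    rw [hspan] at hv'
    obtain ⟨k, rfl⟩ := exists_scaledEmb_eq hv'
    exact ⟨k, rfl⟩
  obtain ⟨s, hs⟩ := exists_eq_fid (L.Λ.comap (scaledEmb c))
    (Submodule.fg_of_fg_map_injective _ (scaledEmb_injective c)
      (by rw [hmap]; exact L.fg)) (by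
      intro h
      rw [h, Submodule.map_bot] at hmap
      have := L.rank_one
      rw [← hmap, KSpan, Submodule.bot_coe, Submodule.span_zero_singleton, finrank_bot] at this
      exact zero_ne_one this)
  have hΛ : L.Λ = lat s c := by rw [lat, ← hs, hmap]
  have hex : ∀ a : K, ∃ k : K, L.φ (Submodule.Quotient.mk a) =
      Submodule.Quotient.mk (scaledEmb c k) := by
    intro a
    obtain ⟨v, hv, hφ⟩ := L.φ_mem (Submodule.Quotient.mk a)
    rw [hspan] at hv
    obtain ⟨k, rfl⟩ := exists_scaledEmb_eq hv
    exact ⟨k, hφ⟩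
  have heq : ∀ k k' : K, (Submodule.Quotient.mk (scaledEmb c k) : ℂ ⧸ L.Λ) =
      Submodule.Quotient.mk (scaledEmb c k') ↔
        algebraMap K (Af K) k - algebraMap K (Af K) k' ∈ ball s := by
    intro k k'
    rw [Submodule.Quotient.eq, ← map_sub, hΛ, scaledEmb_mem_lat, mem_fid, map_sub]
  have hsmul : ∀ (r : 𝓞 K) (a k : K),
      L.φ (Submodule.Quotient.mk a) = Submodule.Quotient.mk (scaledEmb c k) →
      L.φ (Submodule.Quotient.mk (r * a : K)) =
        Submodule.Quotient.mk (scaledEmb c (r * k)) := by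
    intro r a k h
    have h1 : (r : K) * a = r • a := by rw [Algebra.smul_def]
    have h2 : (r : K) * k = r • k := by rw [Algebra.smul_def]
    rw [h1, h2, Submodule.Quotient.mk_smul, map_smul, map_smul, h, Submodule.Quotient.mk_smul]
  choose κ hκ using fun n : (𝓞 K)⁰ => hex ((n : 𝓞 K) : K)⁻¹
  have hn0 : ∀ n : (𝓞 K)⁰, ((n : 𝓞 K) : K) ≠ 0 := fun n => by simp
  -- The `ρ` that give the right value at `1/n`. All `n` together suffice, since every element of
  -- `K` is an integral multiple of some `1/n`.
  let C : (𝓞 K)⁰ → Set (Af K) := fun n => {ρ | ρ ∈ Ohat K ∧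
    algebraMap K (Af K) ((n : 𝓞 K) : K)⁻¹ * (s * ρ) - algebraMap K (Af K) (κ n) ∈ ball s}
  have hC : ∀ n, IsClosed (C n) := fun n => by
    refine isClosed_Ohat.inter (isClosed_Ohat.preimage (f := fun ρ : Af K =>
      ((s⁻¹ : (Af K)ˣ) : Af K) * (algebraMap K (Af K) ((n : 𝓞 K) : K)⁻¹ * (s * ρ) -
        algebraMap K (Af K) (κ n))) ?_)
    fun_prop
  obtain ⟨ρ, hρ⟩ : (⋂ n, C n).Nonempty := by
    refine IsCompact.nonempty_iInter_of_directed_nonempty_isCompact_isClosed C ?_ ?_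
      (fun n => isCompact_Ohat.of_isClosed_subset (hC n) fun x hx => hx.1) hC
    · intro n m
      have aux : ∀ n m : (𝓞 K)⁰, C (n * m) ⊆ C n := by
        rintro n m ρ ⟨h1, h2⟩
        refine ⟨h1, ?_⟩
        have h3 := hsmul m _ _ (hκ (n * m))
        have h4 : ((m : 𝓞 K) : K) * (((n * m : (𝓞 K)⁰) : 𝓞 K) : K)⁻¹ = ((n : 𝓞 K) : K)⁻¹ := by
          have := hn0 n
          have := hn0 m
          push_cast
          field_simp
        rw [h4, hκ n, heq] at h3
        have h5 := mul_mem_ball (algebraMap_mem_Ohat K m) h2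
        convert (ball s).sub_mem h5 h3 using 1
        rw [algebraMap_Af_coe, ← h4, map_mul, map_mul]
        ring
      exact ⟨n * m, aux n m, by rw [mul_comm]; exact aux m n⟩
    · intro n
      -- As `φ` kills the class of `1`, the element `n κ(n)` lies in `fid s`; writing it as `s b`
      -- with `b ∈ Ô`, the choice `ρ = b` gives `κ(n)` exactly.
      have h3 := hsmul n _ _ (hκ n)
      rw [mul_inv_cancel₀ (hn0 n)] at h3
      rw [mk_one_eq_zero, map_zero, eq_comm, Submodule.Quotient.mk_eq_zero, hΛ, scaledEmb_mem_lat,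
        mem_fid, mem_ball_iff_exists] at h3
      obtain ⟨b, hb, h3⟩ := h3
      refine ⟨b, hb, ?_⟩
      rw [← h3, ← map_mul, inv_mul_cancel_left₀ (hn0 n), sub_self]
      exact (ball s).zero_mem
  refine ⟨ρ, s, c, represents_iff.2 ⟨hΛ, fun a k => ?_⟩⟩
  obtain ⟨p, n, hn, rfl⟩ := IsFractionRing.div_surjective (A := 𝓞 K) a
  have h1 := (Set.mem_iInter.1 hρ ⟨n, hn⟩).2
  have h2 := hsmul p _ _ (hκ ⟨n, hn⟩)
  have h3 : algebraMap (𝓞 K) K p / algebraMap (𝓞 K) K n = (p : K) * (n : K)⁻¹ := div_eq_mul_inv _ _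
  rw [h3, h2, heq]
  have h5 := mul_mem_ball (algebraMap_mem_Ohat K p) h1
  have h6 : (s : Af K) * ρ * algebraMap K (Af K) ((p : K) * (n : K)⁻¹) - algebraMap K (Af K) k =
      algebraMap (𝓞 K) (Af K) p * (algebraMap K (Af K) (n : K)⁻¹ * (s * ρ) -
        algebraMap K (Af K) (κ ⟨n, hn⟩)) +
      (algebraMap K (Af K) ((p : K) * κ ⟨n, hn⟩) - algebraMap K (Af K) k) := by
    rw [algebraMap_Af_coe, map_mul, map_mul]
    ring
  rw [h6]
  exact ((ball s).add_mem_iff_right h5).symm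

theorem Represents.mem_Ohat {ρ : Af K} {s : (Af K)ˣ} {c : ℂˣ} {L : KLattice K}
    (h : Represents ρ s c L) : ρ ∈ Ohat K := by
  have h1 := ((represents_iff.1 h).2 1 0).1 (by
    rw [map_zero, Submodule.Quotient.mk_zero, mk_one_eq_zero, map_zero])
  rw [map_one, map_zero, sub_zero, mul_one, mem_ball, Units.inv_mul_cancel_left] at h1
  exact h1

/-- The embedding of `K^*` in `ℂ^*`. -/
noncomputable def embUnits : Kˣ →* ℂˣ := Units.map (algebraMap K ℂ).toMonoidHom

@[simp]
theorem embUnits_val (k : Kˣ) : ((embUnits k : ℂˣ) : ℂ) = algebraMap K ℂ (k : K) := rfl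

theorem scaledEmb_embUnits_mul (k : Kˣ) (c : ℂˣ) (x : K) :
    scaledEmb (embUnits k * c) x = scaledEmb c ((k⁻¹ : Kˣ) * x) := by
  rw [scaledEmb_apply, scaledEmb_apply, mul_inv, Units.val_mul, ← map_inv, embUnits_val, map_mul]
  ring

theorem lat_idele_mul (k : Kˣ) (s : (Af K)ˣ) (c : ℂˣ) :
    lat (idele k * s) (embUnits k * c) = lat s c := by
  ext v
  simp only [lat, Submodule.mem_map, fid_mul_idele, scaledEmb_embUnits_mul]
  constructor
  · rintro ⟨x, hx, rfl⟩
    exact ⟨_, hx, rfl⟩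
  · rintro ⟨x, hx, rfl⟩
    exact ⟨k * x, by rwa [Units.inv_mul_cancel_left], by rw [Units.inv_mul_cancel_left]⟩

/-- The choice of generator of `K Λ` is free up to `K^*`, which acts diagonally on `(s_f, s_∞)`.
Together with `Represents.congr`, it permits the comparison of different representations. -/
theorem Represents.idele_mul {ρ : Af K} {s : (Af K)ˣ} {c : ℂˣ} {L : KLattice K}
    (h : Represents ρ s c L) (k : Kˣ) : Represents ρ (idele k * s) (embUnits k * c) L := by
  rw [represents_iff] at h ⊢
  refine ⟨by rw [h.1, lat_idele_mul], fun a x => ?_⟩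
  rw [scaledEmb_embUnits_mul, h.2, ← mul_mem_ball_mul (t := idele k) (s := s), mul_sub, idele_val,
    ← map_mul _ (k : K), Units.mul_inv_cancel_left, Units.val_mul, idele_val]
  simp only [mul_assoc]

theorem Represents.congr {ρ ρ' : Af K} {s s' : (Af K)ˣ} {c : ℂˣ} {L : KLattice K}
    (h : Represents ρ s c L) (hs : ball s = ball s') (hr : (s : Af K) * ρ = s' * ρ') :
    Represents ρ' s' c L := by
  rw [represents_iff] at h ⊢
  refine ⟨by rw [h.1, lat, lat, fid_eq_iff.2 hs], fun a x => ?_⟩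
  rw [h.2, ← hr, hs]

theorem eq_zero_of_forall_mul_mem_ball {r : Af K} {s : (Af K)ˣ}
    (h : ∀ k : K, r * algebraMap K (Af K) k ∈ ball s) : r = 0 := by
  have h1 : ((s⁻¹ : (Af K)ˣ) : Af K) * r = 0 :=
    eq_zero_of_forall_mul_mem_Ohat fun k => by rw [mul_assoc]; exact h k
  simpa using h1

theorem Represents.ball_eq {ρ ρ' : Af K} {s s' : (Af K)ˣ} {c : ℂˣ} {L L' : KLattice K}
    (h : Represents ρ s c L) (h' : Represents ρ' s' c L') :
    L.Λ = L'.Λ ↔ ball s = ball s' := by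
  rw [(represents_iff.1 h).1, (represents_iff.1 h').1, lat, lat,
    (Submodule.map_injective_of_injective (scaledEmb_injective c)).eq_iff, fid_eq_iff]

theorem Represents.exists_phi {ρ : Af K} {s : (Af K)ˣ} {c : ℂˣ} {L : KLattice K}
    (h : Represents ρ s c L) (a : K) : ∃ k : K,
      L.φ (Submodule.Quotient.mk a) = Submodule.Quotient.mk (scaledEmb c k) ∧
      (s : Af K) * ρ * algebraMap K (Af K) a - algebraMap K (Af K) k ∈ ball s := by
  obtain ⟨k, hk⟩ := exists_sub_mem_ball ((s : Af K) * ρ * algebraMap K (Af K) a) s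
  exact ⟨k, ((represents_iff.1 h).2 a k).2 hk, hk⟩

/-- Agreement of `φ` and `φ'` modulo `Λ + Λ'` says that `(sρ - s'ρ') a` lies in `s Ô + s' Ô` for all
`a ∈ K`. This sum is contained in one ball, so the difference is zero. Symmetry and transitivity of
commensurability are immediate consequences. -/
theorem Represents.commens_iff {ρ ρ' : Af K} {s s' : (Af K)ˣ} {c : ℂˣ} {L L' : KLattice K}
    (h : Represents ρ s c L) (h' : Represents ρ' s' c L') :
    Commens L L' ↔ (s : Af K) * ρ = s' * ρ' := by
  have hΛ := (represents_iff.1 h).1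
  have hΛ' := (represents_iff.1 h').1
  have hmem : ∀ k, scaledEmb c k ∈ L.Λ ⊔ L'.Λ ↔ algebraMap K (Af K) k ∈ ball s ⊔ ball s' := by
    intro k
    rw [← mem_fid_sup_iff, hΛ, hΛ', lat, lat, ← Submodule.map_sup, Submodule.mem_map]
    exact ⟨by rintro ⟨y, hy, h⟩; rwa [← scaledEmb_injective c h], fun h => ⟨k, h, rfl⟩⟩
  have hφ : ∀ (a k k' : K), L.φ (Submodule.Quotient.mk a) = Submodule.Quotient.mk (scaledEmb c k) →
      L'.φ (Submodule.Quotient.mk a) = Submodule.Quotient.mk (scaledEmb c k') →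
      (Submodule.factor (le_sup_left : L.Λ ≤ L.Λ ⊔ L'.Λ) (L.φ (Submodule.Quotient.mk a)) =
      Submodule.factor (le_sup_right : L'.Λ ≤ L.Λ ⊔ L'.Λ) (L'.φ (Submodule.Quotient.mk a)) ↔
        algebraMap K (Af K) k - algebraMap K (Af K) k' ∈ ball s ⊔ ball s') := by
    intro a k k' hk hk'
    rw [hk, hk', ← map_sub, ← hmem, map_sub, ← Submodule.Quotient.eq]
    rfl
  constructor
  · rintro ⟨-, H⟩
    -- Inverting ideles reverses inclusions of balls, so a common lower bound for the inverses gives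
    -- a common upper bound.
    obtain ⟨w, hw⟩ : ∃ w : (Af K)ˣ, ball s ⊔ ball s' ≤ ball w := by
      obtain ⟨w, hw, hw'⟩ := exists_ball_le_inf s⁻¹ s'⁻¹
      refine ⟨w⁻¹, sup_le (ball_le_iff.2 ?_) (ball_le_iff.2 ?_)⟩
      · have := ball_le_iff.1 hw
        rw [inv_inv] at this ⊢
        rwa [mul_comm]
      · have := ball_le_iff.1 hw'
        rw [inv_inv] at this ⊢
        rwa [mul_comm]
    rw [← sub_eq_zero]
    refine eq_zero_of_forall_mul_mem_ball (s := w) fun a => hw ?_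
    obtain ⟨k, hk, hk1⟩ := h.exists_phi a
    obtain ⟨k', hk', hk1'⟩ := h'.exists_phi a
    have h1 := (hφ a k k' hk hk').1 (H _)
    convert (ball s ⊔ ball s').add_mem ((ball s ⊔ ball s').sub_mem (Submodule.mem_sup_left hk1)
      (Submodule.mem_sup_right hk1')) h1 using 1
    ring
  · intro hr
    refine ⟨h.kspan.trans h'.kspan.symm, fun x => ?_⟩
    obtain ⟨a, rfl⟩ := Submodule.Quotient.mk_surjective _ x
    obtain ⟨k, hk, hk1⟩ := h.exists_phi a
    obtain ⟨k', hk', hk1'⟩ := h'.exists_phi a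
    rw [hφ a k k' hk hk']
    convert (ball s ⊔ ball s').sub_mem (Submodule.mem_sup_right hk1')
      (Submodule.mem_sup_left hk1) using 1
    rw [hr]
    ring

theorem Represents.mul_eq {ρ ρ' : Af K} {s s' : (Af K)ˣ} {c : ℂˣ} {L : KLattice K}
    (h : Represents ρ s c L) (h' : Represents ρ' s' c L) : (s : Af K) * ρ = s' * ρ' :=
  (h.commens_iff h').1 (Commens.refl L)

theorem Represents.eq_iff {ρ ρ' : Af K} {s s' : (Af K)ˣ} {c : ℂˣ} {L L' : KLattice K}
    (h : Represents ρ s c L) (h' : Represents ρ' s' c L') :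
    L = L' ↔ ball s = ball s' ∧ (s : Af K) * ρ = s' * ρ' := by
  constructor
  · rintro rfl
    exact ⟨(h.ball_eq h').1 rfl, h.mul_eq h'⟩
  · rintro ⟨h1, h2⟩
    exact (h.congr h1 h2).unique h'

theorem exists_embUnits_mul {c c' : ℂˣ}
    (h1 : ((c⁻¹ : ℂˣ) : ℂ) ∈ Submodule.span K {((c'⁻¹ : ℂˣ) : ℂ)}) :
    ∃ k : Kˣ, embUnits k * c' = c := by
  obtain ⟨k, hk⟩ := exists_scaledEmb_eq h1
  have hk0 : k ≠ 0 := by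
    rintro rfl
    rw [map_zero] at hk
    exact Units.ne_zero _ hk
  refine ⟨(Units.mk0 k hk0)⁻¹, ?_⟩
  rw [← inv_inj]
  apply Units.ext
  rw [hk, mul_inv, ← map_inv, inv_inv, Units.val_mul, embUnits_val, Units.val_mk0,
    scaledEmb_apply, mul_comm]

theorem exists_represents_of_kspan_eq {c : ℂˣ} {L : KLattice K}
    (h : KSpan L.Λ = Submodule.span K {((c⁻¹ : ℂˣ) : ℂ)}) : ∃ ρ s, Represents ρ s c L := by
  obtain ⟨ρ, s, c', h'⟩ := exists_rep L
  obtain ⟨k, hk⟩ := exists_embUnits_mul (K := K) (c := c) (c' := c') (by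
    rw [← h'.kspan, h]
    exact Submodule.mem_span_singleton_self _)
  exact ⟨ρ, _, hk ▸ h'.idele_mul k⟩

theorem Commens.exists_represents {ρ : Af K} {s : (Af K)ˣ} {c : ℂˣ} {L L' : KLattice K}
    (h : Represents ρ s c L) (hL : Commens L L') :
    ∃ ρ' s', Represents ρ' s' c L' ∧ (s : Af K) * ρ = s' * ρ' := by
  obtain ⟨ρ', s', h'⟩ := exists_represents_of_kspan_eq (hL.1.symm.trans h.kspan)
  exact ⟨ρ', s', h', (h.commens_iff h').1 hL⟩

theorem Commens.symm {L L' : KLattice K} (h : Commens L L') : Commens L' L := by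
  obtain ⟨ρ, s, c, hr⟩ := exists_rep L
  obtain ⟨ρ', s', hr', e⟩ := h.exists_represents hr
  exact (hr'.commens_iff hr).2 e.symm

theorem Commens.trans {L L' L'' : KLattice K} (h : Commens L L') (h' : Commens L' L'') :
    Commens L L'' := by
  obtain ⟨ρ, s, c, hr⟩ := exists_rep L
  obtain ⟨ρ', s', hr', e⟩ := h.exists_represents hr
  obtain ⟨ρ'', s'', hr'', e'⟩ := h'.exists_represents hr'
  exact (hr.commens_iff hr'').2 (e.trans e')

end Representatives

/-! ### Multiplication of `φ`, scaling, enlargement, and divisibility. -/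

section Operations

variable {K : Type*} [Field K] [NumberField K] [Algebra K ℂ]

/-- On `n`-torsion, `t` acts as any `a ∈ 𝓞` congruent to it modulo `n`: the error is a multiple of
`n k`, which is integral. -/
theorem Represents.isQuot {ρ : Af K} {s : (Af K)ˣ} {c : ℂˣ} {t : Sgp K} {L M : KLattice K}
    (hM : Represents ρ s c M) (hL : Represents (((t : (Af K)ˣ) : Af K) * ρ) s c L) : IsQuot t L M := by
  have h : M.Λ = L.Λ := (hM.ball_eq hL).2 rfl
  refine ⟨h, ?_⟩
  rintro x n a hn hx ⟨b, hb, hab⟩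
  obtain ⟨k, rfl⟩ := Submodule.Quotient.mk_surjective _ x
  obtain ⟨p, hp⟩ : ∃ p : 𝓞 K, (p : K) = n * k := by
    rw [← Submodule.Quotient.mk_smul, Submodule.Quotient.mk_eq_zero] at hx
    obtain ⟨p, hp⟩ := hx
    exact ⟨p, hp.trans (Algebra.smul_def n k)⟩
  obtain ⟨k', hk', h1⟩ := hM.exists_phi k
  have h2 : L.φ (Submodule.Quotient.mk k) = Submodule.Quotient.mk (scaledEmb c (a * k')) := by
    rw [(represents_iff.1 hL).2]
    have h3 : (s : Af K) * (((t : (Af K)ˣ) : Af K) * ρ) * algebraMap K (Af K) k -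
        algebraMap K (Af K) (a * k') =
        algebraMap (𝓞 K) (Af K) a * (s * ρ * algebraMap K (Af K) k - algebraMap K (Af K) k') -
          (b * ρ * algebraMap (𝓞 K) (Af K) p) * s := by
      rw [map_mul, ← algebraMap_Af_coe, algebraMap_Af_coe p, hp, map_mul, ← algebraMap_Af_coe, hab]
      ring
    rw [h3]
    exact (ball s).sub_mem (mul_mem_ball (algebraMap_mem_Ohat K a) h1)
      (mul_mem_ball ((Ohat K).mul_mem ((Ohat K).mul_mem hb hM.mem_Ohat)
        (algebraMap_mem_Ohat K p)) (self_mem_ball s))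
  have h4 : (a : K) * k' = a • k' := by rw [Algebra.smul_def]
  rw [h2, hk', h4, map_smul]
  rfl

/-- Every class in `K/𝓞` is killed by some `n`, and approximation supplies an `a ∈ 𝓞` congruent to
`t` modulo `n`, so `t φ` is forced. Hence `IsQuot t` is the graph of the function `mulL t`, read
from its second argument. -/
theorem IsQuot.unique {t : Sgp K} {L L' M : KLattice K} (h : IsQuot t L M) (h' : IsQuot t L' M) :
    L = L' := by
  obtain ⟨hΛ, h⟩ := h
  obtain ⟨hΛ', h'⟩ := h'
  refine KLattice.ext_of_iff (hΛ.symm.trans hΛ') fun k v hv => ?_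
  obtain ⟨p, n, hn, hk⟩ := IsFractionRing.div_surjective (A := 𝓞 K) k
  have hn0 : n ≠ 0 := nonZeroDivisors.ne_zero hn
  have hn0' : (n : K) ≠ 0 := by simpa using hn0
  obtain ⟨x, hx⟩ := exists_sub_mem_ball ((t : (Af K)ˣ) : Af K) (idele (Units.mk0 (n : K) hn0'))
  obtain ⟨b, hb, hxb⟩ := mem_ball_iff_exists.1 hx
  rw [idele_val, Units.val_mk0, ← algebraMap_Af_coe] at hxb
  have hx' : algebraMap K (Af K) x = (t : (Af K)ˣ) + algebraMap (𝓞 K) (Af K) n * (-b) := by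
    linear_combination -hxb
  obtain ⟨a, rfl⟩ := exists_coe_eq_of_mem_Ohat (k := x) (by
    rw [hx']
    exact (Ohat K).add_mem t.2 ((Ohat K).mul_mem (algebraMap_mem_Ohat K n) ((Ohat K).neg_mem hb)))
  have hnk : n • (Submodule.Quotient.mk k : K ⧸ OinK K) = 0 := by
    rw [← Submodule.Quotient.mk_smul, Submodule.Quotient.mk_eq_zero]
    refine ⟨p, ?_⟩
    rw [← hk, Algebra.smul_def, mul_div_cancel₀ _ hn0']
    rfl
  have h1 := h _ n a hn0 hnk ⟨-b, (Ohat K).neg_mem hb, hx'⟩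
  have h1' := h' _ n a hn0 hnk ⟨-b, (Ohat K).neg_mem hb, hx'⟩
  obtain ⟨w, -, hw⟩ := M.φ_mem (Submodule.Quotient.mk k)
  rw [hw, ← Submodule.Quotient.mk_smul] at h1 h1'
  change _ = Submodule.Quotient.mk (a • w) at h1
  change _ = Submodule.Quotient.mk (a • w) at h1'
  rw [h1, Submodule.Quotient.eq, ← hΛ, hΛ', ← Submodule.Quotient.eq] at hv
  rw [h1', hv]

theorem Represents.isQuot_iff {ρ : Af K} {s : (Af K)ˣ} {c : ℂˣ} {t : Sgp K} {L M : KLattice K}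
    (hM : Represents ρ s c M) : IsQuot t L M ↔ Represents (((t : (Af K)ˣ) : Af K) * ρ) s c L := by
  refine ⟨fun h => ?_, fun h => hM.isQuot h⟩
  obtain ⟨L', hL'⟩ := exists_represents ((Ohat K).mul_mem t.2 hM.mem_Ohat) s c
  rwa [h.unique (hM.isQuot hL')]

theorem exists_isQuot (t : Sgp K) (M : KLattice K) : ∃ L, IsQuot t L M := by
  obtain ⟨ρ, s, c, hM⟩ := exists_rep M
  obtain ⟨L', hL'⟩ := exists_represents ((Ohat K).mul_mem t.2 hM.mem_Ohat) s c
  exact ⟨L', hM.isQuot hL'⟩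

/-- The `K`-lattice `(Λ, t φ)`. -/
noncomputable def mulL (t : Sgp K) (M : KLattice K) : KLattice K := (exists_isQuot t M).choose

theorem isQuot_iff {t : Sgp K} {L M : KLattice K} : IsQuot t L M ↔ L = mulL t M :=
  ⟨fun h => h.unique (exists_isQuot t M).choose_spec,
    fun h => h ▸ (exists_isQuot t M).choose_spec⟩

theorem Represents.mulL {ρ : Af K} {s : (Af K)ˣ} {c : ℂˣ} {M : KLattice K}
    (hM : Represents ρ s c M) (t : Sgp K) : Represents (((t : (Af K)ˣ) : Af K) * ρ) s c (mulL t M) :=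
  hM.isQuot_iff.1 (CMSystem.isQuot_iff.2 rfl)

theorem IsScaled.unique {l : ℂˣ} {L L' L'' : KLattice K} (h' : IsScaled l L L')
    (h'' : IsScaled l L L'') : L' = L'' := by
  have hΛ : ∀ v, v ∈ L'.Λ ↔ ((l⁻¹ : ℂˣ) : ℂ) * v ∈ L.Λ := fun v => by
    rw [h'.1, Units.mul_inv_cancel_left]
  have hΛ' : ∀ v, v ∈ L''.Λ ↔ ((l⁻¹ : ℂˣ) : ℂ) * v ∈ L.Λ := fun v => by
    rw [h''.1, Units.mul_inv_cancel_left]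
  have hΛΛ : L'.Λ = L''.Λ := by ext v; rw [hΛ, hΛ']
  refine KLattice.ext_of_iff hΛΛ fun a v hv => ?_
  obtain ⟨w, -, hw⟩ := L.φ_mem (Submodule.Quotient.mk a)
  rw [h'.2 _ w hw, Submodule.Quotient.eq, hΛΛ, ← Submodule.Quotient.eq] at hv
  rw [h''.2 _ w hw, hv]

theorem scaledEmb_inv_mul (l c : ℂˣ) (k : K) :
    scaledEmb (l⁻¹ * c) k = (l : ℂ) * scaledEmb c k := by
  rw [scaledEmb_apply, scaledEmb_apply, mul_inv, inv_inv, Units.val_mul, mul_assoc]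

theorem Represents.isScaled {ρ : Af K} {s : (Af K)ˣ} {c l : ℂˣ} {L L' : KLattice K}
    (h : Represents ρ s c L) (h' : Represents ρ s (l⁻¹ * c) L') : IsScaled l L L' := by
  have h1 := represents_iff.1 h
  have h1' := represents_iff.1 h'
  constructor
  · intro v
    rw [h1.1, h1'.1, lat, lat, Submodule.mem_map, Submodule.mem_map]
    refine exists_congr fun k => and_congr Iff.rfl ?_
    rw [scaledEmb_inv_mul]
    exact (mul_right_injective₀ l.ne_zero).eq_iff.symm
  · intro x v hv
    obtain ⟨a, rfl⟩ := Submodule.Quotient.mk_surjective _ x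
    obtain ⟨k, hk, hk1⟩ := h.exists_phi a
    rw [(h1'.2 a k).2 hk1, scaledEmb_inv_mul, Submodule.Quotient.eq, ← mul_sub]
    rw [hk, Submodule.Quotient.eq, h1.1] at hv
    obtain ⟨y, hy, hyv⟩ := hv
    rw [← hyv, h1'.1, ← scaledEmb_inv_mul]
    exact scaledEmb_mem_lat.2 hy

theorem Represents.isScaled_iff {ρ : Af K} {s : (Af K)ˣ} {c l : ℂˣ} {L L' : KLattice K}
    (h : Represents ρ s c L) : IsScaled l L L' ↔ Represents ρ s (l⁻¹ * c) L' := by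
  refine ⟨fun h' => ?_, h.isScaled⟩
  obtain ⟨L'', hL''⟩ := exists_represents h.mem_Ohat s (l⁻¹ * c)
  rwa [h'.unique (h.isScaled hL'')]

theorem exists_isScaled (l : ℂˣ) (L : KLattice K) : ∃ L', IsScaled l L L' := by
  obtain ⟨ρ, s, c, h⟩ := exists_rep L
  obtain ⟨L'', hL''⟩ := exists_represents h.mem_Ohat s (l⁻¹ * c)
  exact ⟨L'', h.isScaled hL''⟩

/-- The scaled `K`-lattice `(l Λ, l φ)`. -/
noncomputable def scaleL (l : ℂˣ) (L : KLattice K) : KLattice K := (exists_isScaled l L).choose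

theorem isScaled_iff {l : ℂˣ} {L L' : KLattice K} : IsScaled l L L' ↔ L' = scaleL l L :=
  ⟨fun h => h.unique (exists_isScaled l L).choose_spec,
    fun h => h ▸ (exists_isScaled l L).choose_spec⟩

theorem Represents.scaleL {ρ : Af K} {s : (Af K)ˣ} {c : ℂˣ} {L : KLattice K}
    (h : Represents ρ s c L) (l : ℂˣ) : Represents ρ s (l⁻¹ * c) (scaleL l L) :=
  h.isScaled_iff.1 (CMSystem.isScaled_iff.2 rfl)

theorem mulL_mul (t u : Sgp K) (L : KLattice K) : mulL (t * u) L = mulL t (mulL u L) := by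
  obtain ⟨ρ, s, c, h⟩ := exists_rep L
  refine (h.mulL (t * u)).unique ?_
  have := (h.mulL u).mulL t
  rwa [← mul_assoc] at this

theorem mulL_one (L : KLattice K) : mulL 1 L = L := by
  obtain ⟨ρ, s, c, h⟩ := exists_rep L
  refine (h.mulL 1).unique ?_
  simpa using h

theorem scaleL_one (L : KLattice K) : scaleL 1 L = L := by
  obtain ⟨ρ, s, c, h⟩ := exists_rep L
  refine (h.scaleL 1).unique ?_
  simpa using h

theorem scaleL_mul (l m : ℂˣ) (L : KLattice K) : scaleL (l * m) L = scaleL l (scaleL m L) := by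
  obtain ⟨ρ, s, c, h⟩ := exists_rep L
  refine (h.scaleL (l * m)).unique ?_
  have := (h.scaleL m).scaleL l
  rwa [← mul_assoc, ← mul_inv] at this

theorem scaleL_inv_scaleL (l : ℂˣ) (L : KLattice K) : scaleL l⁻¹ (scaleL l L) = L := by
  rw [← scaleL_mul, inv_mul_cancel, scaleL_one]

theorem scaleL_scaleL_inv (l : ℂˣ) (L : KLattice K) : scaleL l (scaleL l⁻¹ L) = L := by
  rw [← scaleL_mul, mul_inv_cancel, scaleL_one]

theorem mulL_scaleL (t : Sgp K) (l : ℂˣ) (L : KLattice K) :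
    mulL t (scaleL l L) = scaleL l (mulL t L) := by
  obtain ⟨ρ, s, c, h⟩ := exists_rep L
  exact ((h.scaleL l).mulL t).unique ((h.mulL t).scaleL l)

theorem Represents.commens_mulL_iff {ρ ρ' : Af K} {s s' : (Af K)ˣ} {c : ℂˣ} {L L' : KLattice K}
    (h : Represents ρ s c L) (h' : Represents ρ' s' c L') (t : Sgp K) :
    Commens (CMSystem.mulL t L) (CMSystem.mulL t L') ↔ Commens L L' := by
  rw [(h.mulL t).commens_iff (h'.mulL t), h.commens_iff h', mul_left_comm,
    mul_left_comm (s' : Af K), (t : (Af K)ˣ).isUnit.mul_right_inj]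

theorem Represents.kspan_mulL {ρ : Af K} {s : (Af K)ˣ} {c : ℂˣ} {L : KLattice K}
    (h : Represents ρ s c L) (t : Sgp K) : KSpan (CMSystem.mulL t L).Λ = KSpan L.Λ :=
  (h.mulL t).kspan.trans h.kspan.symm

theorem commens_mulL_iff (t : Sgp K) {L L' : KLattice K} :
    Commens (mulL t L) (mulL t L') ↔ Commens L L' := by
  obtain ⟨ρ, s, c, h⟩ := exists_rep L
  obtain ⟨ρ', s', c', h'⟩ := exists_rep L'
  constructor
  · intro H
    obtain ⟨ρ'', s'', h''⟩ := exists_represents_of_kspan_eq (L := L') (c := c)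
      (by rw [← h'.kspan_mulL t, ← H.1, h.kspan_mulL, h.kspan])
    exact (h.commens_mulL_iff h'' t).1 H
  · intro H
    obtain ⟨ρ'', s'', h'', -⟩ := H.exists_represents h
    exact (h.commens_mulL_iff h'' t).2 H

/-- Equality of the images makes the two lattices commensurable, hence representable with the same
`c` and the same `s ρ`; `s Ô` is not changed by the operation, so it agrees as well. -/
theorem mulL_injective (t : Sgp K) : Function.Injective (mulL t : KLattice K → KLattice K) := by
  intro L L' H
  obtain ⟨ρ, s, c, h⟩ := exists_rep L
  obtain ⟨ρ', s', h', e⟩ :=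
    ((commens_mulL_iff t).1 (H ▸ Commens.refl _ : Commens (mulL t L) (mulL t L'))).exists_represents h
  exact (h.eq_iff h').2 ⟨(((h.mulL t).eq_iff (h'.mulL t)).1 H).1, e⟩

theorem Commens.scaleL {L L' : KLattice K} (H : Commens L L') (l : ℂˣ) :
    Commens (scaleL l L) (scaleL l L') := by
  obtain ⟨ρ, s, c, h⟩ := exists_rep L
  obtain ⟨ρ', s', h', e⟩ := H.exists_represents h
  exact ((h.scaleL l).commens_iff (h'.scaleL l)).2 e

theorem commens_scaleL_iff (l : ℂˣ) {L L' : KLattice K} :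
    Commens (scaleL l L) (scaleL l L') ↔ Commens L L' := by
  refine ⟨fun H => ?_, fun H => H.scaleL l⟩
  have := H.scaleL l⁻¹
  rwa [scaleL_inv_scaleL, scaleL_inv_scaleL] at this

theorem scaleL_injective (l : ℂˣ) : Function.Injective (scaleL l : KLattice K → KLattice K) :=
  fun L L' h => by rw [← scaleL_inv_scaleL l L, h, scaleL_inv_scaleL]

/-- A lift of `φ` modulo `J Λ` is the same as a `K`-lattice with module `J Λ` commensurable to `L`.
Since `J Λ` corresponds to `t s Ô`, such a lattice exists exactly when `s ρ ∈ t s Ô`. -/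
theorem Represents.divisible_iff {ρ : Af K} {s : (Af K)ˣ} {c : ℂˣ} {t : Sgp K} {L : KLattice K}
    (h : Represents ρ s c L) :
    Divisible (idealOf t) L ↔ (((t : (Af K)ˣ)⁻¹ : (Af K)ˣ) : Af K) * ρ ∈ Ohat K := by
  have hlat : idealOf t • lat s c = lat ((t : (Af K)ˣ) * s) c := by
    rw [lat, lat, ← idealOf_smul_fid, Submodule.map_smul'']
  have h1 := represents_iff.1 h
  constructor
  · rintro ⟨ψ, hψ⟩
    have hlift : ∀ x, ∃ v ∈ KSpan L.Λ, ψ x = Submodule.Quotient.mk v := by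
      intro x
      obtain ⟨v, hv⟩ := Submodule.Quotient.mk_surjective _ (ψ x)
      refine ⟨v, ?_, hv.symm⟩
      obtain ⟨w, hw, hxw⟩ := L.φ_mem x
      have h2 := hψ x
      rw [← hv, hxw] at h2
      have h3 : v - w ∈ L.Λ := (Submodule.Quotient.eq _).1 h2
      have h4 := (KSpan L.Λ).add_mem (Submodule.subset_span h3) hw
      rwa [sub_add_cancel] at h4
    have hspan : KSpan (idealOf t • L.Λ) = KSpan L.Λ := by
      rw [h1.1, hlat, kspan_lat, kspan_lat]
    -- The lift is turned into a `K`-lattice, so that `Commens.exists_represents` gives it an adelic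
    -- representation.
    let L' : KLattice K := ⟨idealOf t • L.Λ,
      Submodule.FG.smul (IsNoetherian.noetherian (idealOf t)) L.fg, hspan ▸ L.rank_one, ψ,
      hspan ▸ hlift⟩
    have hc : Commens L L' := by
      refine ⟨hspan.symm, fun x => ?_⟩
      rw [← hψ]
      obtain ⟨v, hv⟩ := Submodule.Quotient.mk_surjective _ (ψ x)
      change _ = Submodule.factor _ (ψ x)
      rw [← hv]
      rfl
    obtain ⟨ρ', s', h', e⟩ := hc.exists_represents h
    have h5 : lat s' c = lat ((t : (Af K)ˣ) * s) c := by
      rw [← hlat, ← h1.1, ← (represents_iff.1 h').1]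
    rw [lat, lat, (Submodule.map_injective_of_injective (scaledEmb_injective c)).eq_iff,
      fid_eq_iff] at h5
    have h6 : (s : Af K) * ρ ∈ ball s' := by
      rw [e, mul_comm]
      exact mul_mem_ball h'.mem_Ohat (self_mem_ball _)
    rw [h5, mem_ball, mul_inv, Units.val_mul, mul_assoc, Units.inv_mul_cancel_left] at h6
    exact h6
  · intro hρ
    obtain ⟨L', h'⟩ := exists_represents hρ ((t : (Af K)ˣ) * s) c
    have hc : Commens L L' := (h.commens_iff h').2 (by
      rw [Units.val_mul]
      linear_combination (-(s : Af K) * ρ) * (t : (Af K)ˣ).mul_inv)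
    have hΛ : L'.Λ = idealOf t • L.Λ := by rw [h1.1, hlat, (represents_iff.1 h').1]
    have hle : L'.Λ ≤ L.Λ := hΛ ▸ Submodule.smul_le_right
    refine ⟨Submodule.factor hΛ.le ∘ₗ L'.φ, fun x => ?_⟩
    obtain ⟨v, -, hv⟩ := L'.φ_mem x
    obtain ⟨w, -, hw⟩ := L.φ_mem x
    have h2 := hc.2 x
    rw [hv, hw] at h2
    have h3 : w - v ∈ L.Λ ⊔ L'.Λ := (Submodule.Quotient.eq _).1 h2
    rw [sup_eq_left.2 hle] at h3
    rw [hw, LinearMap.comp_apply, hv, eq_comm]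
    exact (Submodule.Quotient.eq _).2 h3

/-- By the criterion `t⁻¹ ρ ∈ Ô`, dividing `ρ` by `t` produces the required lattice. This turns
divisibility into membership in the range of `mulL t`. -/
theorem divisible_iff {t : Sgp K} {L : KLattice K} :
    Divisible (idealOf t) L ↔ ∃ M, L = mulL t M := by
  obtain ⟨ρ, s, c, h⟩ := exists_rep L
  rw [h.divisible_iff]
  constructor
  · intro hρ
    obtain ⟨M, hM⟩ := exists_represents hρ s c
    refine ⟨M, h.unique ?_⟩
    have := hM.mulL t
    rwa [Units.mul_inv_cancel_left] at this
  · rintro ⟨M, rfl⟩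
    obtain ⟨ρ', s', hM⟩ := exists_represents_of_kspan_eq (L := M) (c := c) (by
      obtain ⟨ρ', s', c', hM⟩ := exists_rep M
      rw [← hM.kspan_mulL t, h.kspan])
    have h1 := ((hM.mulL t).eq_iff h).1 rfl
    have h2 : ((s : Af K) * (((t : (Af K)ˣ)⁻¹ : (Af K)ˣ) : Af K) * ρ) ∈ ball s := by
      have h3 : ((s : Af K) * (((t : (Af K)ˣ)⁻¹ : (Af K)ˣ) : Af K) * ρ) = s' * ρ' := by
        have h4 := h1.2
        have h5 := (t : (Af K)ˣ).inv_mul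
        linear_combination (-(((t : (Af K)ˣ)⁻¹ : (Af K)ˣ) : Af K)) * h4 + (s' * ρ') * h5
      rw [h3, mul_comm, ← h1.1]
      exact mul_mem_ball hM.mem_Ohat (self_mem_ball s')
    rwa [mem_ball, mul_assoc, Units.inv_mul_cancel_left] at h2

/-- An element of `𝓞 ∖ {0}` as an element of `K^*`. -/
noncomputable def fieldUnit (a : (𝓞 K)⁰) : Kˣ := Units.mk0 ((a : 𝓞 K) : K) (by simp)

@[simp]
theorem fieldUnit_val (a : (𝓞 K)⁰) : ((fieldUnit a : Kˣ) : K) = (a : 𝓞 K) := rfl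

theorem diag_val (a : (𝓞 K)⁰) : (diag K a : (Af K)ˣ) = idele (fieldUnit a) := rfl

/-- The `K`-lattice `(a⁻¹ Λ, φ)`. -/
noncomputable def enlarge (a : (𝓞 K)⁰) (L : KLattice K) : KLattice K :=
  scaleL (embUnits (fieldUnit a))⁻¹ (mulL (diag K a) L)

/-- The scaling by a principal element is traded for a principal idele, which moves it from `c` to
`s`. In this form `c` and `s ρ` are visibly unchanged, whence commensurability with `L`. -/
theorem Represents.enlarge {ρ : Af K} {s : (Af K)ˣ} {c : ℂˣ} {L : KLattice K}
    (h : Represents ρ s c L) (a : (𝓞 K)⁰) :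
    Represents (((idele (fieldUnit a) : (Af K)ˣ) : Af K) * ρ) ((idele (fieldUnit a))⁻¹ * s) c
      (enlarge a L) := by
  have h1 := ((h.mulL (diag K a)).scaleL (embUnits (fieldUnit a))⁻¹).idele_mul (fieldUnit a)⁻¹
  rwa [inv_inv, map_inv, map_inv, inv_mul_cancel_left, diag_val] at h1

theorem commens_enlarge (a : (𝓞 K)⁰) (L : KLattice K) : Commens (enlarge a L) L := by
  obtain ⟨ρ, s, c, h⟩ := exists_rep L
  refine ((h.enlarge a).commens_iff h).2 ?_
  rw [mul_comm (idele (fieldUnit a))⁻¹, Units.val_mul, mul_assoc, Units.inv_mul_cancel_left]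

theorem enlarge_injective (a : (𝓞 K)⁰) : Function.Injective (enlarge a : KLattice K → KLattice K) :=
  (scaleL_injective _).comp (mulL_injective _)

theorem mulL_enlarge (t : Sgp K) (a : (𝓞 K)⁰) (L : KLattice K) :
    mulL t (enlarge a L) = enlarge a (mulL t L) := by
  rw [enlarge, enlarge, mulL_scaleL, ← mulL_mul, ← mulL_mul, mul_comm]

theorem enlarge_scaleL (a : (𝓞 K)⁰) (l : ℂˣ) (L : KLattice K) :
    enlarge a (scaleL l L) = scaleL l (enlarge a L) := by
  rw [enlarge, enlarge, mulL_scaleL, ← scaleL_mul, ← scaleL_mul, mul_comm]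

theorem divisible_diag_iff {a : (𝓞 K)⁰} {L : KLattice K} :
    Divisible (idealOf (diag K a)) L ↔ ∃ M, L = enlarge a M := by
  rw [divisible_iff]
  constructor
  · rintro ⟨M, rfl⟩
    exact ⟨scaleL (embUnits (fieldUnit a)) M, by
      rw [enlarge_scaleL, enlarge, scaleL_scaleL_inv]⟩
  · rintro ⟨M, rfl⟩
    exact ⟨scaleL (embUnits (fieldUnit a))⁻¹ M, by rw [mulL_scaleL, enlarge]⟩

theorem Divisible.scaleL {t : Sgp K} {L : KLattice K} (h : Divisible (idealOf t) L) (l : ℂˣ) :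
    Divisible (idealOf t) (scaleL l L) := by
  obtain ⟨M, rfl⟩ := divisible_iff.1 h
  exact divisible_iff.2 ⟨_, (mulL_scaleL t l M).symm⟩

theorem divisible_scaleL_iff {t : Sgp K} {l : ℂˣ} {L : KLattice K} :
    Divisible (idealOf t) (scaleL l L) ↔ Divisible (idealOf t) L := by
  refine ⟨fun h => ?_, fun h => h.scaleL l⟩
  have := h.scaleL l⁻¹
  rwa [scaleL_inv_scaleL] at this

/-- For commensurable pairs, the condition defining `μ_a` is that `L` is the enlargement of `L'`
by the factor `a⁻¹`. -/
theorem Commens.eq_enlarge_iff {a : (𝓞 K)⁰} {L L' : KLattice K} (H : Commens L L') :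
    ((∀ v : ℂ, v ∈ L.Λ ↔ (a : 𝓞 K) • v ∈ L'.Λ) ∧
      (∃ h : L'.Λ ≤ L.Λ, ∀ x, L.φ x = Submodule.factor h (L'.φ x))) ↔ L = enlarge a L' := by
  obtain ⟨ρ, s, c, h⟩ := exists_rep L
  obtain ⟨ρ', s', h', e⟩ := H.exists_represents h
  have hmem : ∀ v : ℂ, v ∈ (enlarge a L').Λ ↔ (a : 𝓞 K) • v ∈ L'.Λ := by
    intro v
    have h1 := (h'.mulL (diag K a)).scaleL (embUnits (fieldUnit a))⁻¹
    have h2 := ((h'.mulL (diag K a)).ball_eq h').2 rfl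
    have h3 := ((h'.mulL (diag K a)).isScaled h1).1 ((a : 𝓞 K) • v)
    rw [h2] at h3
    rw [h3]
    have h4 : (((embUnits (fieldUnit a))⁻¹ : ℂˣ) : ℂ) * ((a : 𝓞 K) • v) = v := by
      have : (a : 𝓞 K) • v = ((embUnits (fieldUnit a) : ℂˣ) : ℂ) * v := by
        rw [Algebra.smul_def, embUnits_val, fieldUnit_val, IsScalarTower.algebraMap_apply (𝓞 K) K ℂ]
      rw [this, Units.inv_mul_cancel_left]
    rw [h4]
    rfl
  constructor
  -- Commensurability already fixes the adele `s ρ`, so equality of the modules determines the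
  -- lattice.
  · rintro ⟨h1, -⟩
    have hΛ : L.Λ = (enlarge a L').Λ := by ext v; rw [h1, hmem]
    refine (h.eq_iff (h'.enlarge a)).2 ⟨(h.ball_eq (h'.enlarge a)).1 hΛ, ?_⟩
    rw [e, mul_comm (idele (fieldUnit a))⁻¹, Units.val_mul, mul_assoc, Units.inv_mul_cancel_left]
  · intro hL
    have h1 : ∀ v : ℂ, v ∈ L.Λ ↔ (a : 𝓞 K) • v ∈ L'.Λ := fun v => by rw [hL, hmem]
    have hle : L'.Λ ≤ L.Λ := fun v hv => (h1 v).2 (L'.Λ.smul_mem _ hv)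
    refine ⟨h1, hle, fun x => ?_⟩
    obtain ⟨v, -, hv⟩ := L'.φ_mem x
    obtain ⟨w, -, hw⟩ := L.φ_mem x
    have h2 := H.2 x
    rw [hv, hw] at h2
    have h3 : w - v ∈ L.Λ ⊔ L'.Λ := (Submodule.Quotient.eq _).1 h2
    rw [sup_eq_left.2 hle] at h3
    rw [hw, hv]
    exact (Submodule.Quotient.eq _).2 h3

end Operations

/-! ### Covolumes and their behavior under scaling. -/

section Covolume

variable {K : Type*} [Field K] [NumberField K] [Algebra K ℂ]

theorem exists_im_ne_zero [NumberField.IsTotallyComplex K] : ∃ k : K, (algebraMap K ℂ k).im ≠ 0 := by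
  by_contra! h
  have h1 : ComplexEmbedding.IsReal (algebraMap K ℂ) := by
    ext k
    exact Complex.conj_eq_iff_im.2 (h k)
  exact (InfinitePlace.not_isReal_iff_isComplex.2
    (NumberField.IsTotallyComplex.isComplex (InfinitePlace.mk (algebraMap K ℂ))))
    ⟨_, h1, rfl⟩

theorem span_range_algebraMap_eq_top [NumberField.IsTotallyComplex K] :
    Submodule.span ℝ (Set.range (algebraMap K ℂ)) = ⊤ := by
  obtain ⟨k, hk⟩ := exists_im_ne_zero (K := K)
  rw [eq_top_iff]
  intro w _
  have hw : w = (w.re - w.im / (algebraMap K ℂ k).im * (algebraMap K ℂ k).re) • algebraMap K ℂ 1 +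
      (w.im / (algebraMap K ℂ k).im) • algebraMap K ℂ k := by
    apply Complex.ext
    · simp
    · simp [hk]
  rw [hw]
  exact Submodule.add_mem _ (Submodule.smul_mem _ _ (Submodule.subset_span ⟨_, rfl⟩))
    (Submodule.smul_mem _ _ (Submodule.subset_span ⟨_, rfl⟩))

theorem fracIdeal_ne_zero (s : (Af K)ˣ) : fracIdeal s ≠ 0 := by
  intro h
  obtain ⟨k, hk, hk0⟩ := exists_ne_zero_mem_fid s
  have h1 : k ∈ fracIdeal s := hk
  rw [h] at h1
  exact hk0 (by simpa using h1)

/-- The lattice `Λ`, as a `ℤ`-submodule of `ℂ`. -/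
abbrev intLat (L : KLattice K) : Submodule ℤ ℂ := AddSubgroup.toIntSubmodule L.Λ.toAddSubgroup

/-- A `ℤ`-basis of the fractional ideal spans `K` over `ℚ`, and `K` spans `ℂ` over `ℝ` because it
contains a nonreal number. Two vectors spanning the real plane form a basis. -/
theorem exists_real_basis (hdeg : Module.finrank ℚ K = 2) [NumberField.IsTotallyComplex K]
    (L : KLattice K) : ∃ B : Module.Basis (Fin 2) ℝ ℂ, intLat L = Submodule.span ℤ (Set.range B) := by
  obtain ⟨ρ, s, c, h⟩ := exists_rep L
  let I : (FractionalIdeal (𝓞 K)⁰ K)ˣ := Units.mk0 _ (fracIdeal_ne_zero s)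
  let β := basisOfFractionalIdeal K I
  have hcard : Fintype.card (Module.Free.ChooseBasisIndex ℤ I) = 2 := by
    rw [← hdeg, Module.finrank_eq_card_basis β]
  let e := Fintype.equivFinOfCardEq hcard
  let b : Fin 2 → ℂ := fun i => scaledEmb c (β (e.symm i))
  have hspanK : ∀ k : K, algebraMap K ℂ k ∈ Submodule.span ℝ (Set.range fun i => algebraMap K ℂ (β i)) := by
    intro k
    rw [← β.sum_repr k, map_sum]
    refine Submodule.sum_mem _ fun i _ => ?_
    rw [Algebra.smul_def, map_mul]
    have : algebraMap K ℂ (algebraMap ℚ K (β.repr k i)) = (((β.repr k i : ℚ) : ℝ) : ℂ) := by simp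
    rw [this, ← Complex.real_smul]
    exact Submodule.smul_mem _ _ (Submodule.subset_span ⟨i, rfl⟩)
  have htop : ⊤ ≤ Submodule.span ℝ (Set.range b) := by
    have h1 : Submodule.span ℝ (Set.range fun i => algebraMap K ℂ (β i)) = ⊤ := by
      rw [eq_top_iff, ← span_range_algebraMap_eq_top (K := K), Submodule.span_le]
      rintro _ ⟨k, rfl⟩
      exact hspanK k
    let m : ℂ →ₗ[ℝ] ℂ := LinearMap.mulLeft ℝ ((c⁻¹ : ℂˣ) : ℂ)
    have hm : Function.Surjective m := fun z =>
      ⟨c * z, by rw [LinearMap.mulLeft_apply, Units.inv_mul_cancel_left]⟩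
    have h2 : Submodule.map m ⊤ = ⊤ := by rw [Submodule.map_top, LinearMap.range_eq_top.2 hm]
    rw [← h2, ← h1, Submodule.map_span, Submodule.span_le]
    rintro _ ⟨_, ⟨i, rfl⟩, rfl⟩
    exact Submodule.subset_span ⟨e i, by simp [b, m, scaledEmb_apply]⟩
  let B : Module.Basis (Fin 2) ℝ ℂ := basisOfTopLeSpanOfCardEqFinrank b htop (by simp)
  refine ⟨B, ?_⟩
  have hB : Set.range B = (scaledEmb c).toAddMonoidHom.toIntLinearMap '' Set.range β := by
    rw [coe_basisOfTopLeSpanOfCardEqFinrank, ← Set.range_comp]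
    exact e.symm.surjective.range_comp (fun i => scaledEmb c (β i))
  rw [hB, ← Submodule.map_span]
  ext v
  rw [Submodule.mem_map]
  change v ∈ L.Λ ↔ _
  rw [(represents_iff.1 h).1, lat, Submodule.mem_map]
  refine exists_congr fun k => and_congr ?_ Iff.rfl
  have h1 : k ∈ fid s ↔ k ∈ ((I : (FractionalIdeal (𝓞 K)⁰ K)) : Set K) := Iff.rfl
  rw [h1, ← mem_span_basisOfFractionalIdeal K]

theorem covol_eq_of_basis {L : KLattice K} {B : Module.Basis (Fin 2) ℝ ℂ}
    (h : intLat L = Submodule.span ℤ (Set.range B)) :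
    covol L = |Complex.basisOneI.det B| *
      MeasureTheory.volume.real (ZSpan.fundamentalDomain Complex.basisOneI) := by
  have h1 : covol L = ZLattice.covolume (Submodule.span ℤ (Set.range B)) := by
    rw [covol, ← h]
  rw [h1, ZLattice.covolume_eq_det_mul_measureReal _ _ (B.restrictScalars ℤ) Complex.basisOneI]
  congr 3
  ext i
  simp

theorem covol_pos (hdeg : Module.finrank ℚ K = 2) [NumberField.IsTotallyComplex K]
    (L : KLattice K) : 0 < covol L := by
  obtain ⟨B, hB⟩ := exists_real_basis hdeg L
  have h1 : covol L = ZLattice.covolume (Submodule.span ℤ (Set.range B)) := by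
    rw [covol, ← hB]
  rw [h1]
  exact ZLattice.covolume_pos _ _

theorem covol_scaleL (hdeg : Module.finrank ℚ K = 2) [NumberField.IsTotallyComplex K]
    (l : ℂˣ) (L : KLattice K) :
    covol (scaleL l L) = |LinearMap.det (LinearMap.mulLeft ℝ (l : ℂ))| * covol L := by
  obtain ⟨B, hB⟩ := exists_real_basis hdeg L
  let m : ℂ ≃ₗ[ℝ] ℂ := LinearEquiv.ofBijective (LinearMap.mulLeft ℝ (l : ℂ))
    ⟨mul_right_injective₀ l.ne_zero, fun z =>
      ⟨((l⁻¹ : ℂˣ) : ℂ) * z, by rw [LinearMap.mulLeft_apply, Units.mul_inv_cancel_left]⟩⟩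
  have hB' : intLat (scaleL l L) = Submodule.span ℤ (Set.range (B.map m)) := by
    have h1 : Set.range (B.map m) = (LinearMap.mulLeft ℤ (l : ℂ)) '' Set.range B := by
      rw [← Set.range_comp]; rfl
    rw [h1, ← Submodule.map_span, ← hB]
    ext v
    rw [Submodule.mem_map]
    have h2 := (isScaled_iff.2 (rfl : scaleL l L = _)).1
    constructor
    · intro hv
      refine ⟨((l⁻¹ : ℂˣ) : ℂ) * v, (h2 _).2 ?_, ?_⟩
      · rwa [Units.mul_inv_cancel_left]
      · rw [LinearMap.mulLeft_apply, Units.mul_inv_cancel_left]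
    · rintro ⟨w, hw, rfl⟩
      exact (h2 w).1 hw
  rw [covol_eq_of_basis hB, covol_eq_of_basis hB', ← mul_assoc, ← abs_mul, ← Module.Basis.det_comp]
  rfl

/-- Scaling multiplies both covolumes by the same nonzero determinant. So the ratio is a function on
`G_K`, although the covolume itself is not scale invariant. -/
theorem covolRatio_scaleL (hdeg : Module.finrank ℚ K = 2) [NumberField.IsTotallyComplex K]
    (l : ℂˣ) (L L' : KLattice K) :
    covolRatio (scaleL l L) (scaleL l L') = covolRatio L L' := by
  have h := covol_pos hdeg (scaleL l L)
  rw [covol_scaleL hdeg] at h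
  rw [covolRatio, covol_scaleL hdeg, covol_scaleL hdeg, mul_div_mul_left _ _ (left_ne_zero_of_mul h.ne')]
  rfl

theorem covolRatio_pos (hdeg : Module.finrank ℚ K = 2) [NumberField.IsTotallyComplex K]
    (L L' : KLattice K) : 0 < covolRatio L L' :=
  div_pos (covol_pos hdeg L') (covol_pos hdeg L)

theorem covolRatio_mul (hdeg : Module.finrank ℚ K = 2) [NumberField.IsTotallyComplex K]
    (L L' L'' : KLattice K) :
    covolRatio L L' * covolRatio L' L'' = covolRatio L L'' := by
  have := (covol_pos hdeg L').ne'
  rw [covolRatio, covolRatio, covolRatio]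
  field_simp

theorem covol_eq_of_Λ_eq {L L' : KLattice K} (h : L.Λ = L'.Λ) : covol L = covol L' := by
  rw [covol, covol, h]

theorem mulL_Λ (t : Sgp K) (L : KLattice K) : (mulL t L).Λ = L.Λ :=
  (isQuot_iff.2 (rfl : mulL t L = _)).1.symm

theorem covolRatio_mulL (t : Sgp K) (L L' : KLattice K) :
    covolRatio (mulL t L) (mulL t L') = covolRatio L L' := by
  rw [covolRatio, covolRatio, covol_eq_of_Λ_eq (mulL_Λ t L), covol_eq_of_Λ_eq (mulL_Λ t L')]

end Covolume

/-! ### The topology of `G_K` through adelic parameters. -/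

section Topology

variable {K : Type*} [Field K] [NumberField K] [Algebra K ℂ]

theorem isOpen_OhatUnits : IsOpen (OhatUnits K : Set (Af K)ˣ) := by
  have : (OhatUnits K : Set (Af K)ˣ) = (fun u : (Af K)ˣ => (u : Af K)) ⁻¹' (Ohat K : Set (Af K)) ∩
      (fun u : (Af K)ˣ => ((u⁻¹ : (Af K)ˣ) : Af K)) ⁻¹' (Ohat K : Set (Af K)) := by
    ext u
    exact mem_OhatUnits
  rw [this]
  exact (isOpen_Ohat.preimage Units.continuous_val).inter
    (isOpen_Ohat.preimage (Units.continuous_val.comp continuous_inv))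

/-- The class in `G_K` of a pair of commensurable `K`-lattices. -/
def gk {L L' : KLattice K} (h : Commens L L') : GK K := Quot.mk _ ⟨(L, L'), h⟩

theorem gk_scaleL (l : ℂˣ) {L L' : KLattice K} (h : Commens L L') : gk (h.scaleL l) = gk h :=
  (Quot.sound ⟨l, isScaled_iff.2 rfl, isScaled_iff.2 rfl⟩).symm

theorem gk_eq_iff {L L' M M' : KLattice K} {h : Commens L L'} {h' : Commens M M'} :
    gk h = gk h' ↔ ∃ l, M = scaleL l L ∧ M' = scaleL l L' := by
  constructor
  · intro e
    have he := Quot.eqvGen_exact e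
    rw [Equivalence.eqvGen_iff] at he
    · obtain ⟨l, h1, h2⟩ := he
      exact ⟨l, isScaled_iff.1 h1, isScaled_iff.1 h2⟩
    · refine ⟨fun γ => ⟨1, isScaled_iff.2 (scaleL_one _).symm, isScaled_iff.2 (scaleL_one _).symm⟩,
        ?_, ?_⟩
      · rintro γ γ' ⟨l, h1, h2⟩
        rw [isScaled_iff] at h1 h2
        refine ⟨l⁻¹, isScaled_iff.2 ?_, isScaled_iff.2 ?_⟩
        · rw [h1, scaleL_inv_scaleL]
        · rw [h2, scaleL_inv_scaleL]
      · rintro γ γ' γ'' ⟨l, h1, h2⟩ ⟨m, h3, h4⟩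
        rw [isScaled_iff] at h1 h2 h3 h4
        refine ⟨m * l, isScaled_iff.2 ?_, isScaled_iff.2 ?_⟩
        · rw [h3, h1, scaleL_mul]
        · rw [h4, h2, scaleL_mul]
  · rintro ⟨l, rfl, rfl⟩
    exact (gk_scaleL l h).symm

theorem exists_gk (γ : GK K) : ∃ (L L' : KLattice K) (h : Commens L L'), γ = gk h := by
  obtain ⟨⟨⟨L, L'⟩, h⟩, rfl⟩ := Quot.exists_rep γ
  exact ⟨L, L', h, rfl⟩

/-- The function on `G_K` given by a function of weight zero on pairs of lattices. -/
def liftGK {α : Type*} (F : KLattice K → KLattice K → α)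
    (hF : ∀ l L L', Commens L L' → F (scaleL l L) (scaleL l L') = F L L') : GK K → α :=
  Quot.lift (fun γ => F γ.1.1 γ.1.2) (by
    rintro ⟨⟨L, L'⟩, h⟩ ⟨⟨M, M'⟩, h'⟩ ⟨l, h1, h2⟩
    rw [isScaled_iff] at h1 h2
    simp only at h1 h2
    subst h1 h2
    exact (hF l L L' h).symm)

variable (K) in
/-- The parameters `((ρ, s), g)` of pairs of commensurable `K`-lattices. -/
abbrev PairParam : Type _ :=
  {p : Af K × (Af K)ˣ × ℂˣ × (Af K)ˣ // p.1 ∈ Ohat K ∧ (p.2.2.2 : Af K) * p.1 ∈ Ohat K}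

namespace PairParam

/-- The first lattice of the pair. -/
noncomputable def fst (x : PairParam K) : KLattice K :=
  (exists_represents x.2.1 x.1.2.1 x.1.2.2.1).choose

/-- The second lattice of the pair. -/
noncomputable def snd (x : PairParam K) : KLattice K :=
  (exists_represents x.2.2 (x.1.2.2.2⁻¹ * x.1.2.1) x.1.2.2.1).choose

theorem represents_fst (x : PairParam K) : Represents x.1.1 x.1.2.1 x.1.2.2.1 x.fst :=
  (exists_represents x.2.1 x.1.2.1 x.1.2.2.1).choose_spec

theorem represents_snd (x : PairParam K) : Represents ((x.1.2.2.2 : Af K) * x.1.1)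
    (x.1.2.2.2⁻¹ * x.1.2.1) x.1.2.2.1 x.snd :=
  (exists_represents x.2.2 (x.1.2.2.2⁻¹ * x.1.2.1) x.1.2.2.1).choose_spec

theorem commens (x : PairParam K) : Commens x.fst x.snd := by
  refine (x.represents_fst.commens_iff x.represents_snd).2 ?_
  rw [mul_comm x.1.2.2.2⁻¹, Units.val_mul, mul_assoc, Units.inv_mul_cancel_left]

/-- The pair of lattices attached to a parameter. -/
noncomputable def toGK (x : PairParam K) : GK K := gk x.commens

theorem toGK_eq {x : PairParam K} {L L' : KLattice K} (h : Represents x.1.1 x.1.2.1 x.1.2.2.1 L)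
    (h' : Represents ((x.1.2.2.2 : Af K) * x.1.1) (x.1.2.2.2⁻¹ * x.1.2.1) x.1.2.2.1 L')
    (H : Commens L L') : x.toGK = gk H := by
  obtain rfl := h.unique x.represents_fst
  obtain rfl := h'.unique x.represents_snd
  rfl

theorem exists_of_commens {ρ ρ' : Af K} {s s' : (Af K)ˣ} {c : ℂˣ} {L L' : KLattice K}
    (h : Represents ρ s c L) (h' : Represents ρ' s' c L') (H : Commens L L') :
    ∃ x : PairParam K, x.1 = (ρ, s, c, s * s'⁻¹) ∧ x.fst = L ∧ x.snd = L' := by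
  have e := (h.commens_iff h').1 H
  have e1 : ((s * s'⁻¹ : (Af K)ˣ) : Af K) * ρ = ρ' := by
    rw [mul_comm, Units.val_mul, mul_comm, mul_assoc, mul_comm ((s'⁻¹ : (Af K)ˣ) : Af K), ← mul_assoc,
      e, mul_comm, Units.inv_mul_cancel_left]
  have e2 : (s * s'⁻¹)⁻¹ * s = s' := by group
  let x : PairParam K := ⟨(ρ, s, c, s * s'⁻¹), h.mem_Ohat, e1 ▸ h'.mem_Ohat⟩
  refine ⟨x, rfl, x.represents_fst.unique h, ?_⟩
  refine x.represents_snd.unique ?_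
  change Represents (((s * s'⁻¹ : (Af K)ˣ) : Af K) * ρ) ((s * s'⁻¹)⁻¹ * s) c L'
  rw [e1, e2]
  exact h'

theorem exists_eq {L L' : KLattice K} (H : Commens L L') :
    ∃ x : PairParam K, x.fst = L ∧ x.snd = L' := by
  obtain ⟨ρ, s, c, h⟩ := exists_rep L
  obtain ⟨ρ', s', h', e⟩ := H.exists_represents h
  obtain ⟨x, -, h1, h2⟩ := exists_of_commens h h' H
  exact ⟨x, h1, h2⟩

theorem toGK_surjective : Function.Surjective (toGK : PairParam K → GK K) := by
  intro γ
  obtain ⟨L, L', H, rfl⟩ := exists_gk γ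
  obtain ⟨x, rfl, rfl⟩ := exists_eq H
  exact ⟨x, rfl⟩

/-- The parameters determine the pair they describe, and the topology on `Param` is induced from
them alone. The pair may thus be dropped, which makes `G_K` a quotient of a subspace of adeles and
ideles. -/
theorem isOpen_iff {U : Set (GK K)} : IsOpen U ↔ IsOpen (toGK ⁻¹' U) := by
  have h1 : IsOpen U ↔ IsOpen ((Quot.mk _ : Rel K → GK K) ⁻¹' U) := isOpen_coinduced
  rw [h1, isOpen_coinduced, isOpen_induced_iff, isOpen_induced_iff]
  refine exists_congr fun O => and_congr_right fun _ => ?_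
  rw [Set.ext_iff, Set.ext_iff]
  constructor
  · intro h x
    exact h ⟨(x.1, ⟨(x.fst, x.snd), x.commens⟩), x.2.1, x.2.2, x.represents_fst, x.represents_snd⟩
  · rintro h ⟨⟨p, ⟨⟨L, L'⟩, H⟩⟩, h1, h2, h3, h4⟩
    have := h ⟨p, h1, h2⟩
    have e := toGK_eq (x := ⟨p, h1, h2⟩) h3 h4 H
    rw [Set.mem_preimage (f := toGK), e] at this
    exact this

theorem isQuotientMap_toGK : IsQuotientMap (toGK : PairParam K → GK K) :=
  (isQuotientMap_iff _).2 ⟨isCoinducing_iff.2 fun _ => isOpen_iff.symm, toGK_surjective⟩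

/-- The subgroups `Ô^*` and `Ô` are open, so the conditions on `s`, `g` and `ρ` cut out a
neighborhood of `x`. The modulus `t x` for `ρ` may depend on the base point. -/
theorem isLocallyConstant {α : Type*} (t : PairParam K → (Af K)ˣ) {F : GK K → α}
    (h : ∀ x y : PairParam K, x.1.2.1⁻¹ * y.1.2.1 ∈ OhatUnits K →
      x.1.2.2.2⁻¹ * y.1.2.2.2 ∈ OhatUnits K → (((t x)⁻¹ : (Af K)ˣ) : Af K) * (y.1.1 - x.1.1) ∈ Ohat K →
      F y.toGK = F x.toGK) : IsLocallyConstant F := by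
  rw [IsLocallyConstant.iff_isOpen_fiber]
  intro a
  rw [isOpen_iff, isOpen_iff_mem_nhds]
  intro x hx
  have ho : IsOpen {y : PairParam K | x.1.2.1⁻¹ * y.1.2.1 ∈ OhatUnits K ∧
      x.1.2.2.2⁻¹ * y.1.2.2.2 ∈ OhatUnits K ∧
      (((t x)⁻¹ : (Af K)ˣ) : Af K) * (y.1.1 - x.1.1) ∈ Ohat K} := by
    refine (isOpen_OhatUnits.preimage (f := fun y : PairParam K => x.1.2.1⁻¹ * y.1.2.1)
      (by fun_prop)).inter ((isOpen_OhatUnits.preimage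
        (f := fun y : PairParam K => x.1.2.2.2⁻¹ * y.1.2.2.2) (by fun_prop)).inter
      (isOpen_Ohat.preimage
        (f := fun y : PairParam K => (((t x)⁻¹ : (Af K)ˣ) : Af K) * (y.1.1 - x.1.1)) (by fun_prop)))
  refine Filter.mem_of_superset (ho.mem_nhds ⟨?_, ?_, ?_⟩) ?_
  · rw [inv_mul_cancel]; exact one_mem _
  · rw [inv_mul_cancel]; exact one_mem _
  · rw [sub_self, mul_zero]; exact zero_mem _
  · rintro y ⟨h1, h2, h3⟩
    have hx' : F x.toGK = a := hx
    change F y.toGK = a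
    rw [h x y h1 h2 h3, hx']

end PairParam

end Topology

theorem _root_.IsLocallyConstant.finite_image {X Y : Type*} [TopologicalSpace X] {f : X → Y}
    (hf : IsLocallyConstant f) {s : Set X} (hs : IsCompact s) : (f '' s).Finite := by
  let _ : TopologicalSpace Y := ⊥
  have : DiscreteTopology Y := ⟨rfl⟩
  exact (hs.image hf.continuous).finite_of_discrete

/-! ### The locally constant index with values in `𝔸_{K,f}^* / Ô^*`. -/

section Index

variable {K : Type*} [Field K] [NumberField K] [Algebra K ℂ]

variable (K) in
/-- The group `𝔸_{K,f}^* / Ô^*`. -/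
def IdeleCls : Type _ := (Af K)ˣ ⧸ OhatUnits K

noncomputable instance : CommGroup (IdeleCls K) :=
  inferInstanceAs (CommGroup ((Af K)ˣ ⧸ OhatUnits K))

/-- The class of `s ∈ 𝔸_{K,f}^*` modulo `Ô^*`. -/
noncomputable def cls : (Af K)ˣ →* IdeleCls K := QuotientGroup.mk' _

theorem cls_eq_iff {s s' : (Af K)ˣ} : cls s = cls s' ↔ s⁻¹ * s' ∈ OhatUnits K := QuotientGroup.eq

theorem cls_eq_iff_ball {s s' : (Af K)ˣ} : cls s = cls s' ↔ ball s = ball s' := by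
  rw [cls_eq_iff, eq_comm, ball_eq_iff, ← inv_mem_iff (H := OhatUnits K), mul_inv_rev, inv_inv]

/-- Changing the generator of the line multiplies `s` and `s'` by the same principal idele, which
cancels in the quotient. -/
theorem cls_div_eq {ρ ρ' σ σ' : Af K} {s s' t t' : (Af K)ˣ} {c d : ℂˣ} {L L' : KLattice K}
    (h : Represents ρ s c L) (h' : Represents ρ' s' c L') (k : Represents σ t d L)
    (k' : Represents σ' t' d L') : cls s / cls s' = cls t / cls t' := by
  obtain ⟨x, rfl⟩ := exists_embUnits_mul (K := K) (c := d) (c' := c) (by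
    rw [← h.kspan, k.kspan]
    exact Submodule.mem_span_singleton_self _)
  have e1 : cls (idele x * s) = cls t :=
    cls_eq_iff_ball.2 (((h.idele_mul x).ball_eq k).1 rfl)
  have e2 : cls (idele x * s') = cls t' :=
    cls_eq_iff_ball.2 (((h'.idele_mul x).ball_eq k').1 rfl)
  rw [← e1, ← e2, map_mul, map_mul, mul_div_mul_left_eq_div]

open Classical in
/-- The class of `s s'⁻¹` modulo `Ô^*`, where `L` and `L'` are represented by `(ρ, s)` and
`(ρ', s')` with the same component at infinity. -/
noncomputable def idx (L L' : KLattice K) : IdeleCls K :=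
  if h : ∃ q, ∀ (ρ ρ' : Af K) (s s' : (Af K)ˣ) (c : ℂˣ), Represents ρ s c L →
    Represents ρ' s' c L' → q = cls s / cls s' then h.choose else 1

theorem Represents.idx_eq {ρ ρ' : Af K} {s s' : (Af K)ˣ} {c : ℂˣ} {L L' : KLattice K}
    (h : Represents ρ s c L) (h' : Represents ρ' s' c L') : idx L L' = cls s / cls s' := by
  have H : ∃ q, ∀ (ρ ρ' : Af K) (s s' : (Af K)ˣ) (c : ℂˣ), Represents ρ s c L →
    Represents ρ' s' c L' → q = cls s / cls s' := ⟨_, fun _ _ _ _ _ k k' => cls_div_eq h h' k k'⟩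
  rw [idx, dif_pos H]
  exact H.choose_spec _ _ _ _ _ h h'

theorem idx_scaleL (l : ℂˣ) {L L' : KLattice K} (H : Commens L L') :
    idx (scaleL l L) (scaleL l L') = idx L L' := by
  obtain ⟨ρ, s, c, h⟩ := exists_rep L
  obtain ⟨ρ', s', h', e⟩ := H.exists_represents h
  rw [h.idx_eq h', (h.scaleL l).idx_eq (h'.scaleL l)]

theorem idx_symm {L L' : KLattice K} (H : Commens L L') : idx L' L = (idx L L')⁻¹ := by
  obtain ⟨ρ, s, c, h⟩ := exists_rep L
  obtain ⟨ρ', s', h', e⟩ := H.exists_represents h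
  rw [h.idx_eq h', h'.idx_eq h, inv_div]

/-- In a commensurability class `s ρ` is fixed, so the class of `s` modulo `Ô^*` determines the
lattice. Together with `eq_of_idx_eq'`, this makes each fiber of `idx` the graph of a partial
bijection. -/
theorem eq_of_idx_eq {L L' M : KLattice K} (H : Commens L M) (H' : Commens L' M)
    (e : idx L M = idx L' M) : L = L' := by
  obtain ⟨ρ, s, c, h⟩ := exists_rep M
  obtain ⟨ρ₁, s₁, h₁, e₁⟩ := H.symm.exists_represents h
  obtain ⟨ρ₂, s₂, h₂, e₂⟩ := H'.symm.exists_represents h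
  rw [h₁.idx_eq h, h₂.idx_eq h, div_left_inj] at e
  exact (h₁.eq_iff h₂).2 ⟨cls_eq_iff_ball.1 e, e₁.symm.trans e₂⟩

theorem eq_of_idx_eq' {L L' M : KLattice K} (H : Commens M L) (H' : Commens M L')
    (e : idx M L = idx M L') : L = L' := by
  refine eq_of_idx_eq H.symm H'.symm ?_
  rw [idx_symm H, idx_symm H', e]

theorem idx_self (L : KLattice K) : idx L L = 1 := by
  obtain ⟨ρ, s, c, h⟩ := exists_rep L
  rw [h.idx_eq h, div_self']

theorem idx_enlarge (a : (𝓞 K)⁰) (L : KLattice K) :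
    idx (enlarge a L) L = (cls (idele (fieldUnit a)))⁻¹ := by
  obtain ⟨ρ, s, c, h⟩ := exists_rep L
  rw [(h.enlarge a).idx_eq h, map_mul, map_inv, mul_div_cancel_right]

/-- The class `idx` as a function on `G_K`. -/
noncomputable def idxGK : GK K → IdeleCls K :=
  liftGK idx fun l _ _ H => idx_scaleL l H

theorem idxGK_toGK (x : PairParam K) : idxGK x.toGK = cls x.1.2.2.2 := by
  change idx x.fst x.snd = _
  rw [x.represents_fst.idx_eq x.represents_snd, map_mul, map_inv]
  simp

theorem isLocallyConstant_idxGK : IsLocallyConstant (idxGK : GK K → _) := by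
  refine PairParam.isLocallyConstant (fun _ => 1) fun x y _ h _ => ?_
  rw [idxGK_toGK, idxGK_toGK]
  exact (cls_eq_iff.2 h).symm

/-- Normalization of parameters: `K^*` and scaling bring `s` into `F` up to `Ô^*` and `c` to `1`;
the remaining unit is absorbed in `ρ`, and `g'` may be replaced by `g` because only its class counts
once the adele is kept. -/
theorem exists_toGK_eq {F : Finset (Af K)ˣ} (hF : ∀ s : (Af K)ˣ, ∃ t ∈ F, ∃ k : Kˣ,
    ∃ u ∈ OhatUnits K, s = idele k * t * u) {ρ : Af K} {s g g' : (Af K)ˣ} {c : ℂˣ}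
    {L L' : KLattice K} (hL : Represents ρ s c L)
    (hL' : Represents ((g' : Af K) * ρ) (g'⁻¹ * s) c L') (H : Commens L L') (hg : cls g' = cls g) :
    ∃ t ∈ F, ∃ (ρ' : Af K) (h : ρ' ∈ Ohat K ∧ (g : Af K) * ρ' ∈ Ohat K),
      PairParam.toGK ⟨(ρ', t, 1, g), h⟩ = gk H := by
  obtain ⟨t, ht, k, u, hu, rfl⟩ := hF s
  have hu1 : cls u = 1 := (QuotientGroup.eq_one_iff u).2 hu
  -- Scaling by `l` replaces `c` by `l⁻¹ c`, so `l` is taken to be the current component at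
  -- infinity.
  have hc1 : (embUnits k⁻¹ * c)⁻¹ * (embUnits k⁻¹ * c) = 1 := inv_mul_cancel _
  have hM := (hL.idele_mul k⁻¹).scaleL (embUnits k⁻¹ * c)
  have hM' := (hL'.idele_mul k⁻¹).scaleL (embUnits k⁻¹ * c)
  rw [hc1] at hM hM'
  have e₀ : (idele k⁻¹ * (idele k * t * u) : (Af K)ˣ) = t * u := by
    rw [map_inv, mul_assoc, inv_mul_cancel_left]
  have e : (idele k⁻¹ * (g'⁻¹ * (idele k * t * u)) : (Af K)ˣ) = g'⁻¹ * (t * u) := by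
    rw [mul_left_comm, e₀]
  rw [e₀] at hM
  rw [e] at hM'
  have hN := hM.congr (s' := t) (ρ' := (u : Af K) * ρ)
    (cls_eq_iff_ball.1 (by rw [map_mul, hu1, mul_one])) (by rw [Units.val_mul, mul_assoc])
  have hN' := hM'.congr (s' := g⁻¹ * t) (ρ' := (g : Af K) * ((u : Af K) * ρ))
    (cls_eq_iff_ball.1 (by rw [map_mul, map_mul, map_mul, map_inv, map_inv, hu1, mul_one, hg])) (by
      simp only [Units.val_mul]
      linear_combination ((t : Af K) * u * ρ) * (g'.inv_mul) - ((t : Af K) * u * ρ) * (g.inv_mul))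
  refine ⟨t, ht, (u : Af K) * ρ, ⟨hN.mem_Ohat, hN'.mem_Ohat⟩, ?_⟩
  exact (PairParam.toGK_eq (x := ⟨((u : Af K) * ρ, t, 1, g), hN.mem_Ohat, hN'.mem_Ohat⟩)
    hN hN' (H.scaleL _)).trans (gk_scaleL _ _)

/-- After normalization only `ρ` varies, in the compact set of `ρ ∈ Ô` with `g ρ ∈ Ô`, while `s`
runs through finitely many representatives. The fiber is closed in this compact union. -/
theorem isCompact_idxGK_fiber (q : IdeleCls K) :
    IsCompact {γ : GK K | idxGK γ = q} := by
  obtain ⟨g, rfl⟩ : ∃ g, cls g = q := QuotientGroup.mk'_surjective _ q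
  obtain ⟨F, hF⟩ := exists_finset_idele_classes K
  let Y : Set (Af K) := {ρ | ρ ∈ Ohat K ∧ (g : Af K) * ρ ∈ Ohat K}
  have hY : IsCompact Y := isCompact_Ohat.inter_right (isClosed_Ohat.preimage (continuous_const_mul _))
  have := isCompact_iff_compactSpace.1 hY
  let j : (Af K)ˣ → Y → GK K := fun t ρ => PairParam.toGK ⟨(ρ.1, t, 1, g), ρ.2⟩
  have hj : ∀ t, Continuous (j t) := fun t =>
    PairParam.isQuotientMap_toGK.continuous.comp (by fun_prop)
  have hc : IsCompact (⋃ t ∈ F, Set.range (j t)) :=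
    F.isCompact_biUnion fun t _ => isCompact_range (hj t)
  refine hc.of_isClosed_subset (isLocallyConstant_idxGK.isClosed_fiber _) ?_
  intro γ hγ
  obtain ⟨x, rfl⟩ := PairParam.toGK_surjective γ
  obtain ⟨t, ht, ρ', h, e⟩ := exists_toGK_eq hF x.represents_fst x.represents_snd x.commens
    ((idxGK_toGK x).symm.trans hγ)
  simp only [Set.mem_iUnion]
  exact ⟨t, ht, ⟨ρ', h⟩, e⟩

theorem finite_idxGK (f : C_c(GK K, ℂ)) : (idxGK '' tsupport f).Finite :=
  isLocallyConstant_idxGK.finite_image f.hasCompactSupport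

/-- A locally constant function on `G_K` which is supported in a fiber of `idxGK`. -/
noncomputable def ccOfIdx (q : IdeleCls K) (F : GK K → ℂ) (hF : IsLocallyConstant F)
    (h : ∀ γ, F γ ≠ 0 → idxGK γ = q) : C_c(GK K, ℂ) where
  toFun := F
  continuous_toFun := hF.continuous
  hasCompactSupport' := by
    refine (isCompact_idxGK_fiber q).of_isClosed_subset (isClosed_tsupport F) ?_
    exact closure_minimal (fun γ hγ => h γ hγ) (isLocallyConstant_idxGK.isClosed_fiber q)

/-- The product of a locally constant function and a function in `C_c(G_K)`. -/
noncomputable def ccMul (F : GK K → ℂ) (hF : IsLocallyConstant F) (f : C_c(GK K, ℂ)) :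
    C_c(GK K, ℂ) where
  toFun := fun γ => F γ * f γ
  continuous_toFun := hF.continuous.mul f.continuous
  hasCompactSupport' := f.hasCompactSupport.mul_left

theorem ev_of_commens (f : C_c(GK K, ℂ)) {L L' : KLattice K} (H : Commens L L') :
    ev f L L' = f (gk H) := dif_pos H

theorem ev_of_not_commens (f : C_c(GK K, ℂ)) {L L' : KLattice K} (H : ¬ Commens L L') :
    ev f L L' = 0 := dif_neg H

theorem ev_scaleL (f : C_c(GK K, ℂ)) (l : ℂˣ) (L L' : KLattice K) :
    ev f (scaleL l L) (scaleL l L') = ev f L L' := by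
  by_cases H : Commens L L'
  · rw [ev_of_commens f H, ev_of_commens f (H.scaleL l), gk_scaleL]
  · rw [ev_of_not_commens f H, ev_of_not_commens f (mt (commens_scaleL_iff l).1 H)]

theorem exists_ev_le (f : C_c(GK K, ℂ)) : ∃ C : ℝ, 0 ≤ C ∧ ∀ L L', ‖ev f L L'‖ ≤ C := by
  obtain ⟨C, hC⟩ := f.continuous.bounded_above_of_compact_support f.hasCompactSupport
  refine ⟨max C 0, le_max_right _ _, fun L L' => ?_⟩
  by_cases H : Commens L L'
  · rw [ev_of_commens f H]
    exact (hC _).trans (le_max_left _ _)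
  · rw [ev_of_not_commens f H, norm_zero]
    exact le_max_right _ _

theorem exists_finset_idx (f : C_c(GK K, ℂ)) : ∃ S : Finset (IdeleCls K),
    ∀ L L', ev f L L' ≠ 0 → Commens L L' ∧ idx L L' ∈ S := by
  refine ⟨(finite_idxGK f).toFinset, fun L L' h => ?_⟩
  by_cases H : Commens L L'
  · rw [ev_of_commens f H] at h
    exact ⟨H, (finite_idxGK f).mem_toFinset.2 ⟨gk H, subset_tsupport f h, rfl⟩⟩
  · exact absurd (ev_of_not_commens f H) h

end Index

/-! ### Local constancy of divisibility. -/

section Divisibility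

variable {K : Type*} [Field K] [NumberField K] [Algebra K ℂ]

/-- The criterion `t⁻¹ ρ ∈ Ô` depends only on `ρ` modulo `t Ô`. -/
theorem isLocallyConstant_divisible (t : Sgp K) : IsLocallyConstant
    (liftGK (fun L _ : KLattice K => Divisible (idealOf t) L)
      fun _ _ _ _ => propext divisible_scaleL_iff) := by
  refine PairParam.isLocallyConstant (fun _ => (t : (Af K)ˣ)) fun x y _ _ h => ?_
  change Divisible _ y.fst = Divisible _ x.fst
  rw [y.represents_fst.divisible_iff, x.represents_fst.divisible_iff]
  rw [mul_sub] at h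
  exact propext ⟨fun h' => by simpa using sub_mem h' h, fun h' => by simpa using add_mem h h'⟩

/-- For the second lattice the criterion is `t⁻¹ g ρ ∈ Ô`, which depends on `ρ` modulo `t g⁻¹ Ô` and
on `g` modulo `Ô^*`; hence the modulus varies with the base point. -/
theorem isLocallyConstant_divisible' (t : Sgp K) : IsLocallyConstant
    (liftGK (fun _ L' : KLattice K => Divisible (idealOf t) L')
      fun _ _ _ _ => propext divisible_scaleL_iff) := by
  refine PairParam.isLocallyConstant (fun x => (t : (Af K)ˣ) * x.1.2.2.2⁻¹) fun x y _ hg h => ?_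
  change Divisible _ y.snd = Divisible _ x.snd
  rw [y.represents_snd.divisible_iff, x.represents_snd.divisible_iff]
  obtain ⟨w, hw, e⟩ : ∃ w ∈ OhatUnits K, y.1.2.2.2 = x.1.2.2.2 * w :=
    ⟨_, hg, (mul_inv_cancel_left _ _).symm⟩
  rw [mul_inv, inv_inv, mul_sub, Units.val_mul, mul_assoc, mul_assoc] at h
  have h1 : (((t : (Af K)ˣ)⁻¹ : (Af K)ˣ) : Af K) * ((y.1.2.2.2 : Af K) * y.1.1) =
      w * ((((t : (Af K)ˣ)⁻¹ : (Af K)ˣ) : Af K) * ((x.1.2.2.2 : Af K) * y.1.1)) := by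
    rw [e, Units.val_mul]
    ring
  have h2 : ∀ z : Af K, (w : Af K) * z ∈ Ohat K ↔ z ∈ Ohat K := fun z =>
    ⟨fun hz => by simpa using (Ohat K).mul_mem (mem_OhatUnits.1 hw).2 hz,
      fun hz => (Ohat K).mul_mem (mem_OhatUnits.1 hw).1 hz⟩
  rw [h1, h2]
  exact propext ⟨fun h' => by simpa using sub_mem h' h, fun h' => by simpa using add_mem h h'⟩

end Divisibility

/-! ### Extension by zero of compactly supported functions. -/

section Extension

/-- Extension by zero of a function in `C_c(X)` along an open embedding with closed range. -/
noncomputable def ccExtend {X Y : Type*} [TopologicalSpace X] [TopologicalSpace Y] {m : X → Y}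
    (hm : IsOpenEmbedding m) (hc : IsClosed (Set.range m)) (f : C_c(X, ℂ)) : C_c(Y, ℂ) where
  toFun := Function.extend m f 0
  continuous_toFun := by
    rw [continuous_iff_continuousAt]
    intro y
    by_cases hy : y ∈ Set.range m
    · obtain ⟨x, rfl⟩ := hy
      rw [← hm.continuousAt_iff, Function.extend_comp hm.injective]
      exact f.continuous.continuousAt
    -- Closedness of the range makes the extension vanish near every point outside it.
    · have h0 : Function.extend m f 0 =ᶠ[𝓝 y] fun _ => 0 := by
        filter_upwards [hc.isOpen_compl.mem_nhds hy] with z hz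
        exact Function.extend_apply' _ _ _ hz
      exact continuousAt_const.congr h0.symm
  hasCompactSupport' := by
    have hcl : IsClosedEmbedding m := ⟨hm.isEmbedding, hc⟩
    refine (f.hasCompactSupport.image hm.continuous).of_isClosed_subset (isClosed_tsupport _) ?_
    refine closure_minimal ?_ (hcl.isClosedMap _ (isClosed_tsupport _))
    intro y hy
    by_cases h : ∃ x, m x = y
    · obtain ⟨x, rfl⟩ := h
      rw [Function.mem_support, hm.injective.extend_apply] at hy
      exact ⟨x, subset_tsupport _ hy, rfl⟩
    · exact absurd (Function.extend_apply' _ _ _ h) hy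

end Extension

/-! ### The open embedding of `G_K` given by `t`, and `θ_t` on functions. -/

section Endomorphism

variable {K : Type*} [Field K] [NumberField K] [Algebra K ℂ]

/-- The action of `t` on the parameters of pairs of lattices. -/
noncomputable def mulParam (t : Sgp K) (x : PairParam K) : PairParam K :=
  ⟨((t : (Af K)ˣ) * x.1.1, x.1.2), (Ohat K).mul_mem t.2 x.2.1, by
    have := (Ohat K).mul_mem t.2 x.2.2
    rwa [mul_left_comm] at this⟩

/-- The map `(L, L') ↦ (t L, t L')` on `G_K`, where `t (Λ, φ) = (Λ, t φ)`. -/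
noncomputable def mulGK (t : Sgp K) : GK K → GK K :=
  Quot.lift (fun γ => gk ((commens_mulL_iff t).2 γ.2)) (by
    rintro ⟨⟨L, L'⟩, h⟩ ⟨⟨M, M'⟩, h'⟩ ⟨l, h1, h2⟩
    rw [isScaled_iff] at h1 h2
    simp only at h1 h2
    subst h1 h2
    exact gk_eq_iff.2 ⟨l, mulL_scaleL t l L, mulL_scaleL t l L'⟩)

theorem mulGK_gk (t : Sgp K) {L L' : KLattice K} (h : Commens L L') :
    mulGK t (gk h) = gk ((commens_mulL_iff t).2 h) := rfl

theorem mulGK_toGK (t : Sgp K) (x : PairParam K) : mulGK t x.toGK = (mulParam t x).toGK := by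
  refine (PairParam.toGK_eq (x.represents_fst.mulL t) ?_ _).symm
  have := x.represents_snd.mulL t
  rwa [mul_left_comm] at this

theorem mulGK_injective (t : Sgp K) : Function.Injective (mulGK t) := by
  intro γ γ' h
  obtain ⟨L, L', H, rfl⟩ := exists_gk γ
  obtain ⟨M, M', H', rfl⟩ := exists_gk γ'
  rw [mulGK_gk, mulGK_gk, gk_eq_iff] at h
  obtain ⟨l, h1, h2⟩ := h
  rw [← mulL_scaleL] at h1 h2
  exact gk_eq_iff.2 ⟨l, mulL_injective t h1, mulL_injective t h2⟩

theorem continuous_mulGK (t : Sgp K) : Continuous (mulGK t) := by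
  rw [PairParam.isQuotientMap_toGK.continuous_iff]
  have : mulGK t ∘ PairParam.toGK = PairParam.toGK ∘ mulParam t := funext (mulGK_toGK t)
  rw [this]
  refine PairParam.isQuotientMap_toGK.continuous.comp ?_
  unfold mulParam
  fun_prop

theorem mem_range_mulGK_iff {t : Sgp K} {L L' : KLattice K} {H : Commens L L'} :
    gk H ∈ Set.range (mulGK t) ↔ Divisible (idealOf t) L ∧ Divisible (idealOf t) L' := by
  constructor
  · rintro ⟨γ, h⟩
    obtain ⟨M, M', H', rfl⟩ := exists_gk γ
    rw [mulGK_gk, gk_eq_iff] at h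
    obtain ⟨l, rfl, rfl⟩ := h
    exact ⟨divisible_scaleL_iff.2 (divisible_iff.2 ⟨_, rfl⟩),
      divisible_scaleL_iff.2 (divisible_iff.2 ⟨_, rfl⟩)⟩
  · rintro ⟨h1, h2⟩
    obtain ⟨M, rfl⟩ := divisible_iff.1 h1
    obtain ⟨M', rfl⟩ := divisible_iff.1 h2
    exact ⟨gk ((commens_mulL_iff t).1 H), rfl⟩

theorem exists_mulParam_eq {t : Sgp K} {y : PairParam K}
    (h : (((t : (Af K)ˣ)⁻¹ : (Af K)ˣ) : Af K) * y.1.1 ∈ Ohat K)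
    (h' : (((t : (Af K)ˣ)⁻¹ : (Af K)ˣ) : Af K) * ((y.1.2.2.2 : Af K) * y.1.1) ∈ Ohat K) :
    mulParam t ⟨((((t : (Af K)ˣ)⁻¹ : (Af K)ˣ) : Af K) * y.1.1, y.1.2), h, by
      rwa [mul_left_comm] at h'⟩ = y := by
  apply Subtype.ext
  refine Prod.ext ?_ rfl
  exact Units.mul_inv_cancel_left _ _

/-- Division of `ρ` by `t` is a continuous map into the ambient space, and the image is the locus
where the quotient is again an admissible parameter; this locus is open because `Ô` is. -/
theorem isOpenMap_mulParam (t : Sgp K) : IsOpenMap (mulParam t) := by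
  rintro U ⟨O, hO, rfl⟩
  let n : PairParam K → Af K × (Af K)ˣ × ℂˣ × (Af K)ˣ := fun y =>
    ((((t : (Af K)ˣ)⁻¹ : (Af K)ˣ) : Af K) * y.1.1, y.1.2)
  have e : mulParam t '' (Subtype.val ⁻¹' O) = (fun y => (n y).1) ⁻¹' (Ohat K : Set (Af K)) ∩
      ((fun y : PairParam K => (((t : (Af K)ˣ)⁻¹ : (Af K)ˣ) : Af K) * ((y.1.2.2.2 : Af K) * y.1.1)) ⁻¹'
        (Ohat K : Set (Af K)) ∩ n ⁻¹' O) := by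
    ext y
    constructor
    · rintro ⟨x, hx, rfl⟩
      have e1 : n (mulParam t x) = x.1 := Prod.ext (Units.inv_mul_cancel_left _ _) rfl
      refine ⟨?_, ?_, ?_⟩
      · change (n (mulParam t x)).1 ∈ Ohat K
        rw [e1]
        exact x.2.1
      · change (((t : (Af K)ˣ)⁻¹ : (Af K)ˣ) : Af K) *
          ((x.1.2.2.2 : Af K) * ((t : (Af K)ˣ) * x.1.1)) ∈ Ohat K
        rw [mul_left_comm (x.1.2.2.2 : Af K), Units.inv_mul_cancel_left]
        exact x.2.2
      · change n (mulParam t x) ∈ O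
        rw [e1]
        exact hx
    · rintro ⟨h1, h2, h3⟩
      exact ⟨_, h3, exists_mulParam_eq h1 h2⟩
  rw [e]
  have hn : Continuous n := by fun_prop
  exact (isOpen_Ohat.preimage (by fun_prop)).inter
    ((isOpen_Ohat.preimage (by fun_prop)).inter (hO.preimage hn))

/-- A parameter of a pair in the range is itself divisible by `t`, whichever parameter is chosen.
Taking images therefore commutes with pulling back to parameters. -/
theorem isOpenMap_mulGK (t : Sgp K) : IsOpenMap (mulGK t) := by
  intro U hU
  rw [PairParam.isOpen_iff] at hU ⊢
  have e : PairParam.toGK ⁻¹' (mulGK t '' U) = mulParam t '' (PairParam.toGK ⁻¹' U) := by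
    ext y
    constructor
    · rintro ⟨γ, hγ, h⟩
      have h1 : gk y.commens ∈ Set.range (mulGK t) := ⟨γ, h⟩
      rw [mem_range_mulGK_iff, y.represents_fst.divisible_iff, y.represents_snd.divisible_iff] at h1
      have e1 := exists_mulParam_eq h1.1 h1.2
      refine ⟨_, ?_, e1⟩
      rw [← e1, ← mulGK_toGK] at h
      rw [Set.mem_preimage, ← mulGK_injective t h]
      exact hγ
    · rintro ⟨x, hx, rfl⟩
      exact ⟨_, hx, mulGK_toGK t x⟩
  rw [e]
  exact isOpenMap_mulParam t _ hU

theorem isOpenEmbedding_mulGK (t : Sgp K) : IsOpenEmbedding (mulGK t) :=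
  .of_continuous_injective_isOpenMap (continuous_mulGK t) (mulGK_injective t) (isOpenMap_mulGK t)

theorem isClosed_range_mulGK (t : Sgp K) : IsClosed (Set.range (mulGK t)) := by
  have e : Set.range (mulGK t) = {γ | liftGK (fun L _ : KLattice K => Divisible (idealOf t) L)
      (fun _ _ _ _ => propext divisible_scaleL_iff) γ = True} ∩
    {γ | liftGK (fun _ L' : KLattice K => Divisible (idealOf t) L')
      (fun _ _ _ _ => propext divisible_scaleL_iff) γ = True} := by
    ext γ
    obtain ⟨L, L', H, rfl⟩ := exists_gk γ
    rw [mem_range_mulGK_iff]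
    exact and_congr ⟨fun h => eq_true h, fun h => of_eq_true h⟩
      ⟨fun h => eq_true h, fun h => of_eq_true h⟩
  rw [e]
  exact ((isLocallyConstant_divisible t).isClosed_fiber _).inter
    ((isLocallyConstant_divisible' t).isClosed_fiber _)

/-- The function `θ_t(f)`. -/
noncomputable def thetaCc (t : Sgp K) (f : C_c(GK K, ℂ)) : C_c(GK K, ℂ) :=
  ccExtend (isOpenEmbedding_mulGK t) (isClosed_range_mulGK t) f

theorem ev_thetaCc_mulL (t : Sgp K) (f : C_c(GK K, ℂ)) (M M' : KLattice K) :
    ev (thetaCc t f) (mulL t M) (mulL t M') = ev f M M' := by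
  by_cases H : Commens M M'
  · rw [ev_of_commens f H, ev_of_commens _ ((commens_mulL_iff t).2 H), ← mulGK_gk]
    exact (mulGK_injective t).extend_apply _ _ _
  · rw [ev_of_not_commens f H, ev_of_not_commens _ (mt (commens_mulL_iff t).1 H)]

theorem ev_thetaCc_of_not (t : Sgp K) (f : C_c(GK K, ℂ)) {L L' : KLattice K}
    (h : ¬ (Divisible (idealOf t) L ∧ Divisible (idealOf t) L')) : ev (thetaCc t f) L L' = 0 := by
  by_cases H : Commens L L'
  · rw [ev_of_commens _ H]
    exact Function.extend_apply' _ _ _ (mt (mem_range_mulGK_iff (H := H)).1 h)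
  · exact ev_of_not_commens _ H

theorem isTheta_thetaCc (t : Sgp K) (f : C_c(GK K, ℂ)) : IsTheta t f (thetaCc t f) := by
  refine fun L L' _ => ⟨?_, ev_thetaCc_of_not t f⟩
  rintro ⟨h1, h2⟩
  obtain ⟨M, rfl⟩ := divisible_iff.1 h1
  obtain ⟨M', rfl⟩ := divisible_iff.1 h2
  exact ⟨M, M', isQuot_iff.2 rfl, isQuot_iff.2 rfl, ev_thetaCc_mulL t f M M'⟩

end Endomorphism

/-! ### The functions `e_J`, `μ_a`, `σ_t(f)` and the covolume components. -/

section SpecialFunctions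

variable {K : Type*} [Field K] [NumberField K] [Algebra K ℂ]

open Classical in
/-- The characteristic function of the set of pairs `(L, L)` with `L` divisible by the ideal
attached to `t`. -/
noncomputable def projCc (t : Sgp K) : C_c(GK K, ℂ) :=
  ccOfIdx 1 (fun γ => if idxGK γ = 1 ∧ liftGK (fun L _ : KLattice K => Divisible (idealOf t) L)
      (fun _ _ _ _ => propext divisible_scaleL_iff) γ then 1 else 0)
    (isLocallyConstant_idxGK.comp₂ (isLocallyConstant_divisible t)
      fun q d => if q = 1 ∧ d then (1 : ℂ) else 0)
    (fun γ h => by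
      by_contra h1
      exact h (if_neg fun h2 => h1 h2.1))

-- A commensurable pair has index `1` only if its lattices coincide, so the units form a fiber of
-- the index.
open Classical in
theorem ev_projCc (t : Sgp K) (L L' : KLattice K) :
    ev (projCc t) L L' = if L = L' ∧ Divisible (idealOf t) L then 1 else 0 := by
  by_cases H : Commens L L'
  · rw [ev_of_commens _ H]
    refine if_congr (and_congr_left fun _ => ?_) rfl rfl
    change idx L L' = 1 ↔ L = L'
    rw [← idx_self L']
    exact ⟨fun h => eq_of_idx_eq H (Commens.refl L') h, fun h => by rw [h]⟩
  · rw [ev_of_not_commens _ H, if_neg]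
    rintro ⟨rfl, -⟩
    exact H (Commens.refl L)

theorem isProj_projCc (t : Sgp K) : IsProj (idealOf t) (projCc t) :=
  fun L L' _ => ev_projCc t L L'

open Classical in
/-- The function `μ_a`. -/
noncomputable def muCc (a : (𝓞 K)⁰) : C_c(GK K, ℂ) :=
  ccOfIdx (cls (idele (fieldUnit a)))⁻¹
    (fun γ => if idxGK γ = (cls (idele (fieldUnit a)))⁻¹ then 1 else 0)
    (isLocallyConstant_idxGK.comp fun q => if q = (cls (idele (fieldUnit a)))⁻¹ then (1 : ℂ) else 0)
    (fun γ h => by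
      by_contra h1
      exact h (if_neg h1))

open Classical in
theorem ev_muCc (a : (𝓞 K)⁰) (L L' : KLattice K) :
    ev (muCc a) L L' = if L = enlarge a L' then 1 else 0 := by
  by_cases H : Commens L L'
  · rw [ev_of_commens _ H]
    refine if_congr ?_ rfl rfl
    change idx L L' = _ ↔ _
    rw [← idx_enlarge a L']
    exact ⟨fun h => eq_of_idx_eq H (commens_enlarge a L') h, fun h => by rw [h]⟩
  · rw [ev_of_not_commens _ H, if_neg]
    rintro rfl
    exact H (commens_enlarge a L')

theorem isMu_muCc (a : (𝓞 K)⁰) : IsMu (a : 𝓞 K) (muCc a) := by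
  intro L L' H
  rw [ev_muCc]
  classical exact if_congr H.eq_enlarge_iff.symm rfl rfl

theorem Represents.covol_eq {ρ ρ' : Af K} {s s' : (Af K)ˣ} {c : ℂˣ} {L L' : KLattice K}
    (h : Represents ρ s c L) (h' : Represents ρ' s' c L') (e : cls s = cls s') :
    covol L = covol L' :=
  covol_eq_of_Λ_eq ((h.ball_eq h').2 (cls_eq_iff_ball.1 e))

variable (hdeg : Module.finrank ℚ K = 2) [NumberField.IsTotallyComplex K]

/-- The covolume ratio as a function on `G_K`. -/
noncomputable def covolGK : GK K → ℝ :=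
  liftGK covolRatio fun l L L' _ => covolRatio_scaleL hdeg l L L'

/-- With equal components at infinity, the two covolumes depend only on `s` and `g` modulo `Ô^*`. -/
theorem isLocallyConstant_covolGK : IsLocallyConstant (covolGK hdeg) := by
  refine PairParam.isLocallyConstant (fun _ => 1) fun x y hs hg _ => ?_
  change covolRatio y.fst y.snd = covolRatio x.fst x.snd
  rw [← cls_eq_iff] at hs hg
  -- Scaling `y` by this factor gives it the component at infinity of `x`, at no cost to the ratio.
  have hc : (y.1.2.2.1 * x.1.2.2.1⁻¹)⁻¹ * y.1.2.2.1 = x.1.2.2.1 := by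
    rw [mul_inv, inv_inv, mul_right_comm, inv_mul_cancel, one_mul]
  have h1 := y.represents_fst.scaleL (y.1.2.2.1 * x.1.2.2.1⁻¹)
  have h2 := y.represents_snd.scaleL (y.1.2.2.1 * x.1.2.2.1⁻¹)
  rw [hc] at h1 h2
  rw [← covolRatio_scaleL hdeg (y.1.2.2.1 * x.1.2.2.1⁻¹), covolRatio, covolRatio,
    h1.covol_eq x.represents_fst hs.symm, h2.covol_eq x.represents_snd (by
      rw [map_mul, map_mul, map_inv, map_inv, hs, hg])]

/-- The function `σ_t(f)`. -/
noncomputable def sigmaCc (t : ℝ) (f : C_c(GK K, ℂ)) : C_c(GK K, ℂ) :=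
  ccMul (fun γ => (covolGK hdeg γ : ℂ) ^ (Complex.I * (t : ℂ)))
    ((isLocallyConstant_covolGK hdeg).comp fun r : ℝ => (r : ℂ) ^ (Complex.I * (t : ℂ))) f

theorem ev_sigmaCc (t : ℝ) (f : C_c(GK K, ℂ)) (L L' : KLattice K) :
    ev (sigmaCc hdeg t f) L L' = (covolRatio L L' : ℂ) ^ (Complex.I * (t : ℂ)) * ev f L L' := by
  by_cases H : Commens L L'
  · rw [ev_of_commens _ H, ev_of_commens _ H]
    rfl
  · rw [ev_of_not_commens _ H, ev_of_not_commens _ H, mul_zero]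

open Classical in
/-- The part of `f` on which the covolume ratio is `r`. -/
noncomputable def covolPart (r : ℝ) (f : C_c(GK K, ℂ)) : C_c(GK K, ℂ) :=
  ccMul (fun γ => if covolGK hdeg γ = r then 1 else 0)
    ((isLocallyConstant_covolGK hdeg).comp fun x : ℝ => if x = r then (1 : ℂ) else 0) f

open Classical in
theorem ev_covolPart (r : ℝ) (f : C_c(GK K, ℂ)) (L L' : KLattice K) :
    ev (covolPart hdeg r f) L L' = (if covolRatio L L' = r then 1 else 0) * ev f L L' := by
  by_cases H : Commens L L'
  · rw [ev_of_commens _ H, ev_of_commens _ H]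
    rfl
  · rw [ev_of_not_commens _ H, ev_of_not_commens _ H, mul_zero]

theorem exists_finset_covolRatio (hdeg : Module.finrank ℚ K = 2) (f : C_c(GK K, ℂ)) : ∃ S : Finset ℝ,
    ∀ L L', ev f L L' ≠ 0 → covolRatio L L' ∈ S := by
  have hfin := (isLocallyConstant_covolGK hdeg).finite_image f.hasCompactSupport
  refine ⟨hfin.toFinset, fun L L' h => ?_⟩
  by_cases H : Commens L L'
  · rw [ev_of_commens f H] at h
    exact hfin.mem_toFinset.2 ⟨gk H, subset_tsupport f h, rfl⟩
  · exact absurd (ev_of_not_commens f H) h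

end SpecialFunctions

/-! ### Operators on `ℓ²`: matrix coefficients and conjugation by injections. -/

section SquareSummable

variable {ι κ : Type*}

/-- The Hilbert space `ℓ²(ι)`. -/
abbrev L2 (ι : Type*) : Type _ := lp (fun _ : ι => ℂ) 2

open Classical in
/-- The standard basis vector. -/
noncomputable def basisVec (i : ι) : L2 ι := lp.single 2 i (1 : ℂ)

open Classical in
theorem basisVec_apply (i j : ι) : basisVec i j = if j = i then 1 else 0 := by
  rw [basisVec, lp.single_apply, Pi.single_apply]

theorem basisVec_self (i : ι) : basisVec i i = 1 := by rw [basisVec_apply, if_pos rfl]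

theorem basisVec_ne {i j : ι} (h : j ≠ i) : basisVec i j = 0 := by rw [basisVec_apply, if_neg h]

theorem hasSum_basisVec (ξ : L2 ι) : HasSum (fun i => ξ i • basisVec i) ξ := by
  classical
  refine (lp.hasSum_single (by norm_num) ξ).congr_fun fun i => ?_
  have := lp.single_smul (E := fun _ : ι => ℂ) 2 i (ξ i) (1 : ℂ)
  rw [smul_eq_mul, mul_one] at this
  exact this.symm

theorem evalL2_hasSum {α : Type*} {f : α → L2 ι} {ξ : L2 ι} (h : HasSum f ξ) (i : ι) :
    HasSum (fun a => f a i) (ξ i) :=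
  (lp.evalCLM ℂ (fun _ : ι => ℂ) 2 i).hasSum h

/-- The matrix coefficients of an operator. -/
noncomputable def coef (T : L2 κ →L[ℂ] L2 ι) (i : ι) (k : κ) : ℂ := T (basisVec k) i

theorem hasSum_coef (T : L2 κ →L[ℂ] L2 ι) (ξ : L2 κ) (i : ι) :
    HasSum (fun k => coef T i k * ξ k) (T ξ i) := by
  refine (evalL2_hasSum (T.hasSum (hasSum_basisVec ξ)) i).congr_fun fun k => ?_
  rw [map_smul, lp.coeFn_smul, Pi.smul_apply, smul_eq_mul, mul_comm, coef]

/-- A bounded operator is determined by its values on basis vectors. Operator identities reduce to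
pointwise identities of functions on pairs of lattices. -/
theorem ext_coef {S T : L2 κ →L[ℂ] L2 ι} (h : ∀ i k, coef S i k = coef T i k) : S = T := by
  ext ξ i
  refine (hasSum_coef S ξ i).unique ?_
  simp only [h]
  exact hasSum_coef T ξ i

theorem coef_eq_of_hasSum {T : L2 κ →L[ℂ] L2 ι} {c : ι → κ → ℂ}
    (h : ∀ ξ i, HasSum (fun k => c i k * ξ k) (T ξ i)) (i : ι) (k : κ) : coef T i k = c i k := by
  classical
  refine (h (basisVec k) i).unique ?_
  convert hasSum_ite_eq k (c i k) using 2 with k'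
  rw [basisVec_apply]
  split_ifs with e
  · rw [e, mul_one]
  · rw [mul_zero]

theorem inner_basisVec (i : ι) (ξ : L2 ι) : inner ℂ (basisVec i) ξ = ξ i := by
  classical
  rw [basisVec, lp.inner_single_left]
  simp

theorem adjoint_apply (T : L2 κ →L[ℂ] L2 ι) (ξ : L2 ι) (k : κ) :
    ContinuousLinearMap.adjoint T ξ k = inner ℂ (T (basisVec k)) ξ := by
  rw [← inner_basisVec k, ContinuousLinearMap.adjoint_inner_right]

/-- Injectivity of `p` on the support of `w` allows the sum to be reindexed as part of the sum for
`‖ξ‖²`. -/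
theorem sum_weightedComp_le {w : ι → ℂ} {p : ι → κ}
    (hp : ∀ i j, w i ≠ 0 → w j ≠ 0 → p i = p j → i = j) {C : ℝ} (hC : 0 ≤ C) (hw : ∀ i, ‖w i‖ ≤ C)
    (ξ : L2 κ) (s : Finset ι) :
    ∑ i ∈ s, ‖w i * ξ (p i)‖ ^ (2 : ℝ≥0∞).toReal ≤ (C * ‖ξ‖) ^ (2 : ℝ≥0∞).toReal := by
  classical
  have h2 : (2 : ℝ≥0∞).toReal = 2 := by norm_num
  calc ∑ i ∈ s, ‖w i * ξ (p i)‖ ^ (2 : ℝ≥0∞).toReal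
      = ∑ i ∈ s with w i ≠ 0, ‖w i * ξ (p i)‖ ^ (2 : ℝ≥0∞).toReal := by
        rw [Finset.sum_filter]
        refine Finset.sum_congr rfl fun i _ => ?_
        split_ifs with h
        · rfl
        · rw [not_not.1 h, zero_mul, norm_zero, h2, Real.zero_rpow two_ne_zero]
    _ ≤ ∑ i ∈ s with w i ≠ 0, C ^ (2 : ℝ≥0∞).toReal * ‖ξ (p i)‖ ^ (2 : ℝ≥0∞).toReal := by
        refine Finset.sum_le_sum fun i _ => ?_
        rw [← Real.mul_rpow hC (norm_nonneg _), norm_mul]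
        have := hw i
        gcongr
    _ = C ^ (2 : ℝ≥0∞).toReal *
          ∑ k ∈ (s.filter fun i => w i ≠ 0).image p, ‖ξ k‖ ^ (2 : ℝ≥0∞).toReal := by
        rw [Finset.sum_image, Finset.mul_sum]
        intro i hi j hj h
        exact hp i j (Finset.mem_filter.1 hi).2 (Finset.mem_filter.1 hj).2 h
    _ ≤ (C * ‖ξ‖) ^ (2 : ℝ≥0∞).toReal := by
        rw [Real.mul_rpow hC (norm_nonneg _)]
        exact mul_le_mul_of_nonneg_left (lp.sum_rpow_le_norm_rpow (by norm_num) ξ _) (by positivity)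

/-- The operator `(T ξ)(i) = w(i) ξ(p(i))`, where `w` is bounded and `p` is injective on the support
of `w`. -/
noncomputable def weightedComp (w : ι → ℂ) (p : ι → κ)
    (hp : ∀ i j, w i ≠ 0 → w j ≠ 0 → p i = p j → i = j) (C : ℝ) (hC : 0 ≤ C) (hw : ∀ i, ‖w i‖ ≤ C) :
    L2 κ →L[ℂ] L2 ι :=
  LinearMap.mkContinuous
    { toFun := fun ξ => ⟨fun i => w i * ξ (p i), memℓp_gen' (sum_weightedComp_le hp hC hw ξ)⟩
      map_add' := fun ξ η => by
        ext i
        exact mul_add _ _ _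
      map_smul' := fun a ξ => by
        ext i
        exact mul_left_comm _ _ _ }
    C fun ξ => lp.norm_le_of_forall_sum_le (by norm_num) (by positivity) (sum_weightedComp_le hp hC hw ξ)

section

variable {w : ι → ℂ} {p : ι → κ} {hp : ∀ i j, w i ≠ 0 → w j ≠ 0 → p i = p j → i = j}
    {C : ℝ} {hC : 0 ≤ C} {hw : ∀ i, ‖w i‖ ≤ C}

theorem weightedComp_apply (ξ : L2 κ) (i : ι) : weightedComp w p hp C hC hw ξ i = w i * ξ (p i) := rfl

theorem norm_weightedComp_le : ‖weightedComp w p hp C hC hw‖ ≤ C :=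
  ContinuousLinearMap.opNorm_le_bound _ hC fun ξ =>
    lp.norm_le_of_forall_sum_le (by norm_num) (by positivity) (sum_weightedComp_le hp hC hw ξ)

end

/-- Restriction along an injective map. -/
noncomputable def comapL2 (j : ι → κ) (hj : Function.Injective j) : L2 κ →L[ℂ] L2 ι :=
  weightedComp 1 j (fun _ _ _ _ h => hj h) 1 zero_le_one fun _ => by simp

variable {j : ι → κ} (hj : Function.Injective j)

theorem comapL2_apply (ξ : L2 κ) (i : ι) : comapL2 j hj ξ i = ξ (j i) := one_mul _

theorem norm_comapL2_le : ‖comapL2 j hj‖ ≤ 1 := norm_weightedComp_le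

theorem comapL2_basisVec (i : ι) : comapL2 j hj (basisVec (j i)) = basisVec i := by
  ext i'
  rw [comapL2_apply]
  by_cases h : i' = i
  · rw [h, basisVec_self, basisVec_self]
  · rw [basisVec_ne h, basisVec_ne fun h' => h (hj h')]

theorem comapL2_basisVec_of_notMem {k : κ} (hk : k ∉ Set.range j) :
    comapL2 j hj (basisVec k) = 0 := by
  ext i
  rw [comapL2_apply]
  exact basisVec_ne fun h => hk ⟨i, h⟩

/-- Extension by zero along an injective map. -/
noncomputable def mapL2 (j : ι → κ) (hj : Function.Injective j) : L2 ι →L[ℂ] L2 κ :=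
  ContinuousLinearMap.adjoint (comapL2 j hj)

theorem mapL2_apply (ξ : L2 ι) (i : ι) : mapL2 j hj ξ (j i) = ξ i := by
  rw [mapL2, adjoint_apply, comapL2_basisVec, inner_basisVec]

theorem mapL2_apply_of_notMem (ξ : L2 ι) {k : κ} (hk : k ∉ Set.range j) : mapL2 j hj ξ k = 0 := by
  rw [mapL2, adjoint_apply, comapL2_basisVec_of_notMem hj hk, inner_zero_left]

theorem norm_mapL2_le : ‖mapL2 j hj‖ ≤ 1 := by
  rw [mapL2, LinearIsometryEquiv.norm_map]
  exact norm_comapL2_le hj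

theorem adjoint_mapL2 : ContinuousLinearMap.adjoint (mapL2 j hj) = comapL2 j hj :=
  ContinuousLinearMap.adjoint_adjoint _

theorem comapL2_mapL2 (ξ : L2 ι) : comapL2 j hj (mapL2 j hj ξ) = ξ := by
  ext i
  rw [comapL2_apply, mapL2_apply]

theorem coef_mapL2 (k : κ) (i : ι) [Decidable (k = j i)] :
    coef (mapL2 j hj) k i = if k = j i then 1 else 0 := by
  rw [coef]
  by_cases hk : k ∈ Set.range j
  · obtain ⟨i', rfl⟩ := hk
    rw [mapL2_apply]
    split_ifs with h
    · rw [hj h, basisVec_self]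
    · exact basisVec_ne fun h' => h (by rw [h'])
  · rw [mapL2_apply_of_notMem hj _ hk, if_neg]
    rintro rfl
    exact hk ⟨i, rfl⟩

/-- The conjugate of an operator by an injective map. -/
noncomputable def conjL2 (j : ι → κ) (hj : Function.Injective j) (T : L2 ι →L[ℂ] L2 ι) :
    L2 κ →L[ℂ] L2 κ := mapL2 j hj ∘L T ∘L comapL2 j hj

theorem norm_conjL2_le (T : L2 ι →L[ℂ] L2 ι) : ‖conjL2 j hj T‖ ≤ ‖T‖ := by
  calc ‖conjL2 j hj T‖ ≤ ‖mapL2 j hj‖ * (‖T‖ * ‖comapL2 j hj‖) :=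
        (ContinuousLinearMap.opNorm_comp_le _ _).trans
          (mul_le_mul_of_nonneg_left (ContinuousLinearMap.opNorm_comp_le _ _) (norm_nonneg _))
    _ ≤ 1 * (‖T‖ * 1) := by
        have := norm_mapL2_le hj
        have := norm_comapL2_le hj
        gcongr
    _ = ‖T‖ := by ring

theorem conjL2_add (S T : L2 ι →L[ℂ] L2 ι) : conjL2 j hj (S + T) = conjL2 j hj S + conjL2 j hj T := by
  ext1 ξ
  simp [conjL2]

theorem conjL2_smul (c : ℂ) (T : L2 ι →L[ℂ] L2 ι) : conjL2 j hj (c • T) = c • conjL2 j hj T := by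
  ext1 ξ
  simp [conjL2]

/-- Extension by zero followed by restriction is the identity, so the inner factors cancel. -/
theorem conjL2_mul (S T : L2 ι →L[ℂ] L2 ι) : conjL2 j hj (S * T) = conjL2 j hj S * conjL2 j hj T := by
  ext1 ξ
  simp [conjL2, comapL2_mapL2]

theorem conjL2_star (T : L2 ι →L[ℂ] L2 ι) : conjL2 j hj (star T) = star (conjL2 j hj T) := by
  rw [ContinuousLinearMap.star_eq_adjoint, ContinuousLinearMap.star_eq_adjoint, conjL2, conjL2,
    ContinuousLinearMap.adjoint_comp, ContinuousLinearMap.adjoint_comp, adjoint_mapL2,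
    ContinuousLinearMap.comp_assoc]
  rfl

theorem coef_conjL2 (T : L2 ι →L[ℂ] L2 ι) (i i' : ι) :
    coef (conjL2 j hj T) (j i) (j i') = coef T i i' := by
  rw [coef, coef, conjL2, ContinuousLinearMap.comp_apply, ContinuousLinearMap.comp_apply,
    comapL2_basisVec, mapL2_apply]

theorem coef_conjL2_of_notMem_left (T : L2 ι →L[ℂ] L2 ι) {k : κ} (hk : k ∉ Set.range j) (k' : κ) :
    coef (conjL2 j hj T) k k' = 0 := by
  rw [coef, conjL2, ContinuousLinearMap.comp_apply, mapL2_apply_of_notMem hj _ hk]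

theorem coef_conjL2_of_notMem_right (T : L2 ι →L[ℂ] L2 ι) (k : κ) {k' : κ}
    (hk : k' ∉ Set.range j) : coef (conjL2 j hj T) k k' = 0 := by
  rw [coef, conjL2, ContinuousLinearMap.comp_apply, ContinuousLinearMap.comp_apply,
    comapL2_basisVec_of_notMem hj hk, map_zero, map_zero]
  rfl

end SquareSummable

/-! ### Families of operators indexed by base lattices. -/

section Operators

variable {K : Type*} [Field K] [NumberField K] [Algebra K ℂ]

namespace Ops

theorem ext_at {S T : Ops K} (h : ∀ y, S.at y = T.at y) : S = T := lp.ext (funext h)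

/-- The element of `Ops K` given by a bounded family of operators. -/
noncomputable def mk (T : ∀ y : KLattice K, Hy y →L[ℂ] Hy y) (C : ℝ) (h : ∀ y, ‖T y‖ ≤ C) : Ops K :=
  (⟨T, memℓp_infty ⟨C, by rintro _ ⟨y, rfl⟩; exact h y⟩⟩ :
    lp (fun y : KLattice K => Hy y →L[ℂ] Hy y) ∞)

@[simp]
theorem at_mk (T : ∀ y : KLattice K, Hy y →L[ℂ] Hy y) (C : ℝ) (h : ∀ y, ‖T y‖ ≤ C) (y : KLattice K) :
    (mk T C h).at y = T y := rfl

@[simp]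
theorem at_mul (S T : Ops K) (y : KLattice K) : (S * T).at y = S.at y * T.at y := rfl

@[simp]
theorem at_star (T : Ops K) (y : KLattice K) : (star T).at y = star (T.at y) := rfl

theorem norm_at_le (T : Ops K) (y : KLattice K) : ‖T.at y‖ ≤ ‖T‖ :=
  lp.norm_apply_le_norm (by simp) (show lp (fun y : KLattice K => Hy y →L[ℂ] Hy y) ∞ from T) y

theorem norm_le {T : Ops K} {C : ℝ} (hC : 0 ≤ C) (h : ∀ y, ‖T.at y‖ ≤ C) : ‖T‖ ≤ C :=
  lp.norm_le_of_forall_le hC h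

/-- The matrix coefficients of an element of `Ops K`. -/
noncomputable def coef (T : Ops K) {y : KLattice K} (L L' : {L : KLattice K // Commens L y}) : ℂ :=
  CMSystem.coef (T.at y) L L'

theorem ext_coef {S T : Ops K}
    (h : ∀ (y : KLattice K) (L L' : {L : KLattice K // Commens L y}), S.coef L L' = T.coef L L') :
    S = T :=
  ext_at fun y => CMSystem.ext_coef (h y)

theorem coef_add (S T : Ops K) {y : KLattice K} (L L' : {L : KLattice K // Commens L y}) :
    (S + T).coef L L' = S.coef L L' + T.coef L L' := rfl

theorem coef_smul (c : ℂ) (T : Ops K) {y : KLattice K} (L L' : {L : KLattice K // Commens L y}) :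
    (c • T).coef L L' = c * T.coef L L' := rfl

theorem coef_sum {α : Type*} (s : Finset α) (T : α → Ops K) {y : KLattice K}
    (L L' : {L : KLattice K // Commens L y}) :
    (∑ a ∈ s, T a).coef L L' = ∑ a ∈ s, (T a).coef L L' := by
  classical
  induction s using Finset.induction_on with
  | empty => rfl
  | insert a s ha ih => rw [Finset.sum_insert ha, Finset.sum_insert ha, coef_add, ih]

end Ops

theorem isConv_iff {f : C_c(GK K, ℂ)} {T : Ops K} :
    IsConv f T ↔ ∀ (y : KLattice K) (L L' : {L : KLattice K // Commens L y}),
      T.coef L L' = ev f L.1 L'.1 := by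
  constructor
  · intro h y L L'
    exact coef_eq_of_hasSum (T := T.at y)
      (c := fun L L' : {L : KLattice K // Commens L y} => ev f L.1 L'.1) (h y) L L'
  · intro h y ξ L
    have e : (fun L' => CMSystem.coef (T.at y) L L' * ξ L') = fun L' => ev f L.1 L'.1 * ξ L' :=
      funext fun L' => congrArg (· * ξ L') (h y L L')
    rw [← e]
    exact hasSum_coef (T.at y) ξ L

end Operators

/-! ### Boundedness of left convolution. -/

section Convolution

variable {K : Type*} [Field K] [NumberField K] [Algebra K ℂ]

theorem Commens.of_common {y : KLattice K} (L L' : {L : KLattice K // Commens L y}) :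
    Commens L.1 L'.1 := L.2.trans L'.2.symm

/-- For a fixed index `q`, each row and each column of the matrix has at most one entry with that
index. The part of `f` there is a weighted partial permutation, of norm at most `sup |f|`. -/
theorem exists_idx_part (f : C_c(GK K, ℂ)) {C : ℝ} (hC : 0 ≤ C) (hf : ∀ L L', ‖ev f L L'‖ ≤ C)
    (q : IdeleCls K) (y : KLattice K) : ∃ T : Hy y →L[ℂ] Hy y, ‖T‖ ≤ C ∧
      (∀ L L' : {L : KLattice K // Commens L y}, idx L.1 L'.1 = q → coef T L L' = ev f L.1 L'.1) ∧
      (∀ L L' : {L : KLattice K // Commens L y}, idx L.1 L'.1 ≠ q → coef T L L' = 0) := by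
  classical
  let P : {L : KLattice K // Commens L y} → Prop := fun L => ∃ L' : {L : KLattice K // Commens L y},
    idx L.1 L'.1 = q
  let p : {L : KLattice K // Commens L y} → {L : KLattice K // Commens L y} := fun L =>
    if h : P L then h.choose else L
  have hp : ∀ L, P L → idx L.1 (p L).1 = q := fun L h => by
    simp only [p, dif_pos h]
    exact h.choose_spec
  let w : {L : KLattice K // Commens L y} → ℂ := fun L => if P L then ev f L.1 (p L).1 else 0
  have hw : ∀ L, w L ≠ 0 → P L := fun L h => by
    by_contra h'
    exact h (if_neg h')
  have hinj : ∀ L L', w L ≠ 0 → w L' ≠ 0 → p L = p L' → L = L' := by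
    intro L L' h h' e
    refine Subtype.ext (eq_of_idx_eq (Commens.of_common L (p L)) (e ▸ Commens.of_common L' (p L')) ?_)
    rw [hp L (hw L h), e, hp L' (hw L' h')]
  have hwC : ∀ L, ‖w L‖ ≤ C := fun L => by
    simp only [w]
    split_ifs
    · exact hf _ _
    · rwa [norm_zero]
  refine ⟨weightedComp w p hinj C hC hwC, norm_weightedComp_le, ?_, ?_⟩
  · intro L L' e
    have hL : P L := ⟨L', e⟩
    have e' : p L = L' := Subtype.ext (eq_of_idx_eq' (Commens.of_common L (p L))
      (Commens.of_common L L') ((hp L hL).trans e.symm))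
    rw [coef, weightedComp_apply, e', basisVec_self, mul_one]
    simp only [w, if_pos hL, e']
  · intro L L' e
    rw [coef, weightedComp_apply]
    by_cases hL : P L
    · rw [basisVec_ne, mul_zero]
      rintro rfl
      exact e (hp L hL)
    · have : w L = 0 := if_neg hL
      rw [this, zero_mul]

theorem coef_sum {ι κ α : Type*} (s : Finset α) (T : α → L2 κ →L[ℂ] L2 ι) (i : ι) (k : κ) :
    coef (∑ a ∈ s, T a) i k = ∑ a ∈ s, coef (T a) i k := by
  classical
  induction s using Finset.induction_on with
  | empty => rfl
  | insert a s ha ih =>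
    rw [Finset.sum_insert ha, Finset.sum_insert ha, ← ih]
    rfl

/-- Compact support meets only finitely many indices, so the convolution operator is a finite sum of
the bounded pieces. -/
theorem exists_isConv (f : C_c(GK K, ℂ)) : ∃ T : Ops K, IsConv f T := by
  classical
  obtain ⟨C, hC, hf⟩ := exists_ev_le f
  obtain ⟨S, hS⟩ := exists_finset_idx f
  choose T hT h1 h2 using exists_idx_part f hC hf
  refine ⟨Ops.mk (fun y => ∑ q ∈ S, T q y) (∑ q ∈ S, C)
    fun y => norm_sum_le_of_le _ fun q _ => hT q y, isConv_iff.2 fun y L L' => ?_⟩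
  rw [Ops.coef, Ops.at_mk, coef_sum]
  have e : ∀ q ∈ S, coef (T q y) L L' = if q = idx L.1 L'.1 then ev f L.1 L'.1 else 0 := by
    intro q _
    split_ifs with h
    · exact h1 q y L L' h.symm
    · exact h2 q y L L' fun h' => h h'.symm
  rw [Finset.sum_congr rfl e, Finset.sum_ite_eq']
  split_ifs with h
  · rfl
  · by_contra h'
    exact h (hS _ _ fun h0 => h' h0.symm).2

/-- The action of `f` by left convolution. -/
noncomputable def convOp (f : C_c(GK K, ℂ)) : Ops K := (exists_isConv f).choose

theorem isConv_convOp (f : C_c(GK K, ℂ)) : IsConv f (convOp f) := (exists_isConv f).choose_spec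

theorem coef_convOp (f : C_c(GK K, ℂ)) {y : KLattice K} (L L' : {L : KLattice K // Commens L y}) :
    (convOp f).coef L L' = ev f L.1 L'.1 := isConv_iff.1 (isConv_convOp f) y L L'

theorem IsConv.eq_convOp {f : C_c(GK K, ℂ)} {T : Ops K} (h : IsConv f T) : T = convOp f :=
  Ops.ext_coef fun y L L' => by rw [coef_convOp, isConv_iff.1 h]

theorem convOp_congr {f g : C_c(GK K, ℂ)} (h : ∀ L L', ev f L L' = ev g L L') :
    convOp f = convOp g :=
  Ops.ext_coef fun y L L' => by rw [coef_convOp, coef_convOp, h]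

theorem convOp_projCc_basisVec (t : Sgp K) {y : KLattice K} (L : {L : KLattice K // Commens L y})
    (hL : Divisible (idealOf t) L.1) : (convOp (projCc t)).at y (basisVec L) = basisVec L := by
  classical
  ext L'
  change (convOp (projCc t)).coef L' L = _
  rw [coef_convOp, ev_projCc]
  by_cases h : L' = L
  · rw [h, basisVec_self, if_pos ⟨rfl, hL⟩]
  · rw [basisVec_ne h, if_neg fun h' => h (Subtype.ext h'.1)]

theorem convOp_projCc_basisVec_of_not (t : Sgp K) {y : KLattice K}
    (L : {L : KLattice K // Commens L y}) (hL : ¬ Divisible (idealOf t) L.1) :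
    (convOp (projCc t)).at y (basisVec L) = 0 := by
  classical
  ext L'
  change (convOp (projCc t)).coef L' L = _
  rw [coef_convOp, ev_projCc, if_neg]
  · rfl
  · rintro ⟨h1, h2⟩
    exact hL (h1 ▸ h2)

theorem coef_one {y : KLattice K} (L L' : {L : KLattice K // Commens L y}) [Decidable (L = L')] :
    (1 : Ops K).coef L L' = if L = L' then 1 else 0 := by
  change basisVec L' L = _
  split_ifs with h
  · rw [h, basisVec_self]
  · exact basisVec_ne h

/-- Every lattice is divisible by the ideal of `1`, so this is the characteristic function of the
whole unit space, which is compact: the unit of `A_K` already comes from a compactly supported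
function. -/
theorem convOp_projCc_one : convOp (projCc (1 : Sgp K)) = 1 := by
  classical
  refine Ops.ext_coef fun y L L' => ?_
  rw [coef_convOp, ev_projCc, coef_one]
  refine if_congr ⟨fun h => Subtype.ext h.1, fun h => ⟨congrArg _ h, ?_⟩⟩ rfl rfl
  exact divisible_iff.2 ⟨L.1, (mulL_one _).symm⟩

end Convolution

/-! ### `θ_s` on bounded families of operators. -/

section Endomorphism

variable {K : Type*} [Field K] [NumberField K] [Algebra K ℂ]

/-- A common denominator of `s⁻¹` is a nonzero integer `a` with `a s⁻¹ ∈ Ô`. This reduces questions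
about `θ_s` to the principal case. -/
theorem exists_mul_eq_diag (s : Sgp K) : ∃ (t : Sgp K) (a : (𝓞 K)⁰), s * t = diag K a := by
  obtain ⟨n, hn, h⟩ := exists_integer_mul_mem_Ohat (((s : (Af K)ˣ)⁻¹ : (Af K)ˣ) : Af K)
  let a : (𝓞 K)⁰ := ⟨n, mem_nonZeroDivisors_of_ne_zero hn⟩
  refine ⟨⟨diag K a * (s : (Af K)ˣ)⁻¹, h⟩, a, Subtype.ext ?_⟩
  change (s : (Af K)ˣ) * (diag K a * (s : (Af K)ˣ)⁻¹) = diag K a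
  rw [mul_left_comm, mul_inv_cancel, mul_one]

/-- With `s t = a` principal, scaling `t y` by `a⁻¹` works: multiplying by `s` then gives the
enlargement of `y`. The class of `y` thus always contains lattices divisible by the ideal of `s`,
even if `y` is not. -/
theorem exists_mulL_commens (s : Sgp K) (y : KLattice K) : ∃ z, Commens (mulL s z) y := by
  obtain ⟨t, a, h⟩ := exists_mul_eq_diag s
  refine ⟨scaleL (embUnits (fieldUnit a))⁻¹ (mulL t y), ?_⟩
  rw [mulL_scaleL, ← mulL_mul, h]
  exact commens_enlarge a y

/-- A `K`-lattice `z` such that `s z` is commensurable to `y`. -/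
noncomputable def divBase (s : Sgp K) (y : KLattice K) : KLattice K := (exists_mulL_commens s y).choose

theorem commens_divBase (s : Sgp K) (y : KLattice K) : Commens (mulL s (divBase s y)) y :=
  (exists_mulL_commens s y).choose_spec

/-- The map `L ↦ s L` from the lattices commensurable to `divBase s y` to those commensurable
to `y`. -/
noncomputable def mulIdx (s : Sgp K) (y : KLattice K) (L : {L : KLattice K // Commens L (divBase s y)}) :
    {L : KLattice K // Commens L y} :=
  ⟨mulL s L.1, ((commens_mulL_iff s).2 L.2).trans (commens_divBase s y)⟩

theorem mulIdx_injective (s : Sgp K) (y : KLattice K) : Function.Injective (mulIdx s y) :=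
  fun _ _ h => Subtype.ext (mulL_injective s (congrArg Subtype.val h))

theorem mem_range_mulIdx_iff {s : Sgp K} {y : KLattice K} {L : {L : KLattice K // Commens L y}} :
    L ∈ Set.range (mulIdx s y) ↔ Divisible (idealOf s) L.1 := by
  rw [divisible_iff]
  constructor
  · rintro ⟨M, rfl⟩
    exact ⟨M.1, rfl⟩
  · rintro ⟨M, h⟩
    have hM : Commens M (divBase s y) :=
      (commens_mulL_iff s).1 (h ▸ L.2.trans (commens_divBase s y).symm)
    exact ⟨⟨M, hM⟩, Subtype.ext h.symm⟩

/-- The endomorphism of `Ops K` which induces `θ_s`. -/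
noncomputable def thetaOps (s : Sgp K) : Ops K →⋆ₙₐ[ℂ] Ops K where
  toFun T := Ops.mk (fun y => conjL2 (mulIdx s y) (mulIdx_injective s y) (T.at (divBase s y))) ‖T‖
    fun y => (norm_conjL2_le _ _).trans (T.norm_at_le _)
  map_smul' c T := Ops.ext_at fun y => conjL2_smul _ c _
  map_zero' := Ops.ext_at fun y => by
    have := conjL2_smul (mulIdx_injective s y) 0 0
    rw [zero_smul, zero_smul] at this
    exact this
  map_add' S T := Ops.ext_at fun y => conjL2_add _ _ _
  map_mul' S T := Ops.ext_at fun y => conjL2_mul _ _ _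
  map_star' T := Ops.ext_at fun y => conjL2_star _ _

theorem coef_thetaOps (s : Sgp K) (T : Ops K) {y : KLattice K}
    (M M' : {L : KLattice K // Commens L (divBase s y)}) :
    (thetaOps s T).coef (mulIdx s y M) (mulIdx s y M') = T.coef M M' := coef_conjL2 _ _ _ _

theorem coef_thetaOps_of_not (s : Sgp K) (T : Ops K) {y : KLattice K}
    (L L' : {L : KLattice K // Commens L y})
    (h : ¬ (Divisible (idealOf s) L.1 ∧ Divisible (idealOf s) L'.1)) :
    (thetaOps s T).coef L L' = 0 := by
  rw [not_and_or, ← mem_range_mulIdx_iff, ← mem_range_mulIdx_iff] at h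
  rcases h with h | h
  · exact coef_conjL2_of_notMem_left _ _ h _
  · exact coef_conjL2_of_notMem_right _ _ _ h

theorem thetaOps_convOp (s : Sgp K) (f : C_c(GK K, ℂ)) :
    thetaOps s (convOp f) = convOp (thetaCc s f) := by
  refine Ops.ext_coef fun y L L' => ?_
  rw [coef_convOp]
  by_cases h : Divisible (idealOf s) L.1 ∧ Divisible (idealOf s) L'.1
  · obtain ⟨M, rfl⟩ := mem_range_mulIdx_iff.2 h.1
    obtain ⟨M', rfl⟩ := mem_range_mulIdx_iff.2 h.2
    rw [coef_thetaOps, coef_convOp]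
    exact (ev_thetaCc_mulL s f M.1 M'.1).symm
  · rw [coef_thetaOps_of_not s _ L L' h, ev_thetaCc_of_not s f h]

/-- The image of the unit is the projection onto the divisible lattices. That `e_J` is a
self-adjoint idempotent then follows from `θ_s` being a *-homomorphism. -/
theorem thetaOps_one (s : Sgp K) : thetaOps s 1 = convOp (projCc s) := by
  classical
  refine Ops.ext_coef fun y L L' => ?_
  rw [coef_convOp, ev_projCc]
  by_cases h : Divisible (idealOf s) L.1 ∧ Divisible (idealOf s) L'.1
  · obtain ⟨M, rfl⟩ := mem_range_mulIdx_iff.2 h.1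
    obtain ⟨M', rfl⟩ := mem_range_mulIdx_iff.2 h.2
    rw [coef_thetaOps, coef_one]
    refine if_congr ⟨fun e => ⟨by rw [e], h.1⟩, fun e => ?_⟩ rfl rfl
    exact mulIdx_injective s y (Subtype.ext e.1)
  · rw [coef_thetaOps_of_not s _ L L' h, if_neg]
    rintro ⟨h1, h2⟩
    exact h ⟨h2, h1 ▸ h2⟩

end Endomorphism

/-! ### The isometries `μ_a` and the inner endomorphisms. -/

section Isometry

variable {K : Type*} [Field K] [NumberField K] [Algebra K ℂ]

/-- The map `L ↦ a⁻¹ L` on the lattices commensurable to `y`. -/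
noncomputable def enlargeIdx (a : (𝓞 K)⁰) (y : KLattice K) (L : {L : KLattice K // Commens L y}) :
    {L : KLattice K // Commens L y} :=
  ⟨enlarge a L.1, (commens_enlarge a L.1).trans L.2⟩

theorem enlargeIdx_injective (a : (𝓞 K)⁰) (y : KLattice K) : Function.Injective (enlargeIdx a y) :=
  fun _ _ h => Subtype.ext (enlarge_injective a (congrArg Subtype.val h))

theorem mem_range_enlargeIdx_iff {a : (𝓞 K)⁰} {y : KLattice K}
    {L : {L : KLattice K // Commens L y}} :
    L ∈ Set.range (enlargeIdx a y) ↔ Divisible (idealOf (diag K a)) L.1 := by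
  rw [divisible_diag_iff]
  constructor
  · rintro ⟨M, rfl⟩
    exact ⟨M.1, rfl⟩
  · rintro ⟨M, h⟩
    exact ⟨⟨M, (commens_enlarge a M).symm.trans (h ▸ L.2)⟩, Subtype.ext h.symm⟩

/-- The matrix of `μ_a` is the graph of the injection `L' ↦ a⁻¹ L'` of the class into itself, so it
acts by extension by zero along it; the isometry property is the injectivity of this map. -/
theorem convOp_muCc_at (a : (𝓞 K)⁰) (y : KLattice K) :
    (convOp (muCc a)).at y = mapL2 (enlargeIdx a y) (enlargeIdx_injective a y) := by
  classical
  refine ext_coef fun L L' => ?_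
  rw [coef_mapL2]
  refine (coef_convOp (muCc a) L L').trans ?_
  rw [ev_muCc]
  exact if_congr ⟨fun h => Subtype.ext h, fun h => congrArg _ h⟩ rfl rfl

theorem star_muCc_at (a : (𝓞 K)⁰) (y : KLattice K) :
    (star (convOp (muCc a))).at y = comapL2 (enlargeIdx a y) (enlargeIdx_injective a y) := by
  rw [Ops.at_star, convOp_muCc_at, ContinuousLinearMap.star_eq_adjoint, adjoint_mapL2]

theorem star_muCc_mul_muCc (a : (𝓞 K)⁰) : star (convOp (muCc a)) * convOp (muCc a) = 1 := by
  refine Ops.ext_at fun y => ?_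
  rw [Ops.at_mul, star_muCc_at, convOp_muCc_at]
  ext1 ξ
  exact comapL2_mapL2 _ ξ

theorem muCc_mul_mul_star_at (a : (𝓞 K)⁰) (T : Ops K) (y : KLattice K) :
    (convOp (muCc a) * T * star (convOp (muCc a))).at y =
      conjL2 (enlargeIdx a y) (enlargeIdx_injective a y) (T.at y) := by
  rw [Ops.at_mul, Ops.at_mul, star_muCc_at, convOp_muCc_at]
  rfl

theorem coef_muCc_mul_mul_star (a : (𝓞 K)⁰) (T : Ops K) {y : KLattice K}
    (M M' : {L : KLattice K // Commens L y}) :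
    (convOp (muCc a) * T * star (convOp (muCc a))).coef (enlargeIdx a y M) (enlargeIdx a y M') =
      T.coef M M' := by
  rw [Ops.coef, muCc_mul_mul_star_at]
  exact coef_conjL2 _ _ _ _

theorem coef_muCc_mul_mul_star_of_not (a : (𝓞 K)⁰) (T : Ops K) {y : KLattice K}
    (L L' : {L : KLattice K // Commens L y})
    (h : ¬ (Divisible (idealOf (diag K a)) L.1 ∧ Divisible (idealOf (diag K a)) L'.1)) :
    (convOp (muCc a) * T * star (convOp (muCc a))).coef L L' = 0 := by
  rw [not_and_or, ← mem_range_enlargeIdx_iff, ← mem_range_enlargeIdx_iff] at h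
  rw [Ops.coef, muCc_mul_mul_star_at]
  rcases h with h | h
  · exact coef_conjL2_of_notMem_left _ _ h _
  · exact coef_conjL2_of_notMem_right _ _ _ h

/-- An enlargement is a product by `diag K a` followed by scaling, which functions on `G_K` do not
see. This is why principal elements act by inner endomorphisms. -/
theorem ev_thetaCc_enlarge (a : (𝓞 K)⁰) (f : C_c(GK K, ℂ)) (M M' : KLattice K) :
    ev (thetaCc (diag K a) f) (enlarge a M) (enlarge a M') = ev f M M' := by
  rw [enlarge, enlarge, ev_scaleL, ev_thetaCc_mulL]

theorem thetaOps_diag_convOp (a : (𝓞 K)⁰) (f : C_c(GK K, ℂ)) :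
    thetaOps (diag K a) (convOp f) = convOp (muCc a) * convOp f * star (convOp (muCc a)) := by
  rw [thetaOps_convOp]
  refine Ops.ext_coef fun y L L' => ?_
  rw [coef_convOp]
  by_cases h : Divisible (idealOf (diag K a)) L.1 ∧ Divisible (idealOf (diag K a)) L'.1
  · obtain ⟨M, rfl⟩ := mem_range_enlargeIdx_iff.2 h.1
    obtain ⟨M', rfl⟩ := mem_range_enlargeIdx_iff.2 h.2
    rw [coef_muCc_mul_mul_star, coef_convOp]
    exact ev_thetaCc_enlarge a f M.1 M'.1
  · rw [coef_muCc_mul_mul_star_of_not a _ L L' h, ev_thetaCc_of_not _ f h]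

/-- Enlargement commutes with multiplication of `φ` by `s`, so `θ_s` only cuts `μ_a` down to the
divisible lattices. The relation yields the range of `θ_s`. -/
theorem thetaOps_muCc (s : Sgp K) (a : (𝓞 K)⁰) :
    thetaOps s (convOp (muCc a)) = convOp (muCc a) * convOp (projCc s) := by
  classical
  rw [thetaOps_convOp]
  refine Ops.ext_coef fun y L L' => ?_
  rw [coef_convOp]
  have e : ∀ T : Ops K, (convOp (muCc a) * T).coef L L' =
      (convOp (muCc a)).at y (T.at y (basisVec L')) L := fun _ => rfl
  rw [e]
  by_cases h' : Divisible (idealOf s) L'.1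
  · rw [convOp_projCc_basisVec s L' h']
    change _ = (convOp (muCc a)).coef L L'
    rw [coef_convOp]
    obtain ⟨M', hM'⟩ := divisible_iff.1 h'
    by_cases h : Divisible (idealOf s) L.1
    · obtain ⟨M, hM⟩ := divisible_iff.1 h
      rw [hM, hM', ev_thetaCc_mulL, ev_muCc, ev_muCc, ← mulL_enlarge]
      exact if_congr (mulL_injective s).eq_iff.symm rfl rfl
    · rw [ev_thetaCc_of_not s _ fun H => h H.1, ev_muCc, if_neg]
      rintro h1
      rw [hM', ← mulL_enlarge] at h1
      exact h (divisible_iff.2 ⟨_, h1⟩)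
  · rw [convOp_projCc_basisVec_of_not s L' h', ev_thetaCc_of_not s _ fun H => h' H.2, map_zero]
    rfl

end Isometry

/-! ### The time evolution as conjugation by diagonal unitaries. -/

section Phase

variable {K : Type*} [Field K] [NumberField K] [Algebra K ℂ]

/-- The factor `|L/L'|^{it}`. -/
noncomputable def phase (t : ℝ) (L L' : KLattice K) : ℂ :=
  (covolRatio L L' : ℂ) ^ (Complex.I * (t : ℂ))

variable (hdeg : Module.finrank ℚ K = 2) [NumberField.IsTotallyComplex K]

theorem norm_phase (hdeg : Module.finrank ℚ K = 2) (t : ℝ) (L L' : KLattice K) :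
    ‖phase t L L'‖ = 1 := by
  rw [phase, Complex.norm_cpow_eq_rpow_re_of_pos (covolRatio_pos hdeg L L')]
  simp

theorem phase_add (hdeg : Module.finrank ℚ K = 2) (t u : ℝ) (L L' : KLattice K) :
    phase (t + u) L L' = phase t L L' * phase u L L' := by
  have h : (covolRatio L L' : ℂ) ≠ 0 := Complex.ofReal_ne_zero.2 (covolRatio_pos hdeg L L').ne'
  rw [phase, phase, phase, ← Complex.cpow_add _ _ h, Complex.ofReal_add, mul_add]

theorem phase_zero (L L' : KLattice K) : phase 0 L L' = 1 := by
  rw [phase, Complex.ofReal_zero, mul_zero, Complex.cpow_zero]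

theorem phase_neg (t : ℝ) (L L' : KLattice K) : phase (-t) L L' = (phase t L L')⁻¹ := by
  rw [phase, phase, ← Complex.cpow_neg, Complex.ofReal_neg, mul_neg]

theorem phase_mul (hdeg : Module.finrank ℚ K = 2) (t : ℝ) (L L' L'' : KLattice K) :
    phase t L L' * phase t L' L'' = phase t L L'' := by
  rw [phase, phase, phase, ← Complex.mul_cpow_ofReal_nonneg (covolRatio_pos hdeg _ _).le
    (covolRatio_pos hdeg _ _).le, ← Complex.ofReal_mul, covolRatio_mul hdeg]

/-- The diagonal unitaries which implement the time evolution. -/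
noncomputable def phaseOp (t : ℝ) : Ops K :=
  Ops.mk (fun y => weightedComp (fun L : {L : KLattice K // Commens L y} => phase t L.1 y) id
    (fun _ _ _ _ h => h) 1 zero_le_one fun _ => (norm_phase hdeg _ _ _).le) 1
    fun _ => norm_weightedComp_le

theorem phaseOp_apply (t : ℝ) (y : KLattice K) (ξ : Hy y) (L : {L : KLattice K // Commens L y}) :
    (phaseOp hdeg t).at y ξ L = phase t L.1 y * ξ L := rfl

theorem phaseOp_basisVec (t : ℝ) {y : KLattice K} (L : {L : KLattice K // Commens L y}) :
    (phaseOp hdeg t).at y (basisVec L) = phase t L.1 y • basisVec L := by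
  ext L'
  rw [phaseOp_apply, lp.coeFn_smul, Pi.smul_apply, smul_eq_mul]
  by_cases h : L' = L
  · rw [h]
  · rw [basisVec_ne h, mul_zero, mul_zero]

theorem phaseOp_add (t u : ℝ) : phaseOp hdeg (t + u) = phaseOp hdeg t * phaseOp hdeg u := by
  refine Ops.ext_at fun y => ?_
  ext ξ L
  rw [phaseOp_apply, phase_add hdeg, mul_assoc]
  rfl

theorem phaseOp_zero : phaseOp hdeg 0 = (1 : Ops K) := by
  refine Ops.ext_at fun y => ?_
  ext ξ L
  rw [phaseOp_apply, phase_zero, one_mul]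
  rfl

theorem star_phaseOp (t : ℝ) : star (phaseOp hdeg t) = (phaseOp hdeg (-t) : Ops K) := by
  refine Ops.ext_at fun y => ?_
  ext ξ L
  rw [Ops.at_star, ContinuousLinearMap.star_eq_adjoint, adjoint_apply, phaseOp_basisVec,
    inner_smul_left, inner_basisVec, phaseOp_apply, phase_neg, Complex.inv_eq_conj (norm_phase hdeg _ _ _)]

theorem phaseOp_mul_neg (t : ℝ) : phaseOp hdeg t * phaseOp hdeg (-t) = (1 : Ops K) := by
  rw [← phaseOp_add, add_neg_cancel, phaseOp_zero]

theorem phaseOp_neg_mul (t : ℝ) : phaseOp hdeg (-t) * phaseOp hdeg t = (1 : Ops K) := by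
  rw [← phaseOp_add, neg_add_cancel, phaseOp_zero]

/-- The automorphism of `Ops K` which induces `σ_t`. -/
noncomputable def sigmaOps (t : ℝ) : Ops K →⋆ₐ[ℂ] Ops K where
  toFun T := phaseOp hdeg t * T * phaseOp hdeg (-t)
  map_one' := by rw [mul_one, phaseOp_mul_neg]
  map_mul' S T := by
    have h : ∀ Z : Ops K, phaseOp hdeg (-t) * (phaseOp hdeg t * Z) = Z := fun Z => by
      rw [← mul_assoc, phaseOp_neg_mul, one_mul]
    simp only [mul_assoc, h]
  map_zero' := by rw [mul_zero, zero_mul]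
  map_add' S T := by rw [mul_add, add_mul]
  commutes' c := by
    rw [Algebra.algebraMap_eq_smul_one, mul_smul_comm, mul_one, smul_mul_assoc, phaseOp_mul_neg]
  map_star' T := by
    rw [star_mul, star_mul, star_phaseOp, star_phaseOp, neg_neg, mul_assoc]

theorem sigmaOps_apply (t : ℝ) (T : Ops K) :
    sigmaOps hdeg t T = phaseOp hdeg t * T * phaseOp hdeg (-t) := rfl

theorem continuous_sigmaOps (t : ℝ) : Continuous (sigmaOps hdeg t : Ops K → Ops K) := by
  change Continuous fun T => phaseOp hdeg t * T * phaseOp hdeg (-t)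
  fun_prop

theorem sigmaOps_add (t u : ℝ) (T : Ops K) :
    sigmaOps hdeg (t + u) T = sigmaOps hdeg t (sigmaOps hdeg u T) := by
  rw [sigmaOps_apply, sigmaOps_apply, sigmaOps_apply, phaseOp_add, neg_add_rev, phaseOp_add]
  simp only [mul_assoc]

theorem sigmaOps_zero (T : Ops K) : sigmaOps hdeg 0 T = T := by
  rw [sigmaOps_apply, neg_zero, phaseOp_zero, one_mul, mul_one]

/-- The phases `|L/y|^{it}` and `|L'/y|^{-it}` combine by the cocycle identity, so the base point
`y` disappears. -/
theorem coef_sigmaOps (t : ℝ) (T : Ops K) {y : KLattice K} (L L' : {L : KLattice K // Commens L y}) :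
    (sigmaOps hdeg t T).coef L L' = phase t L.1 L'.1 * T.coef L L' := by
  have h1 : (sigmaOps hdeg t T).coef L L' =
      phase t L.1 y * T.at y ((phaseOp hdeg (-t)).at y (basisVec L')) L := rfl
  have h0 : phase t L'.1 y ≠ 0 := by
    intro h
    have := norm_phase hdeg t L'.1 y
    rw [h, norm_zero] at this
    exact zero_ne_one this
  have h2 : T.at y ((phaseOp hdeg (-t)).at y (basisVec L')) L = phase (-t) L'.1 y * T.coef L L' := by
    rw [phaseOp_basisVec, map_smul]
    rfl
  rw [h1, h2, ← phase_mul hdeg t L.1 L'.1 y, phase_neg, mul_assoc, mul_inv_cancel_left₀ h0]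

theorem sigmaOps_convOp (t : ℝ) (f : C_c(GK K, ℂ)) :
    sigmaOps hdeg t (convOp f) = convOp (sigmaCc hdeg t f) := by
  refine Ops.ext_coef fun y L L' => ?_
  rw [coef_convOp, coef_sigmaOps, coef_convOp, ev_sigmaCc]
  rfl

/-- The covolume ratio takes finitely many values on the support of `f`, so the orbit is a finite
combination of the scalar functions `r^{it}` with operator coefficients; it is even norm continuous.
-/
theorem continuous_sigmaOps_convOp (f : C_c(GK K, ℂ)) :
    Continuous fun t => sigmaOps hdeg t (convOp f) := by
  classical
  obtain ⟨S, hS⟩ := exists_finset_covolRatio hdeg f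
  -- Only positive values occur as ratios; filtering records this, since `r ≠ 0` is needed for the
  -- continuity of `r^{it}`.
  have h : ∀ t, sigmaOps hdeg t (convOp f) = ∑ r ∈ S.filter fun r => 0 < r,
      ((r : ℂ) ^ (Complex.I * (t : ℂ))) • convOp (covolPart hdeg r f) := by
    intro t
    refine Ops.ext_coef fun y L L' => ?_
    rw [coef_sigmaOps, Ops.coef_sum, coef_convOp]
    simp only [Ops.coef_smul, coef_convOp, ev_covolPart]
    have e : ∀ r ∈ S.filter fun r => 0 < r, ((r : ℂ) ^ (Complex.I * (t : ℂ))) *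
        ((if covolRatio L.1 L'.1 = r then 1 else 0) * ev f L.1 L'.1) =
        if covolRatio L.1 L'.1 = r then phase t L.1 L'.1 * ev f L.1 L'.1 else 0 := by
      intro r _
      split_ifs with h
      · rw [one_mul, phase, h]
      · rw [zero_mul, mul_zero]
    rw [Finset.sum_congr rfl e, Finset.sum_ite_eq]
    split_ifs with h
    · rfl
    · rw [mul_eq_zero]
      right
      by_contra h'
      exact h (Finset.mem_filter.2 ⟨hS _ _ h', covolRatio_pos hdeg _ _⟩)
  simp only [h]
  refine continuous_finsetSum _ fun r hr => ?_
  have hr0 : (r : ℂ) ≠ 0 := Complex.ofReal_ne_zero.2 (Finset.mem_filter.1 hr).2.ne'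
  have hc : Continuous fun t : ℝ => Complex.I * (t : ℂ) := by fun_prop
  exact (hc.const_cpow (Or.inl hr0)).smul continuous_const

theorem norm_phaseOp_le (t : ℝ) : ‖(phaseOp hdeg t : Ops K)‖ ≤ 1 :=
  Ops.norm_le zero_le_one fun _ => norm_weightedComp_le (hp := fun _ _ _ _ h => h)
    (hC := zero_le_one) (hw := fun _ => (norm_phase hdeg _ _ _).le)

theorem norm_sigmaOps_le (t : ℝ) (T : Ops K) : ‖sigmaOps hdeg t T‖ ≤ ‖T‖ := by
  rw [sigmaOps_apply]
  calc _ ≤ ‖(phaseOp hdeg t : Ops K)‖ * ‖T‖ * ‖(phaseOp hdeg (-t) : Ops K)‖ :=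
        (norm_mul_le _ _).trans (mul_le_mul_of_nonneg_right (norm_mul_le _ _) (norm_nonneg _))
    _ ≤ 1 * ‖T‖ * 1 := by
        have := norm_phaseOp_le (K := K) hdeg t
        have := norm_phaseOp_le (K := K) hdeg (-t)
        gcongr
    _ = ‖T‖ := by ring

/-- The `σ_t` are contractions, so approximating `T` approximates its orbit uniformly in `t`. -/
theorem isClosed_continuous_sigmaOps :
    IsClosed {T : Ops K | Continuous fun t => sigmaOps hdeg t T} := by
  refine isClosed_of_closure_subset fun T hT => ?_
  refine continuous_of_uniform_approx_of_continuous fun u hu => ?_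
  obtain ⟨ε, hε, hu⟩ := Metric.mem_uniformity_dist.1 hu
  obtain ⟨S, hS, hST⟩ := Metric.mem_closure_iff.1 hT ε hε
  refine ⟨_, hS, fun t => hu ?_⟩
  rw [dist_eq_norm, ← map_sub]
  rw [dist_eq_norm] at hST
  exact (norm_sigmaOps_le hdeg t _).trans_lt hST

end Phase

/-! ### Restriction to `A_K` and the structure of `θ_s`. -/

section Algebra

variable {K : Type*} [Field K] [NumberField K] [Algebra K ℂ]

/-- The image of `C_c(G_K)` in `A_K`. -/
noncomputable def gen (f : C_c(GK K, ℂ)) : AK K :=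
  ⟨convOp f, StarSubalgebra.le_topologicalClosure _
    (StarAlgebra.subset_adjoin ℂ _ ⟨f, isConv_convOp f⟩)⟩

theorem gen_projCc_one : gen (projCc (1 : Sgp K)) = 1 := Subtype.ext convOp_projCc_one

/-- Induction over the generated *-algebra, followed by closure. No case for scalars is needed. -/
theorem AK_induction {p : AK K → Prop} (hclosed : IsClosed {x | p x}) (hgen : ∀ f, p (gen f))
    (hadd : ∀ x y, p x → p y → p (x + y)) (hsmul : ∀ (c : ℂ) x, p x → p (c • x))
    (hmul : ∀ x y, p x → p y → p (x * y)) (hstar : ∀ x, p x → p (star x)) (x : AK K) : p x := by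
  let G : Set (Ops K) := {T | ∃ f : C_c(GK K, ℂ), IsConv f T}
  have hle : ∀ {T}, T ∈ StarAlgebra.adjoin ℂ G → T ∈ AK K := fun h =>
    StarSubalgebra.le_topologicalClosure _ h
  have h1 : ∀ T (hT : T ∈ StarAlgebra.adjoin ℂ G), p ⟨T, hle hT⟩ := by
    intro T hT
    induction hT using StarAlgebra.adjoin_induction with
    | mem T h =>
      obtain ⟨f, hf⟩ := h
      have := hgen f
      rwa [show gen f = ⟨T, hle (StarAlgebra.subset_adjoin ℂ G ⟨f, hf⟩)⟩ from
        Subtype.ext hf.eq_convOp.symm] at this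
    -- Scalars are multiples of `gen (projCc 1) = 1`.
    | algebraMap r =>
      have := hsmul r _ (hgen (projCc 1))
      rw [gen_projCc_one] at this
      have e : (⟨algebraMap ℂ (Ops K) r, hle (algebraMap_mem _ r)⟩ : AK K) = r • (1 : AK K) :=
        Subtype.ext (Algebra.algebraMap_eq_smul_one r)
      exact (congrArg p e).mpr this
    | mul S T hS hT h₁ h₂ => exact hmul ⟨S, hle hS⟩ ⟨T, hle hT⟩ h₁ h₂
    | add S T hS hT h₁ h₂ => exact hadd ⟨S, hle hS⟩ ⟨T, hle hT⟩ h₁ h₂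
    | star T hT h => exact hstar ⟨T, hle hT⟩ h
  have h2 : x ∈ closure {x : AK K | p x} := by
    rw [closure_subtype]
    refine closure_mono ?_ x.2
    intro T hT
    exact ⟨⟨T, hle hT⟩, h1 T hT, rfl⟩
  rwa [hclosed.closure_eq] at h2

theorem eq_of_gen {φ ψ : AK K →⋆ₙₐ[ℂ] AK K} (hφ : Continuous φ) (hψ : Continuous ψ)
    (h : ∀ f, φ (gen f) = ψ (gen f)) : φ = ψ := by
  ext1 x
  induction x using AK_induction with
  | hclosed =>
    exact isClosed_eq hφ hψ
  | hgen f => exact h f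
  | hadd x y hx hy => rw [map_add, map_add, hx, hy]
  | hsmul c x hx => rw [map_smul, map_smul, hx]
  | hmul x y hx hy => rw [map_mul, map_mul, hx, hy]
  | hstar x hx => rw [map_star, map_star, hx]

theorem continuous_thetaOps (s : Sgp K) : Continuous (thetaOps s) :=
  AddMonoidHomClass.continuous_of_bound (thetaOps s) 1 fun T => by
    rw [one_mul]
    exact Ops.norm_le (norm_nonneg T) fun y =>
      (norm_conjL2_le _ _).trans (T.norm_at_le _)

theorem thetaOps_mem (s : Sgp K) (x : AK K) : thetaOps s (x : Ops K) ∈ AK K := by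
  induction x using AK_induction with
  | hclosed =>
    exact (StarSubalgebra.isClosed_topologicalClosure _).preimage
      ((continuous_thetaOps s).comp continuous_subtype_val)
  | hgen f => exact (thetaOps_convOp s f) ▸ (gen (thetaCc s f)).2
  | hadd x y hx hy => exact (map_add (thetaOps s) (x : Ops K) y) ▸ add_mem hx hy
  | hsmul c x hx => exact (map_smul (thetaOps s) c (x : Ops K)) ▸ (AK K).smul_mem hx c
  | hmul x y hx hy => exact (map_mul (thetaOps s) (x : Ops K) y) ▸ mul_mem hx hy
  | hstar x hx => exact (map_star (thetaOps s) (x : Ops K)) ▸ star_mem hx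

/-- The endomorphism `θ_s` of `A_K`. -/
noncomputable def theta (s : Sgp K) : AK K →⋆ₙₐ[ℂ] AK K where
  toFun x := ⟨thetaOps s x, thetaOps_mem s x⟩
  map_smul' c x := Subtype.ext (map_smul (thetaOps s) c (x : Ops K))
  map_zero' := Subtype.ext (map_zero (thetaOps s))
  map_add' x y := Subtype.ext (map_add (thetaOps s) (x : Ops K) y)
  map_mul' x y := Subtype.ext (map_mul (thetaOps s) (x : Ops K) y)
  map_star' x := Subtype.ext (map_star (thetaOps s) (x : Ops K))

theorem continuous_theta (s : Sgp K) : Continuous (theta s) :=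
  ((continuous_thetaOps s).comp continuous_subtype_val).subtype_mk _

theorem theta_gen (s : Sgp K) (f : C_c(GK K, ℂ)) : theta s (gen f) = gen (thetaCc s f) :=
  Subtype.ext (thetaOps_convOp s f)

theorem theta_one (s : Sgp K) : theta s 1 = gen (projCc s) := Subtype.ext (thetaOps_one s)

theorem gen_congr {f g : C_c(GK K, ℂ)} (h : ∀ L L', ev f L L' = ev g L L') : gen f = gen g :=
  Subtype.ext (convOp_congr h)

theorem ev_thetaCc_one (f : C_c(GK K, ℂ)) (L L' : KLattice K) : ev (thetaCc 1 f) L L' = ev f L L' := by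
  have := ev_thetaCc_mulL 1 f L L'
  rwa [mulL_one, mulL_one] at this

/-- Divisibility of `sM` by the ideal of `st` is divisibility of `M` by that of `t`, so the two
supports match, and on them `(st) N = s (t N)`. -/
theorem ev_thetaCc_mul (s t : Sgp K) (f : C_c(GK K, ℂ)) (L L' : KLattice K) :
    ev (thetaCc (s * t) f) L L' = ev (thetaCc s (thetaCc t f)) L L' := by
  by_cases h : Divisible (idealOf s) L ∧ Divisible (idealOf s) L'
  · obtain ⟨M, rfl⟩ := divisible_iff.1 h.1
    obtain ⟨M', rfl⟩ := divisible_iff.1 h.2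
    rw [ev_thetaCc_mulL]
    have hd : ∀ M : KLattice K, Divisible (idealOf (s * t)) (mulL s M) ↔ Divisible (idealOf t) M := by
      intro M
      rw [divisible_iff, divisible_iff]
      simp only [mulL_mul, (mulL_injective s).eq_iff]
    by_cases h' : Divisible (idealOf t) M ∧ Divisible (idealOf t) M'
    · obtain ⟨N, rfl⟩ := divisible_iff.1 h'.1
      obtain ⟨N', rfl⟩ := divisible_iff.1 h'.2
      rw [← mulL_mul, ← mulL_mul, ev_thetaCc_mulL, ev_thetaCc_mulL]
    · rw [ev_thetaCc_of_not t f h', ev_thetaCc_of_not (s * t) f]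
      rwa [hd, hd]
  · rw [ev_thetaCc_of_not s _ h, ev_thetaCc_of_not (s * t) f]
    refine mt (And.imp ?_ ?_) h <;>
    · rw [divisible_iff, divisible_iff]
      rintro ⟨M, rfl⟩
      exact ⟨_, mulL_mul s t M⟩

/-- The action of the semigroup `Ô ∩ 𝔸_{K,f}^*` on `A_K`. -/
noncomputable def thetaHom : Sgp K →* (AK K →⋆ₙₐ[ℂ] AK K) where
  toFun := theta
  map_one' := eq_of_gen (continuous_theta 1) continuous_id fun f => by
    rw [theta_gen]
    exact gen_congr (ev_thetaCc_one f)
  map_mul' s t := eq_of_gen (continuous_theta _) ((continuous_theta s).comp (continuous_theta t))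
    fun f => by
      rw [theta_gen, gen_congr (ev_thetaCc_mul s t f), ← theta_gen, ← theta_gen]
      rfl

theorem star_gen_muCc_mul (a : (𝓞 K)⁰) : star (gen (muCc a)) * gen (muCc a) = 1 :=
  Subtype.ext (star_muCc_mul_muCc a)

/-- Known on generators; conjugation by `μ_a` is multiplicative because `μ_a` is an isometry, so
both sides agree on the generated algebra and, by continuity, on `A_K`. -/
theorem theta_diag (a : (𝓞 K)⁰) (x : AK K) :
    theta (diag K a) x = gen (muCc a) * x * star (gen (muCc a)) := by
  have hm : ∀ z, star (gen (muCc a)) * (gen (muCc a) * z) = z := fun z => by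
    rw [← mul_assoc, star_gen_muCc_mul, one_mul]
  induction x using AK_induction with
  | hclosed =>
    exact isClosed_eq (continuous_theta _) (by fun_prop)
  | hgen f => exact Subtype.ext (thetaOps_diag_convOp a f)
  | hadd x y hx hy => rw [map_add, hx, hy, mul_add, add_mul]
  | hsmul c x hx => rw [map_smul, hx, mul_smul_comm, smul_mul_assoc]
  | hmul x y hx hy =>
    rw [map_mul, hx, hy]
    simp only [mul_assoc, hm]
  | hstar x hx => rw [map_star, hx, star_mul, star_mul, star_star, mul_assoc]

theorem gen_muCc_mul_star (a : (𝓞 K)⁰) :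
    gen (muCc a) * star (gen (muCc a)) = gen (projCc (diag K a)) := by
  rw [← theta_one, theta_diag, mul_one]

theorem theta_muCc (s : Sgp K) (a : (𝓞 K)⁰) :
    theta s (gen (muCc a)) = gen (muCc a) * gen (projCc s) := Subtype.ext (thetaOps_muCc s a)

theorem theta_mul (s t : Sgp K) (x : AK K) : theta (s * t) x = theta s (theta t x) :=
  DFunLike.congr_fun (map_mul thetaHom s t) x

theorem star_gen_projCc (s : Sgp K) : star (gen (projCc s)) = gen (projCc s) := by
  rw [← theta_one, ← map_star, star_one]

theorem gen_projCc_mul_self (s : Sgp K) : gen (projCc s) * gen (projCc s) = gen (projCc s) := by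
  rw [← theta_one, ← map_mul, one_mul]

/-- With `s t = a` principal, `θ_t θ_s` is conjugation by `μ_a`, which the compression `z ↦ μ_a^* z
μ_a` undoes. This gives an explicit left inverse of `θ_s`. -/
theorem theta_injective (s : Sgp K) : Function.Injective (theta s) := by
  obtain ⟨t, a, h⟩ := exists_mul_eq_diag s
  intro x y e
  have key : ∀ x : AK K, star (gen (muCc a)) * theta t (theta s x) * gen (muCc a) = x := fun x => by
    rw [← theta_mul, mul_comm t s, h, theta_diag, mul_assoc, mul_assoc, mul_assoc, star_gen_muCc_mul,
      mul_one, ← mul_assoc, star_gen_muCc_mul, one_mul]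
  rw [← key x, e, key y]

theorem range_theta (s : Sgp K) :
    Set.range (theta s) = {x | ∃ y, x = gen (projCc s) * y * gen (projCc s)} := by
  ext x
  constructor
  · rintro ⟨x, rfl⟩
    refine ⟨theta s x, ?_⟩
    rw [← theta_one, ← map_mul, ← map_mul, one_mul, mul_one]
  · rintro ⟨y, rfl⟩
    obtain ⟨t, a, h⟩ := exists_mul_eq_diag s
    -- The preimage is the left inverse applied to `y`. Its image is `(e μ^*) (μ y μ^*) (μ e) = e y
    -- e`, since `θ_s(μ) = μ e` and `θ_s θ_t` is conjugation by `μ`.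
    refine ⟨star (gen (muCc a)) * theta t y * gen (muCc a), ?_⟩
    have hm : ∀ z, star (gen (muCc a)) * (gen (muCc a) * z) = z := fun z => by
      rw [← mul_assoc, star_gen_muCc_mul, one_mul]
    rw [map_mul, map_mul, map_star, ← theta_mul, h, theta_diag, theta_muCc, star_mul, star_gen_projCc]
    simp only [mul_assoc, hm]

/-- The automorphism `θ_s` for `s ∈ Ô^*`. -/
noncomputable def thetaEquiv (s t : Sgp K) (h : s * t = 1) : AK K ≃⋆ₐ[ℂ] AK K where
  toFun := theta s
  invFun := theta t
  left_inv x := by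
    rw [← theta_mul, mul_comm, h]
    exact DFunLike.congr_fun (map_one thetaHom) x
  right_inv x := by
    rw [← theta_mul, h]
    exact DFunLike.congr_fun (map_one thetaHom) x
  map_mul' := map_mul (theta s)
  map_add' := map_add (theta s)
  map_star' := map_star (theta s)
  map_smul' := map_smul (theta s)

end Algebra

/-! ### The time evolution on `A_K` and its commutation with `θ_s`. -/

section TimeEvolution

variable {K : Type*} [Field K] [NumberField K] [Algebra K ℂ]
  (hdeg : Module.finrank ℚ K = 2) [NumberField.IsTotallyComplex K]

theorem sigmaOps_mem (t : ℝ) (x : AK K) : sigmaOps hdeg t (x : Ops K) ∈ AK K := by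
  induction x using AK_induction with
  | hclosed =>
    exact (StarSubalgebra.isClosed_topologicalClosure _).preimage
      ((continuous_sigmaOps hdeg t).comp continuous_subtype_val)
  | hgen f => exact (sigmaOps_convOp hdeg t f) ▸ (gen (sigmaCc hdeg t f)).2
  | hadd x y hx hy => exact (map_add (sigmaOps hdeg t) (x : Ops K) y) ▸ add_mem hx hy
  | hsmul c x hx => exact (map_smul (sigmaOps hdeg t) c (x : Ops K)) ▸ (AK K).smul_mem hx c
  | hmul x y hx hy => exact (map_mul (sigmaOps hdeg t) (x : Ops K) y) ▸ mul_mem hx hy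
  | hstar x hx => exact (map_star (sigmaOps hdeg t) (x : Ops K)) ▸ star_mem hx

/-- The automorphism `σ_t` of `A_K`. -/
noncomputable def sigma (t : ℝ) : AK K ≃⋆ₐ[ℂ] AK K where
  toFun x := ⟨sigmaOps hdeg t x, sigmaOps_mem hdeg t x⟩
  invFun x := ⟨sigmaOps hdeg (-t) x, sigmaOps_mem hdeg (-t) x⟩
  left_inv x := Subtype.ext (by
    change sigmaOps hdeg (-t) (sigmaOps hdeg t x) = x
    rw [← sigmaOps_add, neg_add_cancel, sigmaOps_zero])
  right_inv x := Subtype.ext (by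
    change sigmaOps hdeg t (sigmaOps hdeg (-t) x) = x
    rw [← sigmaOps_add, add_neg_cancel, sigmaOps_zero])
  map_smul' c x := Subtype.ext (map_smul (sigmaOps hdeg t) c (x : Ops K))
  map_add' x y := Subtype.ext (map_add (sigmaOps hdeg t) (x : Ops K) y)
  map_mul' x y := Subtype.ext (map_mul (sigmaOps hdeg t) (x : Ops K) y)
  map_star' x := Subtype.ext (map_star (sigmaOps hdeg t) (x : Ops K))

theorem sigma_gen (t : ℝ) (f : C_c(GK K, ℂ)) :
    sigma hdeg t (gen f) = gen (sigmaCc hdeg t f) := Subtype.ext (sigmaOps_convOp hdeg t f)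

theorem continuous_sigma (t : ℝ) : Continuous (sigma hdeg t : AK K → AK K) :=
  ((continuous_sigmaOps hdeg t).comp continuous_subtype_val).subtype_mk _

/-- The time evolution on `A_K`. -/
noncomputable def sigmaHom : Multiplicative ℝ →* (AK K ≃⋆ₐ[ℂ] AK K) where
  toFun t := sigma hdeg t.toAdd
  map_one' := by
    ext1 x
    exact Subtype.ext (sigmaOps_zero hdeg (x : Ops K))
  map_mul' t u := by
    ext1 x
    exact Subtype.ext (sigmaOps_add hdeg t.toAdd u.toAdd (x : Ops K))

theorem continuous_sigma_apply (x : AK K) : Continuous fun t : ℝ => sigma hdeg t x := by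
  induction x using AK_induction with
  | hclosed =>
    have : {x : AK K | Continuous fun t : ℝ => sigma hdeg t x} =
        Subtype.val ⁻¹' {T : Ops K | Continuous fun t => sigmaOps hdeg t T} := by
      ext x
      exact continuous_induced_rng
    rw [this]
    exact (isClosed_continuous_sigmaOps hdeg).preimage continuous_subtype_val
  | hgen f => exact (continuous_sigmaOps_convOp hdeg f).subtype_mk _
  | hadd x y hx hy => simp only [map_add]; exact hx.add hy
  | hsmul c x hx => simp only [map_smul]; exact hx.const_smul c
  | hmul x y hx hy => simp only [map_mul]; exact hx.mul hy
  | hstar x hx => simp only [map_star]; exact hx.star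

theorem ev_thetaCc_sigmaCc (s : Sgp K) (t : ℝ) (f : C_c(GK K, ℂ)) (L L' : KLattice K) :
    ev (thetaCc s (sigmaCc hdeg t f)) L L' = ev (sigmaCc hdeg t (thetaCc s f)) L L' := by
  rw [ev_sigmaCc]
  by_cases h : Divisible (idealOf s) L ∧ Divisible (idealOf s) L'
  · obtain ⟨M, rfl⟩ := divisible_iff.1 h.1
    obtain ⟨M', rfl⟩ := divisible_iff.1 h.2
    rw [ev_thetaCc_mulL, ev_thetaCc_mulL, ev_sigmaCc, covolRatio_mulL]
  · rw [ev_thetaCc_of_not s _ h, ev_thetaCc_of_not s _ h, mul_zero]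

/-- Multiplying `φ` by `s` leaves `Λ` alone, hence also the covolume ratio; on functions the two
operations commute, and continuity does the rest. -/
theorem theta_sigma (s : Sgp K) (t : ℝ) (x : AK K) :
    theta s (sigma hdeg t x) = sigma hdeg t (theta s x) := by
  induction x using AK_induction with
  | hclosed =>
    exact isClosed_eq ((continuous_theta s).comp (continuous_sigma hdeg t))
      ((continuous_sigma hdeg t).comp (continuous_theta s))
  | hgen f =>
    rw [sigma_gen, theta_gen, theta_gen, sigma_gen]
    exact gen_congr (ev_thetaCc_sigmaCc hdeg s t f)
  | hadd x y hx hy => simp only [map_add, hx, hy]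
  | hsmul c x hx => simp only [map_smul, hx]
  | hmul x y hx hy => simp only [map_mul, hx, hy]
  | hstar x hx => simp only [map_star, hx]

end TimeEvolution

end CMSystem

/-! ### The proposition, assembled from the constructions. -/

open CMSystem in
theorem proposition3 (K : Type*) [Field K] [NumberField K] [Algebra K ℂ]
    (hdeg : Module.finrank ℚ K = 2) [NumberField.IsTotallyComplex K] :
    -- every `f ∈ C_c(G_K)` acts by left convolution, as an element `ι f` of `A_K`
    ∃ ι : C_c(GK K, ℂ) → AK K, (∀ f, IsConv f (ι f : Ops K)) ∧
    -- the time evolution, a strongly continuous one-parameter group of automorphisms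
    ∃ σ : Multiplicative ℝ →* (AK K ≃⋆ₐ[ℂ] AK K),
      (∀ t f, ∃ g, IsSigma t f g ∧ σ (Multiplicative.ofAdd t) (ι f) = ι g) ∧
      (∀ x, Continuous fun t : ℝ => σ (Multiplicative.ofAdd t) x) ∧
    -- the semigroup `Ô ∩ 𝔸_{K,f}^*` acts by endomorphisms
    ∃ θ : Sgp K →* (AK K →⋆ₙₐ[ℂ] AK K),
      (∀ s f, ∃ g, IsTheta s f g ∧ θ s (ι f) = ι g) ∧
      -- each of them is an isomorphism onto the reduced algebra `e_J A_K e_J`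
      (∀ s, Function.Injective (θ s) ∧ ∃ e, IsProj (idealOf s) e ∧
        star (ι e) = ι e ∧ ι e * ι e = ι e ∧
        Set.range (θ s) = {x | ∃ y, x = ι e * y * ι e}) ∧
      -- `Ô^*` acts by automorphisms
      (∀ s : Sgp K, (s : (Af K)ˣ)⁻¹ ∈ Sgp K → ∃ α : AK K ≃⋆ₐ[ℂ] AK K, ∀ x, θ s x = α x) ∧
      -- `𝓞^×` acts by inner endomorphisms, implemented by the isometries `μ_a`
      (∀ a : (𝓞 K)⁰, ∃ m, IsMu (a : 𝓞 K) m ∧ star (ι m) * ι m = 1 ∧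
        (∃ e, IsProj (idealOf (diag K a)) e ∧ ι m * star (ι m) = ι e) ∧
        ∀ x, θ (diag K a) x = ι m * x * star (ι m)) ∧
      -- the action commutes with the time evolution
      (∀ s t x, θ s (σ t x) = σ t (θ s x)) := by
  refine ⟨gen, isConv_convOp, sigmaHom hdeg,
    fun t f => ⟨sigmaCc hdeg t f, fun L L' _ => ev_sigmaCc hdeg t f L L', sigma_gen hdeg t f⟩,
    continuous_sigma_apply hdeg, thetaHom,
    fun s f => ⟨thetaCc s f, isTheta_thetaCc s f, theta_gen s f⟩,
    fun s => ⟨theta_injective s, projCc s, isProj_projCc s, star_gen_projCc s,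
      gen_projCc_mul_self s, range_theta s⟩,
    fun s hs => ⟨thetaEquiv s ⟨_, hs⟩ (Subtype.ext (mul_inv_cancel _)), fun _ => rfl⟩,
    fun a => ⟨muCc a, isMu_muCc a, star_gen_muCc_mul a,
      ⟨projCc (diag K a), isProj_projCc _, gen_muCc_mul_star a⟩, theta_diag a⟩,
    fun s t x => theta_sigma hdeg s t.toAdd x⟩
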